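/- Let $n\ge 2$, $s\in\mathbb R$ and $t>-n/2$. Let $T\mathbb S^{n-1}=\{(x,\xi)\in\mathbb R^n\times\mathbb R^n:\ |\xi|=1,\ \langle x,\xi\rangle=0\}$, and let $\mathcal S(T\mathbb S^{n-1})$ be the Schwartz space of smooth functions on this vector bundle over $\mathbb S^{n-1}$ that decay rapidly along the fibres together with all derivatives. For $f=(f_1,\dots,f_n)\in\mathcal S(\mathbb R^n;\mathbb C^n)$ and $k=0,1$ put $$(I^kf)(x,\xi)=\int_{-\infty}^\infty t^k\sum_{i=1}^n f_i(x+t\xi)\,\xi_i\,dt\qquad((x,\xi)\in T\mathbb S^{n-1}).$$ Let $\hat f(y)=(2\pi)^{-n/2}\int_{\mathbb R^n}e^{-i\langle y,x\rangle}f(x)\,dx$ on $\mathbb R^n$ (componentwise for vector fields), and $\hat\varphi(y,\xi)=(2\pi)^{-(n-1)/2}\int_{\xi^\perp}e^{-i\langle y,x\rangle}\varphi(x,\xi)\,dx$ on $T\mathbb S^{n-1}$. The Hilbert space $H^s_t(\mathbb R^n;\mathbb C^n)$ is the completion of $\mathcal S(\mathbb R^n;\mathbb C^n)$ with respect to the norm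 $$\|f\|^2_{H^s_t}=\int_{\mathbb R^n}|y|^{2t}(1+|y|^2)^{s-t}\sum_{i=1}^n|\hat f_i(y)|^2\,dy .$$ For real $s',t'$ write $$(\varphi,\psi)_{s',t'}=\frac1{2\pi}\int_{\mathbb S^{n-1}}\int_{\xi^\perp}|y|^{2t'}(1+|y|^2)^{s'-t'}\,\hat\varphi(y,\xi)\,\overline{\hat\psi(y,\xi)}\,dy\,d\xi,\qquad \|\varphi\|^2_{s',t'}=(\varphi,\varphi)_{s',t'} .$$ Let $\Xi_i$ $(1\le i\le n)$ be the restriction to $T\mathbb S^{n-1}$ of the vector field $\partial_{\xi_i}-x_i\sum_p\xi_p\partial_{x_p}-\xi_i\sum_p\xi_p\partial_{\xi_p}$ (which is tangent to $T\mathbb S^{n-1}$), and let $Z$ be the operator on $\mathcal S(T\mathbb S^{n-1})$ defined by $\widehat{Z\varphi}(y,\xi)=\sum_i\frac{y_i}{|y|}(\Xi_i\hat\varphi)(y,\xi)$. With $a_n=\Gamma\big(\tfrac{n-1}2\big)\big/\big(2\pi^{(n-1)/2}\big)$, put for $\varphi,\psi\in\mathcal S(T\mathbb S^{n-1})$ $$\|(\varphi,\psi)\|^2_{\mathcal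 H^{1,s}_t}=a_n\Big[\sum_{i=1}^n\|\Xi_i\varphi\|^2_{s+\frac12,t+\frac12}+\|\varphi\|^2_{s+\frac12,t+\frac12}+\|\psi\|^2_{s+\frac32,t+\frac32}+2\,\mathrm{Re}\,(iZ\varphi,\psi)_{s+1,t+1}\Big].$$ Then all the integrals in the definitions of these two squared norms converge absolutely; $\|(\varphi,\psi)\|^2_{\mathcal H^{1,s}_t}>0$ whenever $(\varphi,\psi)\ne(0,0)$; and $\|\cdot\|_{H^s_t}$ and $\|\cdot\|_{\mathcal H^{1,s}_t}$ are norms given by inner products on $\mathcal S(\mathbb R^n;\mathbb C^n)$ and on $\mathcal S(T\mathbb S^{n-1})\oplus\mathcal S(T\mathbb S^{n-1})$. Let the Hilbert space $\mathcal H^{1,s}_t(T\mathbb S^{n-1})$ be the completion of $\mathcal S(T\mathbb S^{n-1})\oplus\mathcal S(T\mathbb S^{n-1})$ with respect to $\|\cdot\|_{\mathcal H^{1,s}_t}$. The map $$\mathcal S(\mathbb R^n;\mathbb C^n)\to\mathcal S(T\mathbb S^{n-1})\oplus\mathcal S(T\mathbb S^{n-1}),\qquad f\mapsto(I^0f,I^1f)$$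 is well defined and linear, and it extends uniquely to a linear isometric embedding $$H^s_t(\mathbb R^n;\mathbb C^n)\to\mathcal H^{1,s}_t(T\mathbb S^{n-1});$$ that is, $\|f\|_{H^s_t(\mathbb R^n;\mathbb C^n)}=\|(I^0f,I^1f)\|_{\mathcal H^{1,s}_t(T\mathbb S^{n-1})}$ for all $f\in H^s_t(\mathbb R^n;\mathbb C^n)$, where $(I^0f,I^1f)$ denotes the image of $f$ under the extension. -/

import Mathlib

open MeasureTheory Metric
open scoped ContDiff InnerProductSpace SchwartzMap

noncomputable section

namespace MomentumRay

/-! ### Euclidean space, the manifold `T S^{n-1}`, integration over it -/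

/-- The space `ℝⁿ` with the Euclidean norm. -/
abbrev E (n : ℕ) : Type := EuclideanSpace ℝ (Fin n)

/-- The space `ℂⁿ` with the Hermitian norm. -/
abbrev Cn (n : ℕ) : Type := EuclideanSpace ℂ (Fin n)

/-- The unit sphere `S^{n-1}` of `ℝⁿ`. -/
abbrev Sph (n : ℕ) : Type := sphere (0 : E n) 1

/-- The hyperplane `ξ^⊥`. -/
abbrev perp {n : ℕ} (ξ : E n) : Submodule ℝ (E n) := (Submodule.span ℝ {ξ})ᗮ

/-- `T S^{n-1} = {(x, ξ) ∈ ℝⁿ × ℝⁿ : |ξ| = 1, ⟨x, ξ⟩ = 0}`. -/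
abbrev TS (n : ℕ) : Type := {p : E n × E n // ‖p.2‖ = 1 ∧ ⟪p.1, p.2⟫_ℝ = 0}

/-- The point `(x, ξ)` of `T S^{n-1}` for `ξ ∈ S^{n-1}` and `x ∈ ξ^⊥`. -/
def TS.mk {n : ℕ} (ξ : Sph n) (x : perp (ξ : E n)) : TS n :=
  ⟨((x : E n), (ξ : E n)), by
    refine ⟨by simp, ?_⟩
    have h := Submodule.mem_orthogonal_singleton_iff_inner_right.mp x.2
    rw [real_inner_comm]
    exact h⟩

/-- The base point `ξ` of `(x, ξ) ∈ T S^{n-1}`. -/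
def TS.base {n : ℕ} (p : TS n) : Sph n := ⟨p.1.2, by simp [p.2.1]⟩

/-- The retraction `(x, ξ) ↦ (x - (⟨ξ, x⟩ / |ξ|²) ξ, ξ / |ξ|)` of `ℝⁿ × (ℝⁿ ∖ 0)` onto
`T S^{n-1}`. -/
def TS.retract {n : ℕ} (p : E n × E n) (h : p.2 ≠ 0) : TS n :=
  ⟨(p.1 - (⟪p.2, p.1⟫_ℝ / ‖p.2‖ ^ 2) • p.2, ‖p.2‖⁻¹ • p.2), by
    have h0 : ‖p.2‖ ≠ 0 := norm_ne_zero_iff.mpr h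
    constructor
    · simp [norm_smul, h0]
    · simp only [inner_smul_right, inner_sub_left, inner_smul_left, real_inner_self_eq_norm_sq]
      rw [real_inner_comm]
      simp
      right
      field_simp
      ring⟩

open Classical in
/-- The canonical extension `(x, ξ) ↦ φ(x - (⟨ξ, x⟩ / |ξ|²) ξ, ξ / |ξ|)` of a function on
`T S^{n-1}` to `ℝⁿ × (ℝⁿ ∖ 0)`; its values at `ξ = 0` are irrelevant. -/
def ext {n : ℕ} (φ : TS n → ℂ) (p : E n × E n) : ℂ :=
  if h : p.2 ≠ 0 then φ (TS.retract p h) else 0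

/-- The iterated integral `∫_{S^{n-1}} ∫_{ξ^⊥} F(y, ξ) dy dξ`, with the surface measure on the
sphere and the `(n-1)`-dimensional Lebesgue measure on the hyperplane. -/
def tsIntegral {n : ℕ} (F : TS n → ℂ) : ℂ :=
  ∫ ξ : Sph n, (∫ y : perp (ξ : E n), F (TS.mk ξ y)) ∂(volume : Measure (E n)).toSphere

/-- Absolute convergence of the iterated integral `∫_{S^{n-1}} ∫_{ξ^⊥} F(y, ξ) dy dξ`. -/
def TSIntegrable {n : ℕ} (F : TS n → ℂ) : Prop :=
  (∀ ξ : Sph n, Integrable (fun y : perp (ξ : E n) => F (TS.mk ξ y))) ∧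
    Integrable (fun ξ : Sph n => ∫ y : perp (ξ : E n), ‖F (TS.mk ξ y)‖)
      (volume : Measure (E n)).toSphere

/-! ### The Schwartz space of `T S^{n-1}` -/

/-- Smooth functions on `T S^{n-1}` all of whose derivatives decay faster than any power of `|x|`
along the fibres. Derivatives are those of the canonical extension, evaluated on `T S^{n-1}`. -/
def IsSchwartz {n : ℕ} (φ : TS n → ℂ) : Prop :=
  ContDiffOn ℝ ∞ (ext φ) {p : E n × E n | p.2 ≠ 0} ∧
    ∀ k m : ℕ, ∃ C : ℝ, ∀ p : TS n, ‖p.1.1‖ ^ k * ‖iteratedFDeriv ℝ m (ext φ) p.1‖ ≤ C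

theorem ext_apply_coe {n : ℕ} (φ : TS n → ℂ) (p : TS n) : ext φ p.1 = φ p := by
  obtain ⟨⟨x, ξ⟩, h1, h2⟩ := p
  have h0 : ξ ≠ 0 := by
    rintro rfl
    simp at h1
  have h3 : ⟪ξ, x⟫_ℝ = 0 := by rw [real_inner_comm]; exact h2
  simp only at h1
  simp [ext, h0, TS.retract, h3, h1]

theorem ext_add {n : ℕ} (φ ψ : TS n → ℂ) : ext (φ + ψ) = ext φ + ext ψ := by
  funext p
  by_cases h : p.2 = 0 <;> simp [ext, h]

theorem ext_smul {n : ℕ} (c : ℂ) (φ : TS n → ℂ) : ext (c • φ) = c • ext φ := by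
  funext p
  by_cases h : p.2 = 0 <;> simp [ext, h]

theorem isOpen_ne {n : ℕ} : IsOpen {p : E n × E n | p.2 ≠ 0} :=
  isOpen_ne_fun continuous_snd continuous_const

theorem TS.snd_ne_zero {n : ℕ} (p : TS n) : p.1.2 ≠ 0 := by
  intro h
  have h1 := p.2.1
  rw [h] at h1
  simp at h1

theorem IsSchwartz.contDiffAt {n : ℕ} {φ : TS n → ℂ} (h : IsSchwartz φ) (p : TS n) (m : ℕ) :
    ContDiffAt ℝ m (ext φ) p.1 :=
  (h.1.contDiffAt (isOpen_ne.mem_nhds p.snd_ne_zero)).of_le (by exact_mod_cast le_top)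

/-- The Schwartz space `𝒮(T S^{n-1})`. -/
def SchwartzTS (n : ℕ) : Submodule ℂ (TS n → ℂ) where
  carrier := {φ | IsSchwartz φ}
  zero_mem' := by
    have h : ext (0 : TS n → ℂ) = fun _ => 0 := by
      funext p
      simp [ext]
    refine ⟨by rw [h]; exact contDiffOn_const, fun k m => ⟨0, fun p => ?_⟩⟩
    rw [h, iteratedFDeriv_fun_zero]
    simp
  add_mem' := by
    intro φ ψ hφ hψ
    refine ⟨by rw [ext_add]; exact hφ.1.add hψ.1, fun k m => ?_⟩
    obtain ⟨C, hC⟩ := hφ.2 k m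
    obtain ⟨D, hD⟩ := hψ.2 k m
    refine ⟨C + D, fun p => ?_⟩
    rw [ext_add, iteratedFDeriv_add_apply (hφ.contDiffAt p m) (hψ.contDiffAt p m)]
    calc _ ≤ ‖p.1.1‖ ^ k * (‖iteratedFDeriv ℝ m (ext φ) p.1‖
            + ‖iteratedFDeriv ℝ m (ext ψ) p.1‖) := by
          gcongr
          exact norm_add_le _ _
      _ ≤ C + D := by
          rw [mul_add]
          exact add_le_add (hC p) (hD p)
  smul_mem' := by
    intro c φ hφ
    refine ⟨by rw [ext_smul]; exact contDiffOn_const.smul hφ.1, fun k m => ?_⟩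
    obtain ⟨C, hC⟩ := hφ.2 k m
    refine ⟨‖c‖ * C, fun p => ?_⟩
    rw [ext_smul, iteratedFDeriv_const_smul_apply (hφ.contDiffAt p m), norm_smul]
    calc _ = ‖c‖ * (‖p.1.1‖ ^ k * ‖iteratedFDeriv ℝ m (ext φ) p.1‖) := by ring
      _ ≤ ‖c‖ * C := by
          gcongr
          exact hC p

/-! ### Momentum ray transforms -/

/-- `(I^k f)(x, ξ) = ∫ t^k ⟨f(x + t ξ), ξ⟩ dt` for a vector field `f : ℝⁿ → ℂⁿ`. -/
def momentum {n : ℕ} (k : ℕ) (f : E n → Cn n) (p : TS n) : ℂ :=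
  ∫ t : ℝ, (t : ℂ) ^ k * ∑ i, f (p.1.1 + t • p.1.2) i * (p.1.2 i : ℂ)

/-! ### Fourier transforms and the operators `Ξ_i`, `Z` -/

/-- `f̂(y) = (2π)^{-n/2} ∫ e^{-i⟨y,x⟩} f(x) dx` on `ℝⁿ`. -/
def fourierE {n : ℕ} (f : E n → ℂ) (y : E n) : ℂ :=
  (((2 * Real.pi) ^ (-(n : ℝ) / 2) : ℝ) : ℂ) *
    ∫ x : E n, Complex.exp (-Complex.I * (⟪y, x⟫_ℝ : ℂ)) * f x

/-- `φ̂(y, ξ) = (2π)^{-(n-1)/2} ∫_{ξ^⊥} e^{-i⟨y,x⟩} φ(x, ξ) dx` on `T S^{n-1}`. -/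
def fourierTS {n : ℕ} (φ : TS n → ℂ) (p : TS n) : ℂ :=
  (((2 * Real.pi) ^ (-((n : ℝ) - 1) / 2) : ℝ) : ℂ) *
    ∫ x : perp (p.base : E n),
      Complex.exp (-Complex.I * (⟪p.1.1, (x : E n)⟫_ℝ : ℂ)) * φ (TS.mk p.base x)

/-- The vector field
`Ξ_i = ∂/∂ξ^i - x_i ξ^p ∂/∂x^p - ξ_i ξ^p ∂/∂ξ^p`, which is tangent to `T S^{n-1}`, acting on
functions on `T S^{n-1}` (through the canonical extension to a neighbourhood). -/
def Xi {n : ℕ} (i : Fin n) (φ : TS n → ℂ) (p : TS n) : ℂ :=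
  fderiv ℝ (ext φ) p.1
    (-(p.1.1 i • p.1.2), EuclideanSpace.single i (1 : ℝ) - p.1.2 i • p.1.2)

/-- The Fourier transform of `Z φ`, by which the operator `Z` is defined:
`(Zφ)^(y, ξ) = (y^i / |y|) (Ξ_i φ̂)(y, ξ)`. -/
def fourierZ {n : ℕ} (φ : TS n → ℂ) (p : TS n) : ℂ :=
  ∑ i, ((p.1.1 i / ‖p.1.1‖ : ℝ) : ℂ) * Xi i (fourierTS φ) p

/-! ### The norms -/

/-- The weight `|y|^{2t} (1 + |y|²)^{s-t}`. -/
def weight {n : ℕ} (s t : ℝ) (y : E n) : ℝ := ‖y‖ ^ (2 * t) * (1 + ‖y‖ ^ 2) ^ (s - t)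

/-- The integrand of the squared `H^s_t(ℝⁿ; ℂⁿ)`-norm: `|y|^{2t} (1 + |y|²)^{s-t} ∑_i |f̂_i(y)|²`. -/
def hstIntegrand {n : ℕ} (s t : ℝ) (f : E n → Cn n) (y : E n) : ℝ :=
  weight s t y * ∑ i, ‖fourierE (fun x => f x i) y‖ ^ 2

/-- The squared norm of `H^s_t(ℝⁿ; ℂⁿ)`. -/
def hstNormSq {n : ℕ} (s t : ℝ) (f : E n → Cn n) : ℝ := ∫ y, hstIntegrand s t f y

/-- The integrand of the `H^s_t(T S^{n-1})`-inner product of two functions whose Fourier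
transforms are `u` and `v`. -/
def tsIntegrand {n : ℕ} (s t : ℝ) (u v : TS n → ℂ) (p : TS n) : ℂ :=
  (weight s t p.1.1 : ℂ) * (u p * (starRingEnd ℂ) (v p))

/-- The `H^s_t(T S^{n-1})`-inner product (linear in the first argument) of two functions whose
Fourier transforms are `u` and `v`. -/
def tsInner {n : ℕ} (s t : ℝ) (u v : TS n → ℂ) : ℂ :=
  (1 / (2 * Real.pi) : ℝ) * tsIntegral (tsIntegrand s t u v)

/-- The squared norm of `H^s_t(T S^{n-1})`. -/
def tsNormSq {n : ℕ} (s t : ℝ) (φ : TS n → ℂ) : ℝ :=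
  (tsInner s t (fourierTS φ) (fourierTS φ)).re

/-- `a_n = Γ((n-1)/2) / (2 π^{(n-1)/2})`. -/
def aConst (n : ℕ) : ℝ :=
  Real.Gamma (((n : ℝ) - 1) / 2) / (2 * Real.pi ^ (((n : ℝ) - 1) / 2))

/-- The squared norm of `ℋ^{1,s}_t(T S^{n-1})` on pairs `(φ, ψ)`:
`a_n [∑_i ‖Ξ_i φ‖² + ‖φ‖² + ‖ψ‖² + 2 Re (i Z φ, ψ)]`, where the first two norms are taken in
`H^{s+1/2}_{t+1/2}`, the third one in `H^{s+3/2}_{t+3/2}` and the inner product in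
`H^{s+1}_{t+1}`. -/
def calHNormSq {n : ℕ} (s t : ℝ) (φ ψ : TS n → ℂ) : ℝ :=
  aConst n * ((∑ i, tsNormSq (s + 1 / 2) (t + 1 / 2) (Xi i φ))
    + tsNormSq (s + 1 / 2) (t + 1 / 2) φ
    + tsNormSq (s + 3 / 2) (t + 3 / 2) ψ
    + 2 * (tsInner (s + 1) (t + 1) (fun p => Complex.I * fourierZ φ p) (fourierTS ψ)).re)

/-- All integrals that occur in the squared norm of `ℋ^{1,s}_t(T S^{n-1})` converge absolutely. -/
def CalHConverges {n : ℕ} (s t : ℝ) (φ ψ : TS n → ℂ) : Prop :=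
  (∀ i, TSIntegrable
    (tsIntegrand (s + 1 / 2) (t + 1 / 2) (fourierTS (Xi i φ)) (fourierTS (Xi i φ)))) ∧
  TSIntegrable (tsIntegrand (s + 1 / 2) (t + 1 / 2) (fourierTS φ) (fourierTS φ)) ∧
  TSIntegrable (tsIntegrand (s + 3 / 2) (t + 3 / 2) (fourierTS ψ) (fourierTS ψ)) ∧
  TSIntegrable
    (tsIntegrand (s + 1) (t + 1) (fun p => Complex.I * fourierZ φ p) (fourierTS ψ))

/-! ### Hilbert space completions -/

section Completion

variable {V : Type*} [AddCommGroup V] [Module ℂ V]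

/-- The vector space `V` with the norm of a (positive definite) inner product `c`. -/
def PreHilbert (_c : InnerProductSpace.Core ℂ V) : Type _ := V

instance (c : InnerProductSpace.Core ℂ V) : NormedAddCommGroup (PreHilbert c) :=
  @InnerProductSpace.Core.toNormedAddCommGroup ℂ V _ _ _ c

instance (c : InnerProductSpace.Core ℂ V) : InnerProductSpace ℂ (PreHilbert c) :=
  @InnerProductSpace.ofCore ℂ V _ _ _ c.toCore

/-- The Hilbert space obtained by completing `V` with respect to the inner product `c`. -/
abbrev HilbertCompletion (c : InnerProductSpace.Core ℂ V) : Type _ :=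
  UniformSpace.Completion (PreHilbert c)

/-- The canonical map from `V` to its completion. -/
def toCompletion (c : InnerProductSpace.Core ℂ V) (v : V) : HilbertCompletion c :=
  ((show PreHilbert c from v : PreHilbert c) : UniformSpace.Completion (PreHilbert c))

end Completion

end MomentumRay

end

noncomputable section

namespace MomentumRay

section

/-! ### Integration over `T S^{n-1}` -/

open Set ENNReal

variable {n : ℕ}

/-! On the Fourier side the isometry is a pointwise identity followed by one integration formula.
Write u and v for the fibrewise Fourier transforms of I⁰f and I¹f. Splitting ℝⁿ as ξ^⊥ × ℝξ gives
the slice formulas u = √(2π) ⟨f̂(y), ξ⟩ and v = √(2π) i ⟨∂_ξ f̂(y), ξ⟩ for y ⊥ ξ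
(`fourierTS_momentum_zero`, `fourierTS_momentum_one`). Applying Ξ_i to u produces √(2π) (f̂_i - ξ_i
⟨f̂, ξ⟩ - y_i ⟨∂_ξ f̂, ξ⟩), and the last term is cancelled by -i y_i v. Hence u and the vector (Ξ_i
u - i y_i v)_i are √(2π) times the components of f̂(y) along ξ and orthogonal to ξ, so that |u|² +
∑_i |Ξ_i u - i y_i v|² = 2π |f̂(y)|² by Pythagoras (`norm_sq_dataVec_momentum`).

For arbitrary (φ, ψ), expanding the same sum of squares gives the bracket in the definition of the
ℋ-norm: the cross terms make up the Z-term, and the powers of |y| account for the shifts 1/2, 1, 3/2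
of the indices (`weight_mul_norm_sq_dataVec`). This uses that Ξ_i commutes with the fibrewise
Fourier transform (`IsSchwartz.xi_fourierTS`). The ℋ-norm is therefore a weighted L²-norm of the
vector `dataVec`, linear in (φ, ψ). It comes from an inner product, and definiteness follows from
continuity and Fourier inversion on the fibres.

It remains to integrate a function of y alone over T S^{n-1}. The measures dy dx/|x| and dx dy/|y|
on pairs of orthogonal vectors coincide (`lintegral_incidence_symm`), whence a_n ∫∫ h(y) dy dξ = ∫
h(y) dy/|y|, where a_n is the reciprocal of the area of S^{n-2} (`lintegral_tsMeasure_fst`). The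
factor 1/|y| is absorbed by the shift of t by 1/2. The extension to the completions is by density.
-/

theorem inner_coe_perp {ξ : E n} (x : perp ξ) : ⟪ξ, (x : E n)⟫_ℝ = 0 :=
  Submodule.mem_orthogonal_singleton_iff_inner_right.mp x.2

theorem inner_perp_coe {ξ : E n} (x : perp ξ) : ⟪(x : E n), ξ⟫_ℝ = 0 := by
  rw [real_inner_comm]
  exact inner_coe_perp x

/-- The isometry `(x, t) ↦ x + t ξ` of `ξ^⊥ × ℝ` onto `ℝⁿ`, for a unit vector `ξ`. -/
def slabEquiv (ξ : E n) (hξ : ‖ξ‖ = 1) : WithLp 2 (perp ξ × ℝ) ≃ₗᵢ[ℝ] E n where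
  toFun p := (p.fst : E n) + p.snd • ξ
  invFun z := WithLp.toLp 2 (⟨z - ⟪ξ, z⟫_ℝ • ξ, by
    rw [Submodule.mem_orthogonal_singleton_iff_inner_right, inner_sub_right, inner_smul_right,
      real_inner_self_eq_norm_sq, hξ]
    ring⟩, ⟪ξ, z⟫_ℝ)
  map_add' p q := by simp [add_smul]; abel
  map_smul' c p := by simp [mul_smul]
  left_inv p := by
    have h : ⟪ξ, (p.fst : E n) + p.snd • ξ⟫_ℝ = p.snd := by
      rw [inner_add_right, inner_smul_right, inner_coe_perp, real_inner_self_eq_norm_sq, hξ]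
      ring
    apply (WithLp.equiv 2 (perp ξ × ℝ)).injective
    refine Prod.ext (Subtype.ext ?_) ?_
    · simp [h]
    · simp [h]
  right_inv z := by simp
  norm_map' p := by
    have h1 : ‖(p.fst : E n) + p.snd • ξ‖ ^ 2 = ‖p‖ ^ 2 := by
      rw [norm_add_sq_real, inner_smul_right, inner_perp_coe, norm_smul, hξ,
        WithLp.prod_norm_sq_eq_of_L2]
      simp
    exact (sq_eq_sq₀ (norm_nonneg _) (norm_nonneg _)).mp h1

theorem measurePreserving_slab (ξ : E n) (hξ : ‖ξ‖ = 1) :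
    MeasurePreserving (fun p : perp ξ × ℝ => (p.1 : E n) + p.2 • ξ) :=
  (slabEquiv ξ hξ).measurePreserving.comp (WithLp.volume_preserving_toLp (perp ξ) ℝ)

theorem measurableEmbedding_slab (ξ : E n) (hξ : ‖ξ‖ = 1) :
    MeasurableEmbedding (fun p : perp ξ × ℝ => (p.1 : E n) + p.2 • ξ) :=
  (slabEquiv ξ hξ).toHomeomorph.measurableEmbedding.comp
    (MeasurableEquiv.toLp 2 (perp ξ × ℝ)).measurableEmbedding

theorem lintegral_slab (ξ : E n) (hξ : ‖ξ‖ = 1) {g : E n → ℝ≥0∞} (hg : Measurable g) :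
    ∫⁻ z, g z = ∫⁻ x : perp ξ, ∫⁻ t : ℝ, g ((x : E n) + t • ξ) := by
  rw [← (measurePreserving_slab ξ hξ).lintegral_comp hg, Measure.volume_eq_prod, lintegral_prod]
  exact (hg.comp (measurePreserving_slab ξ hξ).measurable).aemeasurable

/-- The point of `T S^{n-1}` over `ξ` that is the orthogonal projection of `z`. -/
def TS.proj (q : Sph n × E n) : TS n :=
  TS.retract (q.2, (q.1 : E n)) (by
    intro h
    have h1 : ‖(q.1 : E n)‖ = 1 := by simp
    simp only at h
    rw [h] at h1
    simp at h1)

theorem TS.coe_proj (q : Sph n × E n) :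
    (TS.proj q).1 = (q.2 - ⟪(q.1 : E n), q.2⟫_ℝ • (q.1 : E n), (q.1 : E n)) := by
  simp [TS.proj, TS.retract]

theorem TS.proj_add_smul (ξ : Sph n) (x : perp (ξ : E n)) (t : ℝ) :
    TS.proj (ξ, (x : E n) + t • (ξ : E n)) = TS.mk ξ x := by
  apply Subtype.ext
  rw [TS.coe_proj]
  simp [TS.mk, inner_add_right, inner_smul_right, inner_coe_perp]

theorem TS.continuous_proj : Continuous (TS.proj (n := n)) := by
  rw [continuous_induced_rng]
  have : (Subtype.val ∘ TS.proj (n := n)) = fun q =>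
      (q.2 - ⟪(q.1 : E n), q.2⟫_ℝ • (q.1 : E n), (q.1 : E n)) := funext TS.coe_proj
  rw [this]
  fun_prop

theorem TS.continuous_mk (ξ : Sph n) : Continuous (TS.mk ξ) := by
  rw [continuous_induced_rng]
  have : (Subtype.val ∘ TS.mk ξ) = fun x : perp (ξ : E n) => ((x : E n), (ξ : E n)) := rfl
  rw [this]
  fun_prop

/-- The set of `(ξ, z)` with `0 < ⟨ξ, z⟩ < 1`. -/
def slab (n : ℕ) : Set (Sph n × E n) := {q | ⟪(q.1 : E n), q.2⟫_ℝ ∈ Ioo (0 : ℝ) 1}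

theorem measurableSet_slab : MeasurableSet (slab n) := by
  have h : Measurable fun q : Sph n × E n => ⟪(q.1 : E n), q.2⟫_ℝ :=
    Continuous.measurable (by fun_prop)
  exact h measurableSet_Ioo

/-- The measure `dy dξ` on `T S^{n-1}`. -/
def tsMeasure (n : ℕ) : Measure (TS n) :=
  (((volume : Measure (E n)).toSphere.prod volume).restrict (slab n)).map TS.proj

theorem inner_slab (ξ : Sph n) (x : perp (ξ : E n)) (t : ℝ) :
    ⟪(ξ : E n), (x : E n) + t • (ξ : E n)⟫_ℝ = t := by
  rw [inner_add_right, inner_smul_right, inner_coe_perp]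
  simp

/-- The fibres ξ^⊥ vary with ξ, so `dy dξ` is not a product measure. Thickening each fibre to a slab
of width 1 in the direction ξ does not change fibre integrals and places all of them in the one
space ℝⁿ. Measurability in ξ and Fubini's theorem then come from the product of the sphere and ℝⁿ.
-/
theorem lintegral_perp_eq {F : TS n → ℝ≥0∞} (hF : Measurable F) (ξ : Sph n) :
    ∫⁻ x : perp (ξ : E n), F (TS.mk ξ x) =
      ∫⁻ z, (slab n).indicator (fun q => F (TS.proj q)) (ξ, z) := by
  rw [lintegral_slab (ξ : E n) (by simp)
    (g := fun z => (slab n).indicator (fun q => F (TS.proj q)) (ξ, z))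
    (((hF.comp TS.continuous_proj.measurable).indicator
      measurableSet_slab).comp measurable_prodMk_left)]
  refine lintegral_congr fun x => ?_
  have : ∀ t : ℝ, (slab n).indicator (fun q => F (TS.proj q)) (ξ, (x : E n) + t • (ξ : E n)) =
      (Ioo (0 : ℝ) 1).indicator (fun _ => F (TS.mk ξ x)) t := by
    intro t
    simp only [indicator, slab, mem_ofPred_eq, TS.proj_add_smul, inner_slab]
  simp only [this]
  rw [lintegral_indicator measurableSet_Ioo]
  simp

theorem measurable_lintegral_perp {F : TS n → ℝ≥0∞} (hF : Measurable F) :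
    Measurable fun ξ : Sph n => ∫⁻ x : perp (ξ : E n), F (TS.mk ξ x) := by
  simp only [lintegral_perp_eq hF]
  exact ((hF.comp TS.continuous_proj.measurable).indicator measurableSet_slab).lintegral_prod_right'

theorem lintegral_tsMeasure {F : TS n → ℝ≥0∞} (hF : Measurable F) :
    ∫⁻ p, F p ∂tsMeasure n =
      ∫⁻ ξ : Sph n, (∫⁻ x : perp (ξ : E n), F (TS.mk ξ x)) ∂(volume : Measure (E n)).toSphere := by
  rw [tsMeasure, lintegral_map hF TS.continuous_proj.measurable,
    ← lintegral_indicator measurableSet_slab, lintegral_prod]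
  · exact lintegral_congr fun ξ => (lintegral_perp_eq hF ξ).symm
  · exact ((hF.comp TS.continuous_proj.measurable).indicator measurableSet_slab).aemeasurable

section

variable {G : Type*} [NormedAddCommGroup G] [NormedSpace ℝ G]

theorem integral_perp_eq (F : TS n → G) (ξ : Sph n) :
    ∫ x : perp (ξ : E n), F (TS.mk ξ x) =
      ∫ z, (slab n).indicator (fun q => F (TS.proj q)) (ξ, z) := by
  rw [← (measurePreserving_slab (ξ : E n) (by simp)).integral_comp
    (measurableEmbedding_slab (ξ : E n) (by simp))]
  have : ∀ p : perp (ξ : E n) × ℝ,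
      (slab n).indicator (fun q => F (TS.proj q)) (ξ, (p.1 : E n) + p.2 • (ξ : E n)) =
      (Ioo (0 : ℝ) 1).indicator (fun _ => (1 : ℝ)) p.2 • F (TS.mk ξ p.1) := by
    intro p
    simp only [indicator, slab, mem_ofPred_eq, TS.proj_add_smul, inner_slab]
    split_ifs <;> simp
  simp only [this]
  rw [Measure.volume_eq_prod, ← integral_prod_swap]
  simp only [Prod.snd_swap, Prod.fst_swap]
  rw [integral_prod_smul (f := (Ioo (0 : ℝ) 1).indicator (fun _ => (1 : ℝ)))
    (g := fun x => F (TS.mk ξ x)), integral_indicator measurableSet_Ioo]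
  simp

theorem integral_tsMeasure {F : TS n → G} (hF : Integrable F (tsMeasure n)) :
    ∫ p, F p ∂tsMeasure n =
      ∫ ξ : Sph n, (∫ x : perp (ξ : E n), F (TS.mk ξ x)) ∂(volume : Measure (E n)).toSphere := by
  rw [tsMeasure] at hF ⊢
  rw [integral_map TS.continuous_proj.measurable.aemeasurable hF.aestronglyMeasurable]
  have h1 := hF.comp_measurable TS.continuous_proj.measurable
  rw [← integral_indicator measurableSet_slab, integral_prod]
  · exact integral_congr_ae (.of_forall fun ξ => (integral_perp_eq F ξ).symm)
  · exact (integrable_indicator_iff measurableSet_slab).mpr h1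

end

/-- The clause on the fibres stays on the right because integrability for `tsMeasure` controls
almost every fibre only, while `TSIntegrable` asks for all of them. -/
theorem tsIntegrable_iff {F : TS n → ℂ} (hF : Measurable F) :
    TSIntegrable F ↔ (∀ ξ : Sph n, Integrable (fun y : perp (ξ : E n) => F (TS.mk ξ y))) ∧
      Integrable F (tsMeasure n) := by
  refine and_congr_right fun h => ?_
  have hm : Measurable fun p => ‖F p‖ₑ := hF.enorm
  have h1 : ∀ ξ : Sph n, ENNReal.ofReal (∫ y : perp (ξ : E n), ‖F (TS.mk ξ y)‖) =
      ∫⁻ y : perp (ξ : E n), ‖F (TS.mk ξ y)‖ₑ := fun ξ =>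
    ofReal_integral_norm_eq_lintegral_enorm (h ξ)
  have h2 : ∀ ξ : Sph n, ∫ y : perp (ξ : E n), ‖F (TS.mk ξ y)‖ =
      (∫⁻ y : perp (ξ : E n), ‖F (TS.mk ξ y)‖ₑ).toReal := fun ξ => by
    rw [← h1, ENNReal.toReal_ofReal (integral_nonneg fun _ => norm_nonneg _)]
  have h3 : ∀ ξ : Sph n, ‖∫ y : perp (ξ : E n), ‖F (TS.mk ξ y)‖‖ₑ =
      ∫⁻ y : perp (ξ : E n), ‖F (TS.mk ξ y)‖ₑ := fun ξ => by
    rw [← h1, Real.enorm_of_nonneg (integral_nonneg fun _ => norm_nonneg _)]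
  constructor
  · intro h4
    refine ⟨hF.aestronglyMeasurable, ?_⟩
    rw [HasFiniteIntegral, lintegral_tsMeasure hm]
    simpa only [HasFiniteIntegral, h3] using h4.2
  · intro h4
    refine ⟨?_, ?_⟩
    · simp only [h2]
      exact (measurable_lintegral_perp hm).ennreal_toReal.aestronglyMeasurable
    · simp only [HasFiniteIntegral, h3]
      rw [← lintegral_tsMeasure hm]
      exact h4.2

theorem TSIntegrable.tsIntegral_eq {F : TS n → ℂ} (hF : Measurable F) (h : TSIntegrable F) :
    tsIntegral F = ∫ p, F p ∂tsMeasure n :=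
  (integral_tsMeasure ((tsIntegrable_iff hF).mp h).2).symm

end

section

/-! ### The integral geometric formula for the incidence relation `⟨x, y⟩ = 0` -/

open Set ENNReal

variable {n : ℕ}

theorem lintegral_comp_affine {F : ℝ → ℝ≥0∞} (hF : Measurable F) {c : ℝ} (hc : c ≠ 0) (b : ℝ) :
    ∫⁻ a, F (a * c + b) = ENNReal.ofReal |c⁻¹| * ∫⁻ t, F t := by
  have h1 : Measurable fun a => F (a + b) := hF.comp (measurable_id.add_const b)
  rw [← lintegral_map (f := fun a => F (a + b)) h1 (g := (· * c)) (measurable_id.mul_const c),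
    Real.map_volume_mul_right hc,
    lintegral_smul_measure, lintegral_add_right_eq_self (μ := volume) F b, smul_eq_mul]

/-- The hyperplane `ξ^⊥` parametrized as a graph over the hyperplane `e^⊥`. -/
theorem lintegral_perp_graph {e ξ : E n} (he : ‖e‖ = 1) (hξ : ‖ξ‖ = 1) (hc : ⟪ξ, e⟫_ℝ ≠ 0)
    {h : E n → ℝ≥0∞} (hh : Measurable h) :
    ∫⁻ x : perp ξ, h x = ENNReal.ofReal |(⟪ξ, e⟫_ℝ)⁻¹| *
      ∫⁻ w : perp e, h ((w : E n) - (⟪(w : E n), ξ⟫_ℝ / ⟪ξ, e⟫_ℝ) • e) := by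
  set c := ⟪ξ, e⟫_ℝ with hcdef
  set I : ℝ → ℝ≥0∞ := (Ioo (0 : ℝ) 1).indicator 1 with hI
  have hIm : Measurable I := measurable_one.indicator measurableSet_Ioo
  have hee : ⟪e, e⟫_ℝ = 1 := by rw [real_inner_self_eq_norm_sq, he]; norm_num
  have hxx : ⟪ξ, ξ⟫_ℝ = 1 := by rw [real_inner_self_eq_norm_sq, hξ]; norm_num
  have hex : ⟪e, ξ⟫_ℝ = c := real_inner_comm _ _
  have hI1 : ∫⁻ t, I t = 1 := by
    rw [hI, lintegral_indicator measurableSet_Ioo]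
    simp
  -- The function h on ξ^⊥ is spread over ℝⁿ with unit mass in the direction ξ. Its integral over ℝⁿ
  -- is then computed in slab coordinates along ξ and along e, and the two results are compared.
  have hG : Measurable fun z : E n => I ⟪z, ξ⟫_ℝ * h (z - ⟪z, ξ⟫_ℝ • ξ) := by
    have h1 : Measurable fun z : E n => ⟪z, ξ⟫_ℝ := Continuous.measurable (by fun_prop)
    have h2 : Measurable fun z : E n => z - ⟪z, ξ⟫_ℝ • ξ := Continuous.measurable (by fun_prop)
    exact (hIm.comp h1).mul (hh.comp h2)
  have key := (lintegral_slab ξ hξ hG).symm.trans (lintegral_slab e he hG)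
  have hL : ∀ (x : perp ξ) (t : ℝ), I ⟪(x : E n) + t • ξ, ξ⟫_ℝ *
      h ((x : E n) + t • ξ - ⟪(x : E n) + t • ξ, ξ⟫_ℝ • ξ) = I t * h x := by
    intro x t
    rw [inner_add_left, inner_smul_left, inner_perp_coe, hxx]
    simp
  simp only [hL] at key
  have hL2 : ∀ x : perp ξ, ∫⁻ t, I t * h x = h x := fun x => by
    rw [lintegral_mul_const _ hIm, hI1, one_mul]
  simp only [hL2] at key
  rw [key]
  set ξ' : perp e := ⟨ξ - c • e, by
    rw [Submodule.mem_orthogonal_singleton_iff_inner_right, inner_sub_right, inner_smul_right,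
      hee, hex]
    ring⟩ with hξ'
  have hwξ : ∀ w : perp e, ⟪(w : E n), (ξ' : E n)⟫_ℝ = ⟪(w : E n), ξ⟫_ℝ := fun w => by
    rw [hξ', inner_sub_right, inner_smul_right, inner_perp_coe]
    simp
  have hξ'ξ : ⟪(ξ' : E n), ξ⟫_ℝ = 1 - c ^ 2 := by
    rw [hξ', inner_sub_left, inner_smul_left, hxx, hex]
    simp
    ring
  have hR : ∀ w : perp e, ∫⁻ a : ℝ, I ⟪(w : E n) + a • e, ξ⟫_ℝ *
      h ((w : E n) + a • e - ⟪(w : E n) + a • e, ξ⟫_ℝ • ξ) =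
      ENNReal.ofReal |c⁻¹| * ∫⁻ t : ℝ, I t *
        h ((w : E n) + ((t - ⟪(w : E n), ξ⟫_ℝ) / c) • e - t • ξ) := by
    intro w
    have hm : Measurable fun t : ℝ => I t *
        h ((w : E n) + ((t - ⟪(w : E n), ξ⟫_ℝ) / c) • e - t • ξ) :=
      hIm.mul (hh.comp (Continuous.measurable (by fun_prop)))
    rw [← lintegral_comp_affine hm hc ⟪(w : E n), ξ⟫_ℝ]
    refine lintegral_congr fun a => ?_
    have h1 : ⟪(w : E n) + a • e, ξ⟫_ℝ = a * c + ⟪(w : E n), ξ⟫_ℝ := by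
      rw [inner_add_left, inner_smul_left, hex]
      simp
      ring
    rw [h1]
    congr 5
    field_simp
    ring
  simp only [hR]
  have hm2 : Measurable fun q : perp e × ℝ => I q.2 *
      h ((q.1 : E n) + ((q.2 - ⟪(q.1 : E n), ξ⟫_ℝ) / c) • e - q.2 • ξ) := by
    refine (hIm.comp measurable_snd).mul (hh.comp (Continuous.measurable ?_))
    fun_prop
  rw [lintegral_const_mul _ hm2.lintegral_prod_right']
  congr 1
  rw [lintegral_lintegral_swap hm2.aemeasurable]
  have hshift : ∀ t : ℝ, ∫⁻ w : perp e, I t *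
      h ((w : E n) + ((t - ⟪(w : E n), ξ⟫_ℝ) / c) • e - t • ξ) =
      I t * ∫⁻ w : perp e, h ((w : E n) - (⟪(w : E n), ξ⟫_ℝ / c) • e) := by
    intro t
    -- Translating w by t times the projection ξ' of ξ to e^⊥ turns the integrand for t into the one
    -- for 0, so the variable t separates.
    rw [← lintegral_add_right_eq_self (μ := (volume : Measure (perp e))) _ (t • ξ'),
      ← lintegral_const_mul]
    · refine lintegral_congr fun w => ?_
      congr 2
      have h2 : ⟪((w + t • ξ' : perp e) : E n), ξ⟫_ℝ = ⟪(w : E n), ξ⟫_ℝ + t * (1 - c ^ 2) := by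
        rw [Submodule.coe_add, Submodule.coe_smul, inner_add_left, inner_smul_left, hξ'ξ]
        simp
      rw [h2]
      have h3 : ((w + t • ξ' : perp e) : E n) = (w : E n) + t • ξ - (t * c) • e := by
        rw [Submodule.coe_add, Submodule.coe_smul, hξ', smul_sub, smul_smul]
        abel
      rw [h3]
      have h4 : (t - (⟪(w : E n), ξ⟫_ℝ + t * (1 - c ^ 2))) / c = t * c - ⟪(w : E n), ξ⟫_ℝ / c := by
        field_simp
        ring
      rw [h4, sub_smul]
      abel
    · exact hh.comp (Continuous.measurable (by fun_prop))
  simp only [hshift]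
  rw [lintegral_mul_const _ hIm, hI1, one_mul]

theorem perp_smul_eq {x : E n} {r : ℝ} (hr : r ≠ 0) : perp (r • x) = perp x := by
  rw [perp, Submodule.span_singleton_smul_eq (IsUnit.mk0 r hr)]

theorem lintegral_perp_smul {x : E n} {r : ℝ} (hr : r ≠ 0) (h : E n → ℝ≥0∞) :
    ∫⁻ y : perp (r • x), h y = ∫⁻ y : perp x, h y := by
  rw [perp_smul_eq hr]

/-- Normalizing x brings a factor |x| into the Jacobian of the graph parametrization. The weight
1/|x| cancels it and leaves 1/|⟨x, e⟩|. This is where the density of the incidence measure comes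
from. -/
theorem lintegral_perp_graph' {e x : E n} (he : ‖e‖ = 1) (hc : ⟪x, e⟫_ℝ ≠ 0)
    {h : E n → ℝ≥0∞} (hh : Measurable h) :
    ‖x‖ₑ⁻¹ * ∫⁻ y : perp x, h y = ENNReal.ofReal |(⟪x, e⟫_ℝ)⁻¹| *
      ∫⁻ w : perp e, h ((w : E n) - (⟪(w : E n), x⟫_ℝ / ⟪x, e⟫_ℝ) • e) := by
  have hx : x ≠ 0 := by
    rintro rfl
    simp at hc
  have hx0 : ‖x‖ ≠ 0 := norm_ne_zero_iff.mpr hx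
  have hr : ‖x‖⁻¹ ≠ 0 := inv_ne_zero hx0
  rw [← lintegral_perp_smul hr h, lintegral_perp_graph (e := e) (ξ := ‖x‖⁻¹ • x) he
    (norm_smul_inv_norm (𝕜 := ℝ) hx) (by rw [inner_smul_left]; simp [hx, hc]) hh]
  have h1 : ⟪‖x‖⁻¹ • x, e⟫_ℝ = ‖x‖⁻¹ * ⟪x, e⟫_ℝ := by rw [inner_smul_left]; simp
  have h2 : ∀ w : E n, ⟪w, ‖x‖⁻¹ • x⟫_ℝ / (‖x‖⁻¹ * ⟪x, e⟫_ℝ) = ⟪w, x⟫_ℝ / ⟪x, e⟫_ℝ := by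
    intro w
    rw [inner_smul_right]
    field_simp
  simp only [h1, h2]
  rw [← mul_assoc]
  congr 1
  rw [mul_inv, inv_inv, abs_mul, abs_of_nonneg (norm_nonneg x),
    ENNReal.ofReal_mul (norm_nonneg x), ← mul_assoc, ofReal_norm,
    ENNReal.inv_mul_cancel (by simpa using hx) (by simp), one_mul]

/-- The involution a ↦ -c/a preserves da/|a|: its derivative is c/a², and |c/a²| · |a/c| = 1/|a|. -/
theorem lintegral_inversion {c : ℝ} (hc : c ≠ 0) (F : ℝ → ℝ → ℝ≥0∞) :
    ∫⁻ a : ℝ, ENNReal.ofReal |a⁻¹| * F a (-(c / a)) =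
      ∫⁻ b : ℝ, ENNReal.ofReal |b⁻¹| * F (-(c / b)) b := by
  have h0 : ∀ g : ℝ → ℝ≥0∞, ∫⁻ a, g a = ∫⁻ a in ({0}ᶜ : Set ℝ), g a := fun g => by
    rw [restrict_compl_singleton]
  have himage : (fun a : ℝ => -(c / a)) '' {0}ᶜ = {0}ᶜ := by
    ext b
    constructor
    · rintro ⟨a, ha, rfl⟩
      simpa [hc] using ha
    · intro hb
      have hb' : b ≠ 0 := hb
      refine ⟨-(c / b), by simp [hc, hb'], ?_⟩
      field_simp
  rw [h0, h0 (fun b => ENNReal.ofReal |b⁻¹| * F (-(c / b)) b)]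
  conv_rhs => rw [← himage]
  rw [lintegral_image_eq_lintegral_abs_deriv_mul (measurableSet_singleton 0).compl
    (f' := fun a => c / a ^ 2)]
  · refine setLIntegral_congr_fun (measurableSet_singleton 0).compl fun a ha => ?_
    have ha' : a ≠ 0 := ha
    have h1 : -(c / -(c / a)) = a := by field_simp
    simp only [h1]
    rw [← mul_assoc, ← ENNReal.ofReal_mul (abs_nonneg _), ← abs_mul]
    congr 2
    rw [← abs_neg]
    congr 1
    field_simp
  · intro a ha
    have ha' : a ≠ 0 := ha
    have h1 := ((hasDerivAt_inv ha').const_mul c).neg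
    have h2 : HasDerivAt (fun a : ℝ => -(c / a)) (c / a ^ 2) a := by
      convert! h1 using 1
      field_simp
    exact h2.hasDerivWithinAt
  · intro a ha b hb hab
    have ha' : a ≠ 0 := ha
    have hb' : b ≠ 0 := hb
    simp only at hab
    field_simp at hab
    linarith

end

/-! ### Symmetry of the incidence measure and integration of functions of y alone -/

section

open Set ENNReal

variable {n : ℕ}

theorem finrank_perp (ξ : E n) (hξ : ξ ≠ 0) : Module.finrank ℝ (perp ξ) = n - 1 := by
  have h := Submodule.finrank_add_finrank_orthogonal (Submodule.span ℝ {ξ})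
  rw [finrank_span_singleton hξ, finrank_euclideanSpace_fin] at h
  have h' : 1 + Module.finrank ℝ (perp ξ) = n := h
  omega

theorem finrank_perp_sphere (ξ : Sph n) : Module.finrank ℝ (perp (ξ : E n)) = n - 1 :=
  finrank_perp _ (ne_zero_of_mem_unit_sphere ξ)

/-- With x = w + a e and y = w' + b e, orthogonality reads ⟨w, w'⟩ + a b = 0 and is solved for b
whenever a ≠ 0. By the graph formula the measure dy dx/|x| becomes dw dw' da/|a|. Exchanging x and y
then only exchanges a and b. -/
theorem lintegral_incidence_half {e : E n} (he : ‖e‖ = 1) {F : E n → E n → ℝ≥0∞}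
    (hF : Measurable (Function.uncurry F)) :
    ∫⁻ x, ‖x‖ₑ⁻¹ * ∫⁻ y : perp x, F x y =
      ∫⁻ w : perp e, ∫⁻ w' : perp e, ∫⁻ a : ℝ, ENNReal.ofReal |a⁻¹| *
        F ((w : E n) + a • e) ((w' : E n) + (-(⟪(w : E n), (w' : E n)⟫_ℝ / a)) • e) := by
  have hee : ⟪e, e⟫_ℝ = 1 := by rw [real_inner_self_eq_norm_sq, he]; norm_num
  have hcont : Measurable fun q : (perp e × ℝ) × perp e =>
      ENNReal.ofReal |q.1.2⁻¹| * F ((q.1.1 : E n) + q.1.2 • e)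
        ((q.2 : E n) + (-(⟪(q.1.1 : E n), (q.2 : E n)⟫_ℝ / q.1.2)) • e) := by
    refine Measurable.mul (by fun_prop) (hF.comp (Measurable.prodMk (by fun_prop) ?_))
    have h1 : Measurable fun q : (perp e × ℝ) × perp e => ⟪(q.1.1 : E n), (q.2 : E n)⟫_ℝ :=
      Continuous.measurable (by fun_prop)
    have h2 : Measurable fun q : (perp e × ℝ) × perp e => q.1.2 := by fun_prop
    exact (measurable_subtype_coe.comp measurable_snd).add ((h1.div h2).neg.smul_const e)
  rw [← (measurePreserving_slab e he).lintegral_comp_emb (measurableEmbedding_slab e he),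
    Measure.volume_eq_prod]
  have hae : ∀ᵐ q : perp e × ℝ ∂(volume : Measure (perp e)).prod volume, q.2 ≠ 0 :=
    Measure.quasiMeasurePreserving_snd.ae (Measure.ae_ne volume (0 : ℝ))
  have hcongr : ∀ᵐ q : perp e × ℝ ∂(volume : Measure (perp e)).prod volume,
      ‖(q.1 : E n) + q.2 • e‖ₑ⁻¹ * ∫⁻ y : perp ((q.1 : E n) + q.2 • e),
        F ((q.1 : E n) + q.2 • e) y =
      ∫⁻ w' : perp e, ENNReal.ofReal |q.2⁻¹| * F ((q.1 : E n) + q.2 • e)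
        ((w' : E n) + (-(⟪(q.1 : E n), (w' : E n)⟫_ℝ / q.2)) • e) := by
    filter_upwards [hae] with q hq
    have h1 : ⟪(q.1 : E n) + q.2 • e, e⟫_ℝ = q.2 := by
      rw [inner_add_left, inner_smul_left, inner_perp_coe, hee]
      simp
    have hm : Measurable (F ((q.1 : E n) + q.2 • e)) := hF.comp measurable_prodMk_left
    rw [lintegral_perp_graph' he (by rwa [h1]) hm, h1, ← lintegral_const_mul]
    · refine lintegral_congr fun w' => ?_
      have h2 : ⟪(w' : E n), (q.1 : E n) + q.2 • e⟫_ℝ = ⟪(q.1 : E n), (w' : E n)⟫_ℝ := by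
        rw [inner_add_right, inner_smul_right, inner_perp_coe, real_inner_comm]
        simp
      rw [h2, neg_smul, sub_eq_add_neg]
    · refine hm.comp (Continuous.measurable ?_)
      fun_prop
  rw [lintegral_congr_ae hcongr, lintegral_prod _ hcont.lintegral_prod_right'.aemeasurable]
  refine lintegral_congr fun w => ?_
  refine lintegral_lintegral_swap (Measurable.aemeasurable ?_)
  exact hcont.comp (show Measurable fun q : ℝ × perp e =>
    (((w, q.1), q.2) : (perp e × ℝ) × perp e) by fun_prop)

/-- The measures `dy dx / |x|` (`y ∈ x^⊥`) and `dx dy / |y|` (`x ∈ y^⊥`) on the set of pairs of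
orthogonal vectors coincide. -/
theorem lintegral_incidence_symm (hn : 2 ≤ n) {F : E n → E n → ℝ≥0∞}
    (hF : Measurable (Function.uncurry F)) :
    ∫⁻ x, ‖x‖ₑ⁻¹ * ∫⁻ y : perp x, F x y = ∫⁻ y, ‖y‖ₑ⁻¹ * ∫⁻ x : perp y, F x y := by
  set e : E n := EuclideanSpace.single ⟨0, by omega⟩ (1 : ℝ) with he'
  have he : ‖e‖ = 1 := by simp [he']
  have he0 : e ≠ 0 := norm_ne_zero_iff.mp (by rw [he]; norm_num)
  have hfr := finrank_perp e he0
  have : Nontrivial (perp e) := Module.nontrivial_of_finrank_pos (R := ℝ) (by omega)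
  have hF' : Measurable (Function.uncurry fun y x => F x y) := hF.comp measurable_swap
  rw [lintegral_incidence_half he hF, lintegral_incidence_half he hF']
  have hm : Measurable fun q : (perp e × perp e) × ℝ => ENNReal.ofReal |q.2⁻¹| *
      F ((q.1.1 : E n) + (-(⟪(q.1.2 : E n), (q.1.1 : E n)⟫_ℝ / q.2)) • e)
        ((q.1.2 : E n) + q.2 • e) := by
    refine Measurable.mul (by fun_prop) (hF.comp (Measurable.prodMk ?_ (by fun_prop)))
    have h1 : Measurable fun q : (perp e × perp e) × ℝ => ⟪(q.1.2 : E n), (q.1.1 : E n)⟫_ℝ :=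
      Continuous.measurable (by fun_prop)
    have h2 : Measurable fun q : (perp e × perp e) × ℝ => q.2 := by fun_prop
    exact (measurable_subtype_coe.comp (measurable_fst.comp measurable_fst)).add
      ((h1.div h2).neg.smul_const e)
  rw [lintegral_lintegral_swap (f := fun w w' : perp e => ∫⁻ a : ℝ, ENNReal.ofReal |a⁻¹| *
    F ((w' : E n) + (-(⟪(w : E n), (w' : E n)⟫_ℝ / a)) • e) ((w : E n) + a • e))
    (hm.lintegral_prod_right'.comp measurable_swap).aemeasurable]
  refine lintegral_congr_ae ?_
  -- For w ≠ 0 the vectors w' with ⟨w, w'⟩ = 0 form a proper subspace of e^⊥, hence a null set. Off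
  -- it the inversion a ↦ -⟨w, w'⟩/a applies. That 0 is a null set of e^⊥ needs n ≥ 2.
  filter_upwards [Measure.ae_ne volume (0 : perp e)] with w hw
  have hw' : ((Submodule.span ℝ {w})ᗮ : Submodule ℝ (perp e)) ≠ ⊤ := by
    intro h
    have h1 : w ∈ ((Submodule.span ℝ {w})ᗮ : Submodule ℝ (perp e)) := by
      rw [h]
      trivial
    rw [Submodule.mem_orthogonal_singleton_iff_inner_right] at h1
    exact hw (inner_self_eq_zero.mp h1)
  have hnull := Measure.addHaar_submodule volume _ hw'
  refine lintegral_congr_ae ?_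
  filter_upwards [measure_eq_zero_iff_ae_notMem.mp hnull] with w' hww
  have hc : ⟪(w : E n), (w' : E n)⟫_ℝ ≠ 0 := fun h =>
    hww (Submodule.mem_orthogonal_singleton_iff_inner_right.mpr h)
  have key := lintegral_inversion hc fun a b => F ((w : E n) + a • e) ((w' : E n) + b • e)
  rw [key]
  simp only [real_inner_comm (w : E n) (w' : E n)]

/-- In polar coordinates the extension of g that is homogeneous of degree 0 contributes the radial
factor ∫₀¹ r^{n-1} dr = 1/n. -/
theorem lintegral_toSphere (hn : 0 < n) {g : Sph n → ℝ≥0∞} (hg : Measurable g) {G : E n → ℝ≥0∞}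
    (hG : ∀ x (hx : x ≠ 0), G x = g ⟨‖x‖⁻¹ • x, by simp [norm_smul, hx]⟩) :
    ∫⁻ ξ, g ξ ∂(volume : Measure (E n)).toSphere = n * ∫⁻ x in ball (0 : E n) 1, G x := by
  have : Nontrivial (E n) := Module.nontrivial_of_finrank_pos (R := ℝ) (by simpa using hn)
  have hfr : Module.finrank ℝ (E n) = n := finrank_euclideanSpace_fin
  have hmp := Measure.measurePreserving_homeomorphUnitSphereProd (volume : Measure (E n))
  rw [← lintegral_indicator measurableSet_ball]
  conv_rhs => rw [← restrict_compl_singleton (μ := (volume : Measure (E n))) 0,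
    ← lintegral_subtype_comap (measurableSet_singleton 0).compl]
  have h1 : ∀ x : ({0}ᶜ : Set (E n)), (ball (0 : E n) 1).indicator G x =
      (fun q : Sph n × Ioi (0 : ℝ) => g q.1 * (Iio (⟨1, mem_Ioi.mpr one_pos⟩ : Ioi (0 : ℝ))).indicator 1 q.2)
        (homeomorphUnitSphereProd (E n) x) := by
    intro x
    have hx : (x : E n) ≠ 0 := x.2
    by_cases h : ‖(x : E n)‖ < 1
    · have h2 : (homeomorphUnitSphereProd (E n) x).2 < (⟨1, mem_Ioi.mpr one_pos⟩ : Ioi (0 : ℝ)) := by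
        rw [← Subtype.coe_lt_coe]
        simpa using h
      simp only [indicator, mem_ball_zero_iff, h, if_true, mem_Iio, h2, Pi.one_apply, mul_one]
      rw [hG _ hx]
      exact congrArg g (Subtype.ext (by simp))
    · have h2 : ¬ ((homeomorphUnitSphereProd (E n) x).2 < (⟨1, mem_Ioi.mpr one_pos⟩ : Ioi (0 : ℝ))) := by
        rw [← Subtype.coe_lt_coe]
        simpa using h
      simp only [indicator, mem_ball_zero_iff, h, if_false, mem_Iio, h2, mul_zero]
  rw [lintegral_congr h1, hmp.lintegral_comp_emb
    (homeomorphUnitSphereProd (E n)).measurableEmbedding (fun q : Sph n × Ioi (0 : ℝ) =>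
      g q.1 * (Iio (⟨1, mem_Ioi.mpr one_pos⟩ : Ioi (0 : ℝ))).indicator 1 q.2),
    hfr, lintegral_prod_mul hg.aemeasurable (measurable_one.indicator measurableSet_Iio).aemeasurable,
    lintegral_indicator measurableSet_Iio]
  simp only [Pi.one_apply, lintegral_one, Measure.restrict_apply_univ,
    Measure.volumeIoiPow_apply_Iio]
  have hn' : ((n - 1 : ℕ) : ℝ) + 1 = n := by
    rw [Nat.cast_sub hn]
    simp
  rw [hn', one_pow, ← ENNReal.ofReal_natCast, mul_comm (∫⁻ ξ, g ξ ∂_), ← mul_assoc,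
    ← ENNReal.ofReal_mul (by positivity), mul_one_div_cancel (by positivity)]
  simp

/-- In polar coordinates with d = dim V this is |S^{d-1}| ∫₀¹ r^d dr, and |S^{d-1}| =
2π^{d/2}/Γ(d/2). It is used for the hyperplanes, where d + 1 = n. -/
theorem lintegral_norm_ball {V : Type*} [NormedAddCommGroup V] [InnerProductSpace ℝ V]
    [FiniteDimensional ℝ V] [MeasurableSpace V] [BorelSpace V] (hV : 0 < Module.finrank ℝ V) :
    ∫⁻ x in ball (0 : V) 1, ‖x‖ₑ = ENNReal.ofReal
      (2 * Real.pi ^ ((Module.finrank ℝ V : ℝ) / 2) / Real.Gamma ((Module.finrank ℝ V : ℝ) / 2)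
        / (Module.finrank ℝ V + 1)) := by
  have : Nontrivial V := Module.nontrivial_of_finrank_pos (R := ℝ) hV
  set d := Module.finrank ℝ V with hd
  have hi : IntegrableOn (fun x : V => ‖x‖) (ball 0 1) :=
    (continuous_norm.continuousOn.integrableOn_compact (isCompact_closedBall 0 1)).mono_set
      ball_subset_closedBall
  rw [show ∫⁻ x in ball (0 : V) 1, ‖x‖ₑ = ∫⁻ x in ball (0 : V) 1, ENNReal.ofReal ‖x‖ from
    lintegral_congr fun x => (ofReal_norm x).symm,
    ← ofReal_integral_eq_lintegral_ofReal hi (.of_forall fun x => norm_nonneg x)]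
  congr 1
  rw [← integral_indicator measurableSet_ball]
  have h1 : ∀ x : V, (ball (0 : V) 1).indicator (fun x => ‖x‖) x =
      (Iio (1 : ℝ)).indicator id ‖x‖ := by
    intro x
    simp [indicator]
  rw [integral_congr_ae (.of_forall h1), integral_fun_norm_addHaar volume
    (f := (Iio (1 : ℝ)).indicator id), ← hd]
  have h2 : ∀ y ∈ Ioi (0 : ℝ), y ^ (d - 1) • (Iio (1 : ℝ)).indicator id y =
      (Iio (1 : ℝ)).indicator (fun y => y ^ d) y := by
    intro y _
    by_cases h : y < 1
    · simp only [indicator, mem_Iio, h, if_true, id, smul_eq_mul]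
      rw [← pow_succ, Nat.sub_add_cancel hV]
    · simp [indicator, h]
  rw [setIntegral_congr_fun measurableSet_Ioi h2, setIntegral_indicator measurableSet_Iio,
    Ioi_inter_Iio, ← integral_Ioc_eq_integral_Ioo, ← intervalIntegral.integral_of_le zero_le_one,
    integral_pow, measureReal_def, InnerProductSpace.volume_ball, ← hd]
  simp only [ENNReal.ofReal_one, one_pow, one_mul]
  have hG : 0 < Real.Gamma ((d : ℝ) / 2) := Real.Gamma_pos_of_pos (by positivity)
  have hG1 : Real.Gamma ((d : ℝ) / 2 + 1) = d / 2 * Real.Gamma ((d : ℝ) / 2) :=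
    Real.Gamma_add_one (by positivity)
  rw [ENNReal.toReal_ofReal (by rw [hG1]; positivity), hG1, Real.sqrt_eq_rpow,
    ← Real.rpow_natCast, ← Real.rpow_mul Real.pi_pos.le, nsmul_eq_mul, smul_eq_mul,
    show (1 / 2 * (d : ℝ)) = d / 2 by ring]
  have hd0 : (d : ℝ) ≠ 0 := by positivity
  simp only [ne_eq, Nat.add_eq_zero_iff, one_ne_zero, and_false, not_false_eq_true, zero_pow,
    sub_zero]
  field_simp

/-- Integration over `T S^{n-1}` of a function that does not depend on `ξ`. -/
theorem lintegral_tsMeasure_fst (hn : 2 ≤ n) {h : E n → ℝ≥0∞} (hh : Measurable h) :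
    ENNReal.ofReal (aConst n) * ∫⁻ p : TS n, h p.1.1 ∂tsMeasure n = ∫⁻ y, ‖y‖ₑ⁻¹ * h y := by
  have hm : Measurable fun p : TS n => h p.1.1 :=
    hh.comp (measurable_fst.comp measurable_subtype_coe)
  have : Nontrivial (E n) := Module.nontrivial_of_finrank_pos (R := ℝ) (by simp; omega)
  have hn1 : ((n - 1 : ℕ) : ℝ) = n - 1 := by rw [Nat.cast_sub (by omega)]; simp
  -- The integral of |x| over the unit ball of a hyperplane, that is |S^{n-2}|/n.
  set κ : ℝ := 2 * Real.pi ^ (((n : ℝ) - 1) / 2) / Real.Gamma (((n : ℝ) - 1) / 2) / n with hκ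
  have hn2 : (2 : ℝ) ≤ n := by exact_mod_cast hn
  have hG : 0 < Real.Gamma (((n : ℝ) - 1) / 2) := Real.Gamma_pos_of_pos (by linarith)
  have hP : 0 < Real.pi ^ (((n : ℝ) - 1) / 2) := Real.rpow_pos_of_pos Real.pi_pos _
  -- The factor |x| cancels the density 1/|x|, and the cutoff to the ball turns the x-integral into
  -- 1/n times an integral over the sphere. With the roles of x and y exchanged, the inner integral
  -- is the constant κ.
  set F : E n → E n → ℝ≥0∞ := fun x y => (ball (0 : E n) 1).indicator (fun x => ‖x‖ₑ) x * h y
    with hFdef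
  have hbm : Measurable ((ball (0 : E n) 1).indicator fun x => ‖x‖ₑ) :=
    measurable_enorm.indicator measurableSet_ball
  have hF : Measurable (Function.uncurry F) := (hbm.comp measurable_fst).mul (hh.comp measurable_snd)
  have hsymm := lintegral_incidence_symm hn hF
  have hL : ∫⁻ x, ‖x‖ₑ⁻¹ * ∫⁻ y : perp x, F x y =
      ∫⁻ x in ball (0 : E n) 1, ∫⁻ y : perp x, h y := by
    rw [← lintegral_indicator measurableSet_ball]
    refine lintegral_congr_ae ?_
    filter_upwards [Measure.ae_ne volume (0 : E n)] with x hx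
    simp only [hFdef]
    rw [lintegral_const_mul (f := fun y : perp x => h y) _ (hh.comp measurable_subtype_coe), ← mul_assoc]
    by_cases hb : x ∈ ball (0 : E n) 1
    · simp only [indicator, hb, if_true]
      rw [ENNReal.inv_mul_cancel (by simpa using hx) (by simp), one_mul]
    · simp [indicator, hb]
  have hR : ∫⁻ y, ‖y‖ₑ⁻¹ * ∫⁻ x : perp y, F x y =
      ENNReal.ofReal κ * ∫⁻ y, ‖y‖ₑ⁻¹ * h y := by
    rw [← lintegral_const_mul (f := fun y : E n => ‖y‖ₑ⁻¹ * h y) _ (measurable_enorm.inv.mul hh)]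
    refine lintegral_congr_ae ?_
    filter_upwards [Measure.ae_ne volume (0 : E n)] with y hy
    simp only [hFdef]
    rw [lintegral_mul_const (f := fun x : perp y =>
      (ball (0 : E n) 1).indicator (fun x => ‖x‖ₑ) (x : E n)) _ (hbm.comp measurable_subtype_coe)]
    have h1 : ∀ x : perp y, (ball (0 : E n) 1).indicator (fun x => ‖x‖ₑ) (x : E n) =
        (ball (0 : perp y) 1).indicator (fun x => ‖x‖ₑ) x := by
      intro x
      have h3 : ‖(x : E n)‖ₑ = ‖x‖ₑ := rfl
      simp [indicator, h3]
    simp only [h1]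
    rw [lintegral_indicator measurableSet_ball, lintegral_norm_ball (by rw [finrank_perp y hy]; omega),
      finrank_perp y hy, hn1, sub_add_cancel, ← hκ]
    ring
  have hS := lintegral_toSphere (n := n) (by omega) (measurable_lintegral_perp hm)
    (G := fun x => ∫⁻ y : perp x, h y)
    (fun x hx => (lintegral_perp_smul (inv_ne_zero (norm_ne_zero_iff.mpr hx)) h).symm)
  rw [lintegral_tsMeasure hm, hS, ← hL, hsymm, hR, ← mul_assoc, ← mul_assoc,
    ← ENNReal.ofReal_natCast, ← ENNReal.ofReal_mul (by rw [aConst]; positivity),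
    ← ENNReal.ofReal_mul (by rw [aConst]; positivity)]
  -- Since a_n = 1/|S^{n-2}| and κ = |S^{n-2}|/n.
  have h1 : aConst n * n * κ = 1 := by
    rw [aConst, hκ]
    field_simp
  rw [h1, ENNReal.ofReal_one, one_mul]

end

section

/-! ### Functions of rapid decay and of moderate growth along the fibres -/

open Set Filter Topology

variable {n : ℕ}

/-- Rapid decay along the fibres, uniformly over the sphere. -/
def Rapid {F : Type*} [Norm F] (u : TS n → F) : Prop :=
  ∀ k : ℕ, ∃ C : ℝ, ∀ p : TS n, (1 + ‖p.1.1‖) ^ k * ‖u p‖ ≤ C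

/-- Polynomial growth along the fibres, uniformly over the sphere. -/
def Moderate {F : Type*} [Norm F] (u : TS n → F) : Prop :=
  ∃ (C : ℝ) (k : ℕ), ∀ p : TS n, ‖u p‖ ≤ C * (1 + ‖p.1.1‖) ^ k

section growth

variable {F G H : Type*} [SeminormedAddCommGroup F] [SeminormedAddCommGroup G]
  [SeminormedAddCommGroup H]

theorem Rapid.mono {u : TS n → F} {v : TS n → G} (hu : Rapid u) (h : ∀ p, ‖v p‖ ≤ ‖u p‖) :
    Rapid v := fun k => by
  obtain ⟨C, hC⟩ := hu k
  exact ⟨C, fun p => (mul_le_mul_of_nonneg_left (h p) (by positivity)).trans (hC p)⟩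

theorem Rapid.norm {u : TS n → F} (hu : Rapid u) : Rapid fun p => ‖u p‖ :=
  hu.mono fun p => by simp

theorem Rapid.add {u v : TS n → F} (hu : Rapid u) (hv : Rapid v) : Rapid fun p => u p + v p :=
  fun k => by
  obtain ⟨C, hC⟩ := hu k
  obtain ⟨D, hD⟩ := hv k
  refine ⟨C + D, fun p => ?_⟩
  calc _ ≤ (1 + ‖p.1.1‖) ^ k * (‖u p‖ + ‖v p‖) := by
        gcongr
        exact norm_add_le _ _
    _ ≤ C + D := by
        rw [mul_add]
        exact add_le_add (hC p) (hD p)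

theorem rapid_zero : Rapid fun _ : TS n => (0 : F) := fun k => ⟨0, fun p => by simp⟩

theorem Rapid.sum {ι : Type*} (s : Finset ι) {u : ι → TS n → F} (hu : ∀ i ∈ s, Rapid (u i)) :
    Rapid fun p => ∑ i ∈ s, u i p := by
  classical
  induction s using Finset.induction_on with
  | empty => simpa using rapid_zero
  | insert a s ha ih =>
    simp only [Finset.sum_insert ha]
    exact (hu a (by simp)).add (ih fun i hi => hu i (by simp [hi]))

theorem Moderate.mono {u : TS n → F} {v : TS n → G} (hu : Moderate u) (h : ∀ p, ‖v p‖ ≤ ‖u p‖) :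
    Moderate v := by
  obtain ⟨C, k, hC⟩ := hu
  exact ⟨C, k, fun p => (h p).trans (hC p)⟩

theorem moderate_const (c : F) : Moderate fun _ : TS n => c := ⟨‖c‖, 0, fun p => by simp⟩

theorem Moderate.exists_nonneg {u : TS n → F} (hu : Moderate u) :
    ∃ (C : ℝ) (k : ℕ), 0 ≤ C ∧ ∀ p : TS n, ‖u p‖ ≤ C * (1 + ‖p.1.1‖) ^ k := by
  obtain ⟨C, k, hC⟩ := hu
  refine ⟨|C|, k, abs_nonneg _, fun p => (hC p).trans ?_⟩
  gcongr
  exact le_abs_self C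

theorem Moderate.add {u v : TS n → F} (hu : Moderate u) (hv : Moderate v) :
    Moderate fun p => u p + v p := by
  obtain ⟨C, k, hC0, hC⟩ := hu.exists_nonneg
  obtain ⟨D, l, hD0, hD⟩ := hv.exists_nonneg
  refine ⟨C + D, k + l, fun p => (norm_add_le _ _).trans ?_⟩
  have h1 : (1 : ℝ) ≤ 1 + ‖p.1.1‖ := by simp
  rw [add_mul]
  refine add_le_add ((hC p).trans ?_) ((hD p).trans ?_)
  · gcongr
    omega
  · gcongr
    omega

theorem Moderate.sum {ι : Type*} (s : Finset ι) {u : ι → TS n → F}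
    (hu : ∀ i ∈ s, Moderate (u i)) : Moderate fun p => ∑ i ∈ s, u i p := by
  classical
  induction s using Finset.induction_on with
  | empty => simpa using moderate_const (0 : F)
  | insert a s ha ih =>
    simp only [Finset.sum_insert ha]
    exact (hu a (by simp)).add (ih fun i hi => hu i (by simp [hi]))

theorem Moderate.mul {u v : TS n → ℝ} (hu : Moderate u) (hv : Moderate v) :
    Moderate fun p => u p * v p := by
  obtain ⟨C, k, hC0, hC⟩ := hu.exists_nonneg
  obtain ⟨D, l, hD0, hD⟩ := hv.exists_nonneg
  refine ⟨C * D, k + l, fun p => ?_⟩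
  rw [norm_mul, pow_add]
  calc _ ≤ (C * (1 + ‖p.1.1‖) ^ k) * (D * (1 + ‖p.1.1‖) ^ l) := by
        gcongr
        · exact hC p
        · exact hD p
    _ = _ := by ring

theorem Moderate.pow {u : TS n → ℝ} (hu : Moderate u) (m : ℕ) : Moderate fun p => u p ^ m := by
  induction m with
  | zero => simpa using moderate_const (1 : ℝ)
  | succ m ih =>
    simp only [pow_succ]
    exact ih.mul hu

theorem Moderate.mul_rapid {u v : TS n → ℝ} (hu : Moderate u) (hv : Rapid v) :
    Rapid fun p => u p * v p := fun k => by
  obtain ⟨C, l, hC0, hC⟩ := hu.exists_nonneg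
  obtain ⟨D, hD⟩ := hv (k + l)
  refine ⟨C * D, fun p => ?_⟩
  rw [norm_mul]
  calc _ ≤ (1 + ‖p.1.1‖) ^ k * ((C * (1 + ‖p.1.1‖) ^ l) * ‖v p‖) := by
        gcongr
        exact hC p
    _ = C * ((1 + ‖p.1.1‖) ^ (k + l) * ‖v p‖) := by ring
    _ ≤ _ := by
        gcongr
        exact hD p

theorem rapid_of_pow_mul_le {u : TS n → F}
    (h : ∀ k : ℕ, ∃ C : ℝ, ∀ p : TS n, ‖p.1.1‖ ^ k * ‖u p‖ ≤ C) : Rapid u := fun k => by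
  obtain ⟨C, hC⟩ := h 0
  obtain ⟨D, hD⟩ := h k
  refine ⟨2 ^ (k - 1) * (C + D), fun p => ?_⟩
  calc _ ≤ (2 ^ (k - 1) * (1 ^ k + ‖p.1.1‖ ^ k)) * ‖u p‖ := by
        gcongr
        exact add_pow_le zero_le_one (norm_nonneg _) k
    _ = 2 ^ (k - 1) * (‖p.1.1‖ ^ 0 * ‖u p‖ + ‖p.1.1‖ ^ k * ‖u p‖) := by simp; ring
    _ ≤ _ := by
        gcongr
        · exact hC p
        · exact hD p

theorem Rapid.pow_mul_le {u : TS n → F} (h : Rapid u) (k : ℕ) :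
    ∃ C : ℝ, ∀ p : TS n, ‖p.1.1‖ ^ k * ‖u p‖ ≤ C := by
  obtain ⟨C, hC⟩ := h k
  refine ⟨C, fun p => le_trans ?_ (hC p)⟩
  gcongr
  simp

end growth

/-- The domain `ℝⁿ × (ℝⁿ ∖ 0)` of the canonical extensions. -/
abbrev Dom (n : ℕ) : Set (E n × E n) := {p | p.2 ≠ 0}

theorem eventuallyEq_of_eqOn {F : Type*} {f g : E n × E n → F} (h : EqOn f g (Dom n)) (p : TS n) :
    f =ᶠ[𝓝 p.1] g :=
  h.eventuallyEq_of_mem (isOpen_ne.mem_nhds p.snd_ne_zero)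

section smooth

variable {F G H : Type*} [NormedAddCommGroup F] [NormedSpace ℝ F] [NormedAddCommGroup G]
  [NormedSpace ℝ G] [NormedAddCommGroup H] [NormedSpace ℝ H]

/-- Smooth functions all of whose derivatives decay rapidly on `T S^{n-1}`. -/
def RapidSmooth (f : E n × E n → F) : Prop :=
  ContDiffOn ℝ ∞ f (Dom n) ∧ ∀ m : ℕ, Rapid fun p : TS n => ‖iteratedFDeriv ℝ m f p.1‖

/-- Smooth functions all of whose derivatives have moderate growth on `T S^{n-1}`. -/
def ModerateSmooth (f : E n × E n → F) : Prop :=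
  ContDiffOn ℝ ∞ f (Dom n) ∧ ∀ m : ℕ, Moderate fun p : TS n => ‖iteratedFDeriv ℝ m f p.1‖

theorem isSchwartz_iff {φ : TS n → ℂ} : IsSchwartz φ ↔ RapidSmooth (ext φ) := by
  refine and_congr_right fun _ => ⟨fun h m => rapid_of_pow_mul_le fun k => ?_, fun h k m => ?_⟩
  · obtain ⟨C, hC⟩ := h k m
    exact ⟨C, fun p => by simpa using hC p⟩
  · obtain ⟨C, hC⟩ := (h m).pow_mul_le k
    exact ⟨C, fun p => by simpa using hC p⟩

theorem RapidSmooth.congr {f g : E n × E n → F} (hf : RapidSmooth f) (h : EqOn g f (Dom n)) :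
    RapidSmooth g := by
  refine ⟨hf.1.congr h, fun m => (hf.2 m).mono fun p => ?_⟩
  rw [((eventuallyEq_of_eqOn h p).iteratedFDeriv ℝ m).self_of_nhds]

/-- Leibniz's formula for derivatives within `Dom n`. They are the full derivatives because the set
is open. -/
theorem norm_iteratedFDeriv_bilin_le (B : F →L[ℝ] G →L[ℝ] H) {f : E n × E n → F}
    {g : E n × E n → G} (hf : ContDiffOn ℝ ∞ f (Dom n)) (hg : ContDiffOn ℝ ∞ g (Dom n)) (m : ℕ)
    (p : TS n) : ‖iteratedFDeriv ℝ m (fun q => B (f q) (g q)) p.1‖ ≤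
      ∑ i ∈ Finset.range (m + 1), (‖B‖ * (m.choose i : ℝ) * ‖iteratedFDeriv ℝ i f p.1‖) *
        ‖iteratedFDeriv ℝ (m - i) g p.1‖ := by
  have hp : p.1 ∈ Dom n := p.snd_ne_zero
  have h := B.norm_iteratedFDerivWithin_le_of_bilinear hf hg isOpen_ne.uniqueDiffOn hp (n := m)
    (by exact_mod_cast le_top)
  simp only [iteratedFDerivWithin_of_isOpen _ isOpen_ne hp] at h
  refine h.trans (le_of_eq ?_)
  rw [Finset.mul_sum]
  exact Finset.sum_congr rfl fun i _ => by ring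

theorem ContDiffOn.bilin (B : F →L[ℝ] G →L[ℝ] H) {f : E n × E n → F} {g : E n × E n → G}
    (hf : ContDiffOn ℝ ∞ f (Dom n)) (hg : ContDiffOn ℝ ∞ g (Dom n)) :
    ContDiffOn ℝ ∞ (fun q => B (f q) (g q)) (Dom n) :=
  (B.isBoundedBilinearMap.contDiff (n := ∞)).comp_contDiffOn (hf.prodMk hg)

theorem ModerateSmooth.bilin_rapid (B : F →L[ℝ] G →L[ℝ] H) {f : E n × E n → F}
    {g : E n × E n → G} (hf : ModerateSmooth f) (hg : RapidSmooth g) :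
    RapidSmooth fun q => B (f q) (g q) := by
  refine ⟨ContDiffOn.bilin B hf.1 hg.1, fun m => ?_⟩
  refine (Rapid.sum (Finset.range (m + 1)) fun i _ =>
    ((moderate_const (‖B‖ * (m.choose i : ℝ))).mul (hf.2 i)).mul_rapid (hg.2 (m - i))).mono
    fun p => ?_
  rw [norm_norm]
  exact (norm_iteratedFDeriv_bilin_le B hf.1 hg.1 m p).trans (le_abs_self _)

theorem ModerateSmooth.bilin (B : F →L[ℝ] G →L[ℝ] H) {f : E n × E n → F} {g : E n × E n → G}
    (hf : ModerateSmooth f) (hg : ModerateSmooth g) : ModerateSmooth fun q => B (f q) (g q) := by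
  refine ⟨ContDiffOn.bilin B hf.1 hg.1, fun m => ?_⟩
  refine (Moderate.sum (Finset.range (m + 1)) fun i _ =>
    ((moderate_const (‖B‖ * (m.choose i : ℝ))).mul (hf.2 i)).mul (hg.2 (m - i))).mono
    fun p => ?_
  rw [norm_norm]
  exact (norm_iteratedFDeriv_bilin_le B hf.1 hg.1 m p).trans (le_abs_self _)

theorem moderateSmooth_const (c : F) : ModerateSmooth fun _ : E n × E n => c := by
  refine ⟨contDiffOn_const, fun m => ?_⟩
  rcases Nat.eq_zero_or_pos m with rfl | hm
  · simpa using moderate_const ‖c‖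
  · simp only [iteratedFDeriv_const_of_ne hm.ne', Pi.zero_apply, norm_zero]
    exact moderate_const 0

theorem moderateSmooth_of_clm (L : E n × E n →L[ℝ] F) : ModerateSmooth L := by
  refine ⟨L.contDiff.contDiffOn, fun m => ?_⟩
  rcases m with _ | _ | m
  · refine Moderate.mono (u := fun p : TS n => ‖L‖ * (1 + ‖p.1.1‖)) ⟨‖L‖, 1, fun p => ?_⟩ fun p => ?_
    · rw [norm_mul, norm_norm, pow_one, Real.norm_of_nonneg (by positivity)]
    · rw [norm_norm, norm_iteratedFDeriv_zero]
      refine (L.le_opNorm _).trans ?_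
      rw [norm_mul, norm_norm, Real.norm_of_nonneg (by positivity)]
      gcongr
      rw [Prod.norm_def, p.2.1]
      exact max_le (by linarith) (by linarith [norm_nonneg p.1.1])
  · have : ∀ p : TS n, ‖iteratedFDeriv ℝ (0 + 1) L p.1‖ = ‖L‖ := fun p => by
      rw [← norm_iteratedFDeriv_fderiv, norm_iteratedFDeriv_zero, L.fderiv]
    simp only [this]
    exact moderate_const _
  · have : ∀ p : TS n, ‖iteratedFDeriv ℝ (m + 1 + 1) L p.1‖ = 0 := fun p => by
      rw [← norm_iteratedFDeriv_fderiv]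
      have h : fderiv ℝ L = fun _ => (L : E n × E n →L[ℝ] F) := funext fun x => L.fderiv
      rw [h, iteratedFDeriv_const_of_ne (by omega)]
      simp
    simp only [this]
    exact moderate_const _

theorem ModerateSmooth.add {f g : E n × E n → F} (hf : ModerateSmooth f)
    (hg : ModerateSmooth g) : ModerateSmooth fun q => f q + g q := by
  refine ⟨hf.1.add hg.1, fun m => ((hf.2 m).add (hg.2 m)).mono fun p => ?_⟩
  have hmem := isOpen_ne.mem_nhds p.snd_ne_zero
  rw [norm_norm, show (fun q => f q + g q) = f + g from rfl, iteratedFDeriv_add_apply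
    ((hf.1.contDiffAt hmem).of_le (by exact_mod_cast le_top))
    ((hg.1.contDiffAt hmem).of_le (by exact_mod_cast le_top))]
  exact (norm_add_le _ _).trans (le_abs_self _)

theorem ModerateSmooth.prodMk {f : E n × E n → F} {g : E n × E n → G} (hf : ModerateSmooth f)
    (hg : ModerateSmooth g) : ModerateSmooth fun q => (f q, g q) := by
  have h1 := (moderateSmooth_const (n := n) (ContinuousLinearMap.inl ℝ F G)).bilin
    (ContinuousLinearMap.id ℝ (F →L[ℝ] F × G)) hf
  have h2 := (moderateSmooth_const (n := n) (ContinuousLinearMap.inr ℝ F G)).bilin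
    (ContinuousLinearMap.id ℝ (G →L[ℝ] F × G)) hg
  simpa using h1.add h2

/-- By translation invariance in the first variable the derivatives depend on ξ only, so on T
S^{n-1} they are bounded by compactness of the sphere. -/
theorem moderateSmooth_of_snd {f : E n → F} (hf : ContDiffOn ℝ ∞ f {ξ | ξ ≠ 0}) :
    ModerateSmooth fun q : E n × E n => f q.2 := by
  refine ⟨hf.comp contDiff_snd.contDiffOn fun q hq => hq, fun m => ?_⟩
  have hc : ContinuousOn (fun ξ : E n => iteratedFDeriv ℝ m (fun q : E n × E n => f q.2) (0, ξ))
      (sphere 0 1) := by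
    have h1 : ContDiffOn ℝ ∞ (fun q : E n × E n => f q.2) (Dom n) :=
      hf.comp contDiff_snd.contDiffOn fun q hq => hq
    have h2 := h1.continuousOn_iteratedFDerivWithin (m := m) (by exact_mod_cast le_top)
      isOpen_ne.uniqueDiffOn
    have h3 : ContinuousOn (iteratedFDeriv ℝ m fun q : E n × E n => f q.2) (Dom n) :=
      h2.congr fun q hq => (iteratedFDerivWithin_of_isOpen m isOpen_ne hq).symm
    exact h3.comp (by fun_prop) fun ξ hξ => ne_zero_of_mem_unit_sphere (⟨ξ, hξ⟩ : Sph n)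
  obtain ⟨C, hC⟩ := (isCompact_sphere (0 : E n) 1).exists_bound_of_continuousOn hc
  refine ⟨C, 0, fun p => ?_⟩
  have h4 : iteratedFDeriv ℝ m (fun q : E n × E n => f q.2) p.1 =
      iteratedFDeriv ℝ m (fun q : E n × E n => f q.2) (0, p.1.2) := by
    have h5 := iteratedFDeriv_comp_add_right (𝕜 := ℝ) (f := fun q : E n × E n => f q.2) m
      (p.1.1, (0 : E n)) (0, p.1.2)
    simpa using h5.symm
  rw [norm_norm, h4]
  simpa using hC p.1.2 (by simp [p.2.1])

theorem RapidSmooth.fderiv {f : E n × E n → F} (hf : RapidSmooth f) :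
    RapidSmooth (fderiv ℝ f) := by
  refine ⟨hf.1.fderiv_of_isOpen isOpen_ne (by simp), fun m => ?_⟩
  simp only [norm_iteratedFDeriv_fderiv]
  exact hf.2 (m + 1)

/-- Because r fixes T S^{n-1} pointwise, the chain rule at p involves derivatives of f at p itself.
Decay of f is thus needed on T S^{n-1} only, and the derivatives of r enter polynomially. -/
theorem RapidSmooth.comp {f : E n × E n → F} (hf : RapidSmooth f) {r : E n × E n → E n × E n}
    (hr : ModerateSmooth r) (hmaps : MapsTo r (Dom n) (Dom n)) (hfix : ∀ p : TS n, r p.1 = p.1) :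
    RapidSmooth (f ∘ r) := by
  refine ⟨hf.1.comp hr.1 hmaps, fun m => ?_⟩
  have hM : Moderate fun p : TS n => (m.factorial : ℝ) *
      (1 + ∑ i ∈ Finset.range (m + 1), ‖iteratedFDeriv ℝ i r p.1‖) ^ m :=
    (moderate_const _).mul (((moderate_const _).add (Moderate.sum _ fun i _ => hr.2 i)).pow m)
  refine (hM.mul_rapid (Rapid.sum (Finset.range (m + 1)) fun i _ => hf.2 i)).mono fun p => ?_
  have hp : p.1 ∈ Dom n := p.snd_ne_zero
  have h := norm_iteratedFDerivWithin_comp_le hf.1 hr.1 (n := m) (by exact_mod_cast le_top)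
    isOpen_ne.uniqueDiffOn isOpen_ne.uniqueDiffOn hmaps hp
    (C := ∑ i ∈ Finset.range (m + 1), ‖iteratedFDeriv ℝ i f p.1‖)
    -- The summand 1 ensures D ≥ 1, so that a bound by D implies the required bound by D^i for i ≥
    -- 1.
    (D := 1 + ∑ i ∈ Finset.range (m + 1), ‖iteratedFDeriv ℝ i r p.1‖)
    (fun i hi => by
      rw [hfix, iteratedFDerivWithin_of_isOpen _ isOpen_ne hp]
      exact Finset.single_le_sum (f := fun i => ‖iteratedFDeriv ℝ i f p.1‖)
        (fun j _ => norm_nonneg _) (Finset.mem_range.mpr (by omega)))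
    (fun i h1 hi => by
      rw [iteratedFDerivWithin_of_isOpen _ isOpen_ne hp]
      have h2 : ‖iteratedFDeriv ℝ i r p.1‖ ≤
          ∑ i ∈ Finset.range (m + 1), ‖iteratedFDeriv ℝ i r p.1‖ :=
        Finset.single_le_sum (f := fun i => ‖iteratedFDeriv ℝ i r p.1‖)
          (fun j _ => norm_nonneg _) (Finset.mem_range.mpr (by omega))
      have h3 := Finset.sum_nonneg (s := Finset.range (m + 1))
        (f := fun i => ‖iteratedFDeriv ℝ i r p.1‖) fun j _ => norm_nonneg _
      exact (h2.trans (by linarith)).trans (le_self_pow₀ (by linarith) (by omega)))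
  rw [iteratedFDerivWithin_of_isOpen _ isOpen_ne hp] at h
  rw [norm_norm]
  refine h.trans (le_trans (le_of_eq ?_) (le_abs_self _))
  ring

end smooth

/-- The retraction onto `T S^{n-1}` as a map of `ℝⁿ × ℝⁿ`. -/
def retr (q : E n × E n) : E n × E n :=
  (q.1 - (⟪q.2, q.1⟫_ℝ / ‖q.2‖ ^ 2) • q.2, ‖q.2‖⁻¹ • q.2)

theorem retr_coe (p : TS n) : retr p.1 = p.1 := by
  have h : ⟪p.1.2, p.1.1⟫_ℝ = 0 := by
    rw [real_inner_comm]
    exact p.2.2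
  simp [retr, h, p.2.1]

theorem mapsTo_retr : MapsTo (retr (n := n)) (Dom n) (Dom n) := fun _ hq =>
  smul_ne_zero (inv_ne_zero (norm_ne_zero_iff.mpr hq)) hq

theorem moderateSmooth_retr : ModerateSmooth (retr (n := n)) := by
  have hfst := moderateSmooth_of_clm (ContinuousLinearMap.fst ℝ (E n) (E n))
  have hsnd := moderateSmooth_of_clm (ContinuousLinearMap.snd ℝ (E n) (E n))
  have hν : ModerateSmooth fun q : E n × E n => ‖q.2‖⁻¹ • q.2 :=
    moderateSmooth_of_snd (f := fun ξ : E n => ‖ξ‖⁻¹ • ξ) fun ξ hξ =>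
      (((contDiffAt_norm ℝ hξ).inv (norm_ne_zero_iff.mpr hξ)).smul contDiffAt_id).contDiffWithinAt
  have hinner := hsnd.bilin (innerSL ℝ) hfst
  have hs : ModerateSmooth fun q : E n × E n => -(‖q.2‖ ^ 2)⁻¹ • q.2 :=
    moderateSmooth_of_snd (f := fun ξ : E n => -(‖ξ‖ ^ 2)⁻¹ • ξ) fun ξ hξ =>
      ((((contDiffAt_norm ℝ hξ).pow 2).inv
        (pow_ne_zero 2 (norm_ne_zero_iff.mpr hξ))).neg.smul contDiffAt_id).contDiffWithinAt
  have h1 := hinner.bilin (ContinuousLinearMap.lsmul ℝ ℝ) hs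
  have h2 := (hfst.add h1).prodMk hν
  have h3 : (retr (n := n)) = fun q => (ContinuousLinearMap.fst ℝ (E n) (E n) q +
      ContinuousLinearMap.lsmul ℝ ℝ (innerSL ℝ (ContinuousLinearMap.snd ℝ (E n) (E n) q)
        (ContinuousLinearMap.fst ℝ (E n) (E n) q)) (-(‖q.2‖ ^ 2)⁻¹ • q.2), ‖q.2‖⁻¹ • q.2) := by
    funext q
    refine Prod.ext ?_ rfl
    simp only [retr, ContinuousLinearMap.coe_fst', ContinuousLinearMap.coe_snd',
      ContinuousLinearMap.lsmul_apply, innerSL_apply_apply, neg_smul, smul_neg, smul_smul,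
      div_eq_mul_inv, sub_eq_add_neg]
  rw [h3]
  exact h2

theorem ext_eqOn_retr {φ : TS n → ℂ} {f : E n × E n → ℂ} (h : ∀ p : TS n, φ p = f p.1) :
    EqOn (ext φ) (f ∘ retr) (Dom n) := by
  intro q hq
  have hq' : q.2 ≠ 0 := hq
  simp only [ext, hq', ne_eq, not_false_eq_true, dif_pos, h]
  rfl

/-- A function on `T S^{n-1}` belongs to the Schwartz space as soon as it is the restriction of
some smooth function whose derivatives decay rapidly. -/
theorem RapidSmooth.isSchwartz {f : E n × E n → ℂ} (hf : RapidSmooth f) {φ : TS n → ℂ}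
    (h : ∀ p : TS n, φ p = f p.1) : IsSchwartz φ :=
  isSchwartz_iff.mpr
    ((hf.comp moderateSmooth_retr mapsTo_retr retr_coe).congr (ext_eqOn_retr h))

/-- The derivative of `ext φ` along the polynomial field Ξ_i is an extension of `Xi i φ` off T
S^{n-1}, though in general not the canonical one. `RapidSmooth.isSchwartz` makes any extension with
rapidly decaying derivatives good enough. -/
theorem IsSchwartz.xi {φ : TS n → ℂ} (hφ : IsSchwartz φ) (i : Fin n) : IsSchwartz (Xi i φ) := by
  have h1 := (isSchwartz_iff.mp hφ).fderiv
  set P : E n →L[ℝ] ℝ := EuclideanSpace.proj i with hP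
  have hfst := moderateSmooth_of_clm (ContinuousLinearMap.fst ℝ (E n) (E n))
  have hsnd := moderateSmooth_of_clm (ContinuousLinearMap.snd ℝ (E n) (E n))
  have hx := moderateSmooth_of_clm (-(P ∘L ContinuousLinearMap.fst ℝ (E n) (E n)))
  have hξ := moderateSmooth_of_clm (-(P ∘L ContinuousLinearMap.snd ℝ (E n) (E n)))
  have h2 := (hx.bilin (ContinuousLinearMap.lsmul ℝ ℝ) hsnd).prodMk
    ((moderateSmooth_const (EuclideanSpace.single i (1 : ℝ))).add
      (hξ.bilin (ContinuousLinearMap.lsmul ℝ ℝ) hsnd))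
  refine (h2.bilin_rapid (ContinuousLinearMap.apply ℝ ℂ) h1).isSchwartz fun p => ?_
  simp [Xi, hP, sub_eq_add_neg]

end

section

/-! ### Momentum ray transforms of Schwartz functions -/

open Set Filter Topology

variable {n : ℕ}

section schwartz

variable {V F : Type*} [NormedAddCommGroup V] [NormedSpace ℝ V] [NormedAddCommGroup F]
  [NormedSpace ℝ F]

theorem schwartz_decay (f : 𝓢(V, F)) (N : ℕ) : ∃ C : ℝ, 0 ≤ C ∧ ∀ z, (1 + ‖z‖) ^ N * ‖f z‖ ≤ C := by
  refine ⟨_, ?_, fun z => by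
    simpa using SchwartzMap.one_add_le_sup_seminorm_apply (𝕜 := ℝ) (m := (N, 0)) le_rfl le_rfl f z⟩
  exact mul_nonneg (by positivity) (apply_nonneg _ _)

/-- The moments `∫ t^k f(x + t ξ) dt` of a function along the line through `x` in the
direction `ξ`. -/
def lineMoment (k : ℕ) (f : V → F) (q : V × V) : F := ∫ t : ℝ, t ^ k • f (q.1 + t • q.2)

/-- Of the N + k + 2 powers of decay, k pay for the moment t^k and two for integrability over the
line. In the applications a is a multiple of 1 + |x + tξ|, b = |f(x + tξ)| and d = t. -/
theorem pow_mul_le_of_le {a b c d : ℝ} {k N : ℕ} (hb : 0 ≤ b) (ha : 1 ≤ a) (ht : |d| ≤ a - 1)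
    (h : a ^ (N + (k + 2)) * b ≤ c) : a ^ N * (|d| ^ k * b) ≤ c * (1 + |d|) ^ (-(2 : ℝ)) := by
  have h1 : (1 + |d|) ^ (-(2 : ℝ)) = ((1 + |d|) ^ 2)⁻¹ := by
    rw [Real.rpow_neg (by positivity)]
    norm_cast
  rw [h1, ← div_eq_mul_inv, le_div_iff₀ (by positivity)]
  refine le_trans ?_ h
  rw [pow_add, pow_add]
  have h2 : |d| ^ k ≤ a ^ k := by
    gcongr
    linarith
  have h3 : (1 + |d|) ^ 2 ≤ a ^ 2 := by
    gcongr
    linarith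
  calc a ^ N * (|d| ^ k * b) * (1 + |d|) ^ 2 = a ^ N * (|d| ^ k * (1 + |d|) ^ 2) * b := by ring
    _ ≤ a ^ N * (a ^ k * a ^ 2) * b := by gcongr

theorem exists_moment_bound (f : 𝓢(V, F)) (k : ℕ) {q₀ : V × V} (hq : q₀.2 ≠ 0) :
    ∃ C : ℝ, ∀ᶠ q in 𝓝 q₀, ∀ t : ℝ,
      |t| ^ k * ‖f (q.1 + t • q.2)‖ ≤ C * (1 + |t|) ^ (-(2 : ℝ)) := by
  obtain ⟨C, hC0, hC⟩ := schwartz_decay f (k + 2)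
  have hδ : 0 < ‖q₀.2‖ / 2 := by positivity
  set δ := ‖q₀.2‖ / 2 with hδdef
  set R := ‖q₀.1‖ + 1 with hR
  have hR0 : 0 ≤ R := by positivity
  -- Near q₀ the first component is shorter than R and the second longer than δ, whence |t| ≤ (‖z‖ +
  -- R)/δ. This c gives (‖z‖ + R)/δ ≤ c (1 + ‖z‖) - 1.
  set c := 1 + (R + 1) / δ with hc
  have hc0 : 0 < c := by positivity
  refine ⟨c ^ (k + 2) * C, ?_⟩
  have e1 : ∀ᶠ q : V × V in 𝓝 q₀, ‖q.1‖ < R :=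
    (continuous_fst.norm.tendsto q₀).eventually_lt_const (by simp [hR])
  have e2 : ∀ᶠ q : V × V in 𝓝 q₀, δ < ‖q.2‖ :=
    (continuous_snd.norm.tendsto q₀).eventually_const_lt (by
      rw [hδdef]
      linarith)
  filter_upwards [e1, e2] with q h1 h2 t
  set z := q.1 + t • q.2 with hz
  have h3 : |t| * δ ≤ ‖z‖ + R := by
    have h4 : ‖t • q.2‖ ≤ ‖z‖ + ‖q.1‖ := by
      have : t • q.2 = z - q.1 := by rw [hz]; abel
      rw [this]
      exact norm_sub_le _ _
    rw [norm_smul, Real.norm_eq_abs] at h4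
    have := mul_le_mul_of_nonneg_left h2.le (abs_nonneg t)
    linarith
  have h5 : |t| ≤ c * (1 + ‖z‖) - 1 := by
    have h6 : |t| ≤ (‖z‖ + R) / δ := (le_div_iff₀ hδ).mpr h3
    refine h6.trans ?_
    have h7 : c * (1 + ‖z‖) - 1 - (‖z‖ + R) / δ = ‖z‖ + (1 + R * ‖z‖) / δ := by
      rw [hc]
      field_simp
      ring
    have h8 : 0 ≤ ‖z‖ + (1 + R * ‖z‖) / δ := by positivity
    linarith
  have h9 : 1 ≤ c * (1 + ‖z‖) := by linarith [abs_nonneg t]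
  have h10 := pow_mul_le_of_le (N := 0) (k := k) (c := c ^ (k + 2) * C) (norm_nonneg (f z)) h9 h5
    (by
      rw [zero_add, mul_pow, mul_assoc]
      exact mul_le_mul_of_nonneg_left (hC z) (by positivity))
  simpa using h10

theorem integrable_one_add_abs : Integrable fun t : ℝ => (1 + |t|) ^ (-(2 : ℝ)) := by
  have h := integrable_one_add_norm (E := ℝ) (μ := volume) (r := 2) (by simp)
  simpa using h

theorem continuous_moment (f : 𝓢(V, F)) (k : ℕ) (q : V × V) :
    Continuous fun t : ℝ => t ^ k • f (q.1 + t • q.2) := by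
  have := f.continuous
  fun_prop

theorem integrable_moment (f : 𝓢(V, F)) (k : ℕ) {q : V × V} (hq : q.2 ≠ 0) :
    Integrable fun t : ℝ => t ^ k • f (q.1 + t • q.2) := by
  obtain ⟨C, hC⟩ := exists_moment_bound f k hq
  refine (integrable_one_add_abs.const_mul C).mono' (continuous_moment f k q).aestronglyMeasurable
    (.of_forall fun t => ?_)
  rw [norm_smul, norm_pow, Real.norm_eq_abs]
  exact hC.self_of_nhds t

/-- Differentiating x + tξ in ξ brings out one more factor t. The derivative is thus built from
moments of orders k and k + 1 of the derivative of f, which is again a Schwartz function, and the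
class of line moments is closed under differentiation. -/
theorem hasFDerivAt_lineMoment [CompleteSpace F] (f : 𝓢(V, F)) (k : ℕ) {q : V × V} (hq : q.2 ≠ 0) :
    HasFDerivAt (lineMoment k f)
      ((lineMoment k (SchwartzMap.fderivCLM ℝ V F f) q).comp (ContinuousLinearMap.fst ℝ V V) +
        (lineMoment (k + 1) (SchwartzMap.fderivCLM ℝ V F f) q).comp
          (ContinuousLinearMap.snd ℝ V V)) q := by
  set g := SchwartzMap.fderivCLM ℝ V F f with hg
  obtain ⟨C, hC⟩ := exists_moment_bound g k hq
  obtain ⟨D, hD⟩ := exists_moment_bound g (k + 1) hq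
  set L₁ : (V →L[ℝ] F) →L[ℝ] (V × V →L[ℝ] F) :=
    (ContinuousLinearMap.compL ℝ (V × V) V F).flip (ContinuousLinearMap.fst ℝ V V) with hL₁
  set L₂ : (V →L[ℝ] F) →L[ℝ] (V × V →L[ℝ] F) :=
    (ContinuousLinearMap.compL ℝ (V × V) V F).flip (ContinuousLinearMap.snd ℝ V V) with hL₂
  have i1 := integrable_moment g k hq
  have i2 := integrable_moment g (k + 1) hq
  have key := hasFDerivAt_integral_of_dominated_of_fderiv_le (𝕜 := ℝ) (μ := (volume : Measure ℝ))
    (F := fun q t => t ^ k • f (q.1 + t • q.2))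
    (F' := fun q t => L₁ (t ^ k • g (q.1 + t • q.2)) + L₂ (t ^ (k + 1) • g (q.1 + t • q.2)))
    (x₀ := q) (hC.and hD)
    (bound := fun t => ‖L₁‖ * (C * (1 + |t|) ^ (-(2 : ℝ))) + ‖L₂‖ * (D * (1 + |t|) ^ (-(2 : ℝ))))
    (.of_forall fun q => (continuous_moment f k q).aestronglyMeasurable)
    (integrable_moment f k hq)
    ((L₁.integrable_comp i1).add (L₂.integrable_comp i2)).aestronglyMeasurable
    (.of_forall fun t q hq' => by
      refine (norm_add_le _ _).trans (add_le_add ?_ ?_)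
      · refine (L₁.le_opNorm _).trans (mul_le_mul_of_nonneg_left ?_ (norm_nonneg _))
        rw [norm_smul, norm_pow, Real.norm_eq_abs]
        exact hq'.1 t
      · refine (L₂.le_opNorm _).trans (mul_le_mul_of_nonneg_left ?_ (norm_nonneg _))
        rw [norm_smul, norm_pow, Real.norm_eq_abs]
        exact hq'.2 t)
    (((integrable_one_add_abs.const_mul C).const_mul _).add
      ((integrable_one_add_abs.const_mul D).const_mul _))
    (.of_forall fun t q _ => by
      have h1 : HasFDerivAt (fun q : V × V => q.1 + t • q.2)
          (ContinuousLinearMap.fst ℝ V V + t • ContinuousLinearMap.snd ℝ V V) q :=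
        hasFDerivAt_fst.add (hasFDerivAt_snd.const_smul t)
      have h2 := ((f.hasFDerivAt (q.1 + t • q.2)).comp q h1).const_smul (t ^ k)
      refine h2.congr_fderiv ?_
      ext v <;>
      simp [hL₁, hL₂, hg, SchwartzMap.fderivCLM_apply, smul_smul, pow_succ])
  refine key.congr_fderiv ?_
  rw [integral_add (L₁.integrable_comp i1) (L₂.integrable_comp i2), L₁.integral_comp_comm i1,
    L₂.integral_comp_comm i2]
  rfl

end schwartz

/-- On T S^{n-1} one has |x + tξ|² = |x|² + t², so decay of f in x + tξ yields decay in x and in t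
together, uniformly in ξ. -/
theorem rapid_lineMoment {F : Type*} [NormedAddCommGroup F] [NormedSpace ℝ F] (f : 𝓢(E n, F))
    (k : ℕ) : Rapid fun p : TS n => lineMoment k f p.1 := by
  intro N
  obtain ⟨C, hC0, hC⟩ := schwartz_decay f (N + (k + 2))
  refine ⟨C * ∫ t : ℝ, (1 + |t|) ^ (-(2 : ℝ)), fun p => ?_⟩
  change (1 + ‖p.1.1‖) ^ N * ‖∫ t : ℝ, t ^ k • f (p.1.1 + t • p.1.2)‖ ≤ _
  rw [← integral_const_mul, ← Real.norm_of_nonneg (r := (1 + ‖p.1.1‖) ^ N) (by positivity),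
    ← norm_smul, ← integral_smul]
  refine norm_integral_le_of_norm_le (integrable_one_add_abs.const_mul C) (.of_forall fun t => ?_)
  rw [norm_smul, norm_smul, norm_pow, norm_pow, Real.norm_eq_abs, Real.norm_eq_abs,
    abs_of_nonneg (by positivity)]
  set z := p.1.1 + t • p.1.2 with hz
  have h1 : ‖z‖ ^ 2 = ‖p.1.1‖ ^ 2 + |t| ^ 2 := by
    rw [hz, norm_add_sq_real, inner_smul_right, p.2.2, norm_smul, p.2.1]
    simp
  have h2 : ‖p.1.1‖ ≤ ‖z‖ := by
    refine le_of_sq_le_sq ?_ (norm_nonneg z)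
    nlinarith [sq_nonneg |t|]
  have h3 : |t| ≤ ‖z‖ := by
    refine le_of_sq_le_sq ?_ (norm_nonneg z)
    nlinarith [sq_nonneg ‖p.1.1‖]
  refine le_trans ?_ (pow_mul_le_of_le (a := 1 + ‖z‖) (d := t) (k := k) (N := N)
    (norm_nonneg (f z)) (by simp) (by linarith) (hC z))
  gcongr

/-- The target space, f and k are quantified inside the induction because the derivative takes
values in a space of linear maps and involves the moment of order k + 1. -/
theorem contDiffOn_lineMoment (m : ℕ) : ∀ {F : Type} [NormedAddCommGroup F] [NormedSpace ℝ F]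
    [CompleteSpace F] (f : 𝓢(E n, F)) (k : ℕ), ContDiffOn ℝ m (lineMoment k f) (Dom n) ∧
      Rapid fun p : TS n => ‖iteratedFDeriv ℝ m (lineMoment k f) p.1‖ := by
  induction m with
  | zero =>
    intro F _ _ _ f k
    refine ⟨contDiffOn_zero.mpr fun q hq =>
      (hasFDerivAt_lineMoment f k hq).continuousAt.continuousWithinAt, ?_⟩
    simp only [norm_iteratedFDeriv_zero]
    exact (rapid_lineMoment f k).norm
  | succ m ih =>
    intro F _ _ _ f k
    set g := SchwartzMap.fderivCLM ℝ (E n) F f with hg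
    set L₁ : (E n →L[ℝ] F) →L[ℝ] (E n × E n →L[ℝ] F) :=
      (ContinuousLinearMap.compL ℝ (E n × E n) (E n) F).flip (ContinuousLinearMap.fst ℝ _ _)
      with hL₁
    set L₂ : (E n →L[ℝ] F) →L[ℝ] (E n × E n →L[ℝ] F) :=
      (ContinuousLinearMap.compL ℝ (E n × E n) (E n) F).flip (ContinuousLinearMap.snd ℝ _ _)
      with hL₂
    obtain ⟨c1, r1⟩ := ih g k
    obtain ⟨c2, r2⟩ := ih g (k + 1)
    have hfd : EqOn (fderiv ℝ (lineMoment k f))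
        (L₁ ∘ lineMoment k g + L₂ ∘ lineMoment (k + 1) g) (Dom n) := fun q hq =>
      (hasFDerivAt_lineMoment f k hq).fderiv
    have hc : ContDiffOn ℝ m (L₁ ∘ lineMoment k g + L₂ ∘ lineMoment (k + 1) g) (Dom n) :=
      (L₁.contDiff.comp_contDiffOn c1).add (L₂.contDiff.comp_contDiffOn c2)
    refine ⟨?_, ?_⟩
    · rw [Nat.cast_succ, contDiffOn_succ_iff_fderiv_of_isOpen isOpen_ne]
      exact ⟨fun q hq => (hasFDerivAt_lineMoment f k hq).differentiableAt.differentiableWithinAt,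
        fun h => absurd h (by simp), hc.congr hfd⟩
    · refine (((moderate_const ‖L₁‖).mul_rapid r1).add ((moderate_const ‖L₂‖).mul_rapid r2)).mono
        fun p => ?_
      have hmem := isOpen_ne.mem_nhds p.snd_ne_zero
      rw [norm_norm, ← norm_iteratedFDeriv_fderiv,
        ((eventuallyEq_of_eqOn hfd p).iteratedFDeriv ℝ m).self_of_nhds, iteratedFDeriv_add_apply
          ((L₁.contDiff.comp_contDiffOn c1).contDiffAt hmem)
          ((L₂.contDiff.comp_contDiffOn c2).contDiffAt hmem)]
      refine (norm_add_le _ _).trans (le_trans (add_le_add ?_ ?_) (le_abs_self _))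
      · exact L₁.norm_iteratedFDeriv_comp_left (c1.contDiffAt hmem) le_rfl
      · exact L₂.norm_iteratedFDeriv_comp_left (c2.contDiffAt hmem) le_rfl

theorem rapidSmooth_lineMoment {F : Type} [NormedAddCommGroup F] [NormedSpace ℝ F]
    [CompleteSpace F] (f : 𝓢(E n, F)) (k : ℕ) : RapidSmooth (lineMoment k f) :=
  ⟨contDiffOn_infty.mpr fun m => (contDiffOn_lineMoment m f k).1,
    fun m => (contDiffOn_lineMoment m f k).2⟩

/-- The pairing `∑_i a_i b_i` of `ℂⁿ` with `ℝⁿ`. -/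
def pairing (n : ℕ) : Cn n →L[ℝ] E n →L[ℝ] ℂ :=
  ∑ i, (ContinuousLinearMap.mul ℝ ℂ).bilinearComp
    ((EuclideanSpace.proj i : Cn n →L[ℂ] ℂ).restrictScalars ℝ)
    (Complex.ofRealCLM ∘L (EuclideanSpace.proj i : E n →L[ℝ] ℝ))

theorem pairing_apply (a : Cn n) (b : E n) : pairing n a b = ∑ i, a i * (b i : ℂ) := by
  simp [pairing]

theorem momentum_eq_pairing (f : 𝓢(E n, Cn n)) (k : ℕ) (p : TS n) :
    momentum k f p = pairing n (lineMoment k f p.1) p.1.2 := by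
  have h1 := ((pairing n).flip p.1.2).integral_comp_comm (integrable_moment f k p.snd_ne_zero)
  rw [lineMoment, ← ContinuousLinearMap.flip_apply, ← h1, momentum]
  refine integral_congr_ae (.of_forall fun t => ?_)
  simp only [ContinuousLinearMap.flip_apply, map_smul,
    pairing_apply, Complex.real_smul, Complex.ofReal_pow]

theorem isSchwartz_momentum (f : 𝓢(E n, Cn n)) (k : ℕ) : IsSchwartz (momentum k f) :=
  ((moderateSmooth_of_clm (ContinuousLinearMap.snd ℝ (E n) (E n))).bilin_rapid (pairing n).flip
    (rapidSmooth_lineMoment f k)).isSchwartz fun p => by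
      simp [momentum_eq_pairing]

/-- The linear map `f ↦ (I⁰ f, I¹ f)`. -/
def momentumMap (n : ℕ) : 𝓢(E n, Cn n) →ₗ[ℂ] SchwartzTS n × SchwartzTS n where
  toFun f := (⟨momentum 0 f, isSchwartz_momentum f 0⟩, ⟨momentum 1 f, isSchwartz_momentum f 1⟩)
  map_add' f g := by
    have h : ∀ k, momentum k (f + g : 𝓢(E n, Cn n)) = momentum k f + momentum k g := fun k => by
      funext p
      rw [Pi.add_apply, momentum_eq_pairing, momentum_eq_pairing, momentum_eq_pairing,
        ← add_apply, ← map_add, lineMoment, lineMoment, lineMoment,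
        ← integral_add (integrable_moment f k p.snd_ne_zero) (integrable_moment g k p.snd_ne_zero)]
      simp
    exact Prod.ext (Subtype.ext (h 0)) (Subtype.ext (h 1))
  map_smul' c f := by
    have h : ∀ k, momentum k (c • f : 𝓢(E n, Cn n)) = c • momentum k f := fun k => by
      funext p
      simp only [Pi.smul_apply, momentum, smul_eq_mul]
      rw [← integral_const_mul]
      refine integral_congr_ae (.of_forall fun t => ?_)
      simp only [smul_apply, PiLp.smul_apply, smul_eq_mul, Finset.mul_sum]
      exact Finset.sum_congr rfl fun i _ => by ring
    exact Prod.ext (Subtype.ext (h 0)) (Subtype.ext (h 1))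

end

section

/-! ### The fibrewise Fourier transform -/

open Set Filter Topology FourierTransform

variable {n : ℕ}

theorem IsSchwartz.exists_bound {φ : TS n → ℂ} (hφ : IsSchwartz φ) (m N : ℕ) :
    ∃ C : ℝ, 0 ≤ C ∧ ∀ p : TS n, (1 + ‖p.1.1‖) ^ N * ‖iteratedFDeriv ℝ m (ext φ) p.1‖ ≤ C := by
  obtain ⟨C, hC⟩ := (isSchwartz_iff.mp hφ).2 m N
  refine ⟨|C|, abs_nonneg C, fun p => ?_⟩
  simpa using (hC p).trans (le_abs_self C)

theorem IsSchwartz.contDiff_fibre {φ : TS n → ℂ} (hφ : IsSchwartz φ) (ξ : Sph n) :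
    ContDiff ℝ ∞ fun x : perp (ξ : E n) => φ (TS.mk ξ x) := by
  have h : (fun x : perp (ξ : E n) => φ (TS.mk ξ x)) =
      fun x : perp (ξ : E n) => ext φ ((x : E n), (ξ : E n)) :=
    funext fun x => (ext_apply_coe φ (TS.mk ξ x)).symm
  rw [h, ← contDiffOn_univ]
  refine hφ.1.comp (ContDiff.contDiffOn ?_) fun x _ => ne_zero_of_mem_unit_sphere ξ
  exact ((perp (ξ : E n)).subtypeL.contDiff).prodMk contDiff_const

/-- The fibre is parametrized by the affine map x ↦ (x, ξ), whose linear part has norm at most 1. -/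
theorem IsSchwartz.norm_iteratedFDeriv_fibre_le {φ : TS n → ℂ} (hφ : IsSchwartz φ) (ξ : Sph n)
    (m : ℕ) (x : perp (ξ : E n)) :
    ‖iteratedFDeriv ℝ m (fun x : perp (ξ : E n) => φ (TS.mk ξ x)) x‖ ≤
      ‖iteratedFDeriv ℝ m (ext φ) (TS.mk ξ x).1‖ := by
  set g : perp (ξ : E n) →L[ℝ] E n × E n :=
    (ContinuousLinearMap.inl ℝ (E n) (E n)).comp (perp (ξ : E n)).subtypeL with hg
  set f : E n × E n → ℂ := fun z => ext φ (z + (0, (ξ : E n))) with hf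
  set s : Set (E n × E n) := {z | (z + (0, (ξ : E n))).2 ≠ 0} with hs
  have hso : IsOpen s := isOpen_ne.preimage (f := fun z : E n × E n => z + (0, (ξ : E n)))
    (by fun_prop)
  have hfs : ContDiffOn ℝ ∞ f s := hφ.1.comp
    (contDiff_id.add contDiff_const).contDiffOn fun z hz => hz
  have hgs : ∀ x, g x ∈ s := fun x => by
    simpa [hg, hs] using ne_zero_of_mem_unit_sphere ξ
  have hpre : g ⁻¹' s = univ := eq_univ_of_forall hgs
  have h1 := g.iteratedFDerivWithin_comp_right hfs hso.uniqueDiffOn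
    (by rw [hpre]; exact uniqueDiffOn_univ) (hgs x) (i := m) (by exact_mod_cast le_top)
  rw [hpre, iteratedFDerivWithin_univ, iteratedFDerivWithin_of_isOpen _ hso (hgs x)] at h1
  have h2 : (fun x : perp (ξ : E n) => φ (TS.mk ξ x)) = f ∘ g := by
    funext x
    refine (ext_apply_coe φ (TS.mk ξ x)).symm.trans ?_
    simp [hf, hg, TS.mk]
  have h3 : iteratedFDeriv ℝ m f (g x) = iteratedFDeriv ℝ m (ext φ) (TS.mk ξ x).1 := by
    have h4 := iteratedFDeriv_comp_add_right (𝕜 := ℝ) (f := ext φ) m (0, (ξ : E n)) (g x)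
    rw [hf, h4]
    simp [hg, TS.mk]
  rw [h2, h1, h3]
  refine (ContinuousMultilinearMap.norm_compContinuousLinearMap_le _ _).trans ?_
  have hg1 : ‖g‖ ≤ 1 := by
    refine ContinuousLinearMap.opNorm_le_bound _ zero_le_one fun x => ?_
    simp [hg, Prod.norm_def]
  refine mul_le_of_le_one_right (norm_nonneg _) ?_
  exact Finset.prod_le_one (fun _ _ => norm_nonneg _) fun _ _ => hg1

/-- An isometry between `ξ^⊥` and `ℝ^{n-1}`. -/
def perpEquiv (ξ : Sph n) : perp (ξ : E n) ≃ₗᵢ[ℝ] EuclideanSpace ℝ (Fin (n - 1)) :=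
  ((stdOrthonormalBasis ℝ (perp (ξ : E n))).reindex (finCongr (finrank_perp_sphere ξ))).repr

theorem integral_perp_norm (ξ : Sph n) (g : ℝ → ℝ) :
    ∫ x : perp (ξ : E n), g ‖x‖ = ∫ x : EuclideanSpace ℝ (Fin (n - 1)), g ‖x‖ := by
  rw [← (perpEquiv ξ).measurePreserving.integral_comp
    (perpEquiv ξ).toHomeomorph.measurableEmbedding]
  simp

theorem integrable_perp_norm (ξ : Sph n) {g : ℝ → ℝ}
    (hg : Integrable fun x : EuclideanSpace ℝ (Fin (n - 1)) => g ‖x‖) :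
    Integrable fun x : perp (ξ : E n) => g ‖x‖ := by
  have h := (perpEquiv ξ).measurePreserving.integrable_comp_of_integrable hg
  simpa [Function.comp_def] using h

theorem integrable_inv_one_add_pow {V : Type*} [NormedAddCommGroup V] [NormedSpace ℝ V]
    [FiniteDimensional ℝ V] [MeasurableSpace V] [BorelSpace V] (μ : Measure V)
    [μ.IsAddHaarMeasure] {N : ℕ} (hN : Module.finrank ℝ V < N) :
    Integrable (fun x : V => ((1 + ‖x‖) ^ N)⁻¹) μ := by
  have h := integrable_one_add_norm (E := V) (μ := μ) (r := N) (by exact_mod_cast hN)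
  refine h.congr (.of_forall fun x => ?_)
  simp only
  rw [Real.rpow_neg (by positivity), Real.rpow_natCast]

theorem integrable_perp_inv_pow (hn : 0 < n) (ξ : Sph n) :
    Integrable fun x : perp (ξ : E n) => ((1 + ‖x‖) ^ n)⁻¹ :=
  integrable_inv_one_add_pow _ (by rw [finrank_perp_sphere]; omega)

/-- The constant does not depend on ξ: the decay is uniform over the sphere and all fibres are
isometric to ℝ^{n-1}, on which (1 + |x|)^{-n} is integrable. -/
theorem IsSchwartz.integrable_fibre_deriv {φ : TS n → ℂ} (hφ : IsSchwartz φ) (hn : 0 < n) (m : ℕ) :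
    ∃ C : ℝ, ∀ ξ : Sph n,
      Integrable (fun x => iteratedFDeriv ℝ m (fun x : perp (ξ : E n) => φ (TS.mk ξ x)) x) ∧
      ∫ x, ‖iteratedFDeriv ℝ m (fun x : perp (ξ : E n) => φ (TS.mk ξ x)) x‖ ≤ C := by
  obtain ⟨C, hC0, hC⟩ := hφ.exists_bound m n
  refine ⟨C * ∫ x : EuclideanSpace ℝ (Fin (n - 1)), ((1 + ‖x‖) ^ n)⁻¹, fun ξ => ?_⟩
  have hb : ∀ x : perp (ξ : E n),
      ‖iteratedFDeriv ℝ m (fun x : perp (ξ : E n) => φ (TS.mk ξ x)) x‖ ≤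
        C * ((1 + ‖x‖) ^ n)⁻¹ := fun x => by
    refine (hφ.norm_iteratedFDeriv_fibre_le ξ m x).trans ?_
    rw [← div_eq_mul_inv, le_div_iff₀ (by positivity), mul_comm]
    exact hC (TS.mk ξ x)
  have hi := (integrable_perp_inv_pow hn ξ).const_mul C
  have hint : Integrable (fun x =>
      iteratedFDeriv ℝ m (fun x : perp (ξ : E n) => φ (TS.mk ξ x)) x) :=
    hi.mono' ((hφ.contDiff_fibre ξ).continuous_iteratedFDeriv
      (m := m) (by exact_mod_cast le_top)).aestronglyMeasurable (.of_forall hb)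
  refine ⟨hint, ?_⟩
  rw [← integral_perp_norm ξ fun r => ((1 + r) ^ n)⁻¹, ← integral_const_mul]
  exact integral_mono hint.norm hi hb

theorem IsSchwartz.integrable_fibre {φ : TS n → ℂ} (hφ : IsSchwartz φ) (hn : 0 < n) (ξ : Sph n) :
    Integrable fun x : perp (ξ : E n) => φ (TS.mk ξ x) := by
  obtain ⟨C, hC⟩ := hφ.integrable_fibre_deriv hn 0
  refine ((hC ξ).1.norm).mono' (hφ.contDiff_fibre ξ).continuous.aestronglyMeasurable
    (.of_forall fun x => ?_)
  rw [norm_iteratedFDeriv_zero]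

/-- The fibrewise Fourier transform in terms of the Fourier transform of Mathlib. -/
theorem fourierTS_mk (φ : TS n → ℂ) (ξ : Sph n) (y : perp (ξ : E n)) :
    fourierTS φ (TS.mk ξ y) = (((2 * Real.pi) ^ (-((n : ℝ) - 1) / 2) : ℝ) : ℂ) *
      𝓕 (fun x : perp (ξ : E n) => φ (TS.mk ξ x)) ((2 * Real.pi)⁻¹ • y) := by
  have h0 : fourierTS φ (TS.mk ξ y) = (((2 * Real.pi) ^ (-((n : ℝ) - 1) / 2) : ℝ) : ℂ) *
    ∫ x : perp (ξ : E n), Complex.exp (-Complex.I * (⟪(y : E n), (x : E n)⟫_ℝ : ℂ)) *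
      φ (TS.mk ξ x) := rfl
  rw [Real.fourier_eq', h0]
  congr 1
  refine integral_congr_ae (.of_forall fun x => ?_)
  simp only [smul_eq_mul]
  congr 2
  have h1 : ⟪x, (2 * Real.pi)⁻¹ • y⟫_ℝ = (2 * Real.pi)⁻¹ * ⟪(y : E n), (x : E n)⟫_ℝ := by
    rw [inner_smul_right, real_inner_comm]
    rfl
  have h2 : -2 * Real.pi * ((2 * Real.pi)⁻¹ * ⟪(y : E n), (x : E n)⟫_ℝ) =
      -⟪(y : E n), (x : E n)⟫_ℝ := by
    have := Real.pi_ne_zero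
    field_simp
  rw [h1, h2]
  push_cast
  ring

theorem TS.exists_mk (p : TS n) : ∃ (ξ : Sph n) (y : perp (ξ : E n)), TS.mk ξ y = p :=
  ⟨p.base, ⟨p.1.1, by
    rw [Submodule.mem_orthogonal_singleton_iff_inner_right, real_inner_comm]
    exact p.2.2⟩, rfl⟩

/-- On each fibre, |y|^N times the transform is bounded by the L¹-norms of the derivatives of order
at most N, and these are bounded uniformly in ξ. -/
theorem IsSchwartz.rapid_fourierTS {φ : TS n → ℂ} (hφ : IsSchwartz φ) (hn : 0 < n) :
    Rapid (fourierTS φ) := by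
  refine rapid_of_pow_mul_le fun N => ?_
  choose C hC using hφ.integrable_fibre_deriv hn
  set c : ℝ := (2 * Real.pi) ^ (-((n : ℝ) - 1) / 2) with hc
  have hc0 : 0 ≤ c := by positivity
  refine ⟨c * ((2 * Real.pi) ^ N * (2 ^ N * ∑ m ∈ Finset.range (N + 1), C m)), fun p => ?_⟩
  obtain ⟨ξ, y, rfl⟩ := p.exists_mk
  rw [fourierTS_mk, norm_mul, Complex.norm_real, Real.norm_of_nonneg hc0]
  set f := fun x : perp (ξ : E n) => φ (TS.mk ξ x) with hf
  have h1 := Real.pow_mul_norm_iteratedFDeriv_fourier_le (K := 0) (N := ⊤) (f := f)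
    (hφ.contDiff_fibre ξ) (fun k m hk _ => by
      have hk' : k = 0 := by simpa using hk
      subst hk'
      simpa using ((hC m ξ).1).norm) (k := 0) (n := N) le_rfl le_top ((2 * Real.pi)⁻¹ • y)
  simp only [norm_iteratedFDeriv_zero, pow_zero, one_mul, CharP.cast_eq_zero, mul_zero, zero_add,
    Finset.range_one, Finset.sum_product, Finset.sum_singleton] at h1
  have h2 : ‖(2 * Real.pi)⁻¹ • y‖ ^ N = ((2 * Real.pi) ^ N)⁻¹ * ‖y‖ ^ N := by
    rw [norm_smul, mul_pow, norm_inv, Real.norm_of_nonneg (by positivity), inv_pow]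
  rw [h2, mul_assoc, inv_mul_le_iff₀ (by positivity)] at h1
  calc ‖(TS.mk ξ y).1.1‖ ^ N * (c * ‖𝓕 f ((2 * Real.pi)⁻¹ • y)‖)
      = c * (‖y‖ ^ N * ‖𝓕 f ((2 * Real.pi)⁻¹ • y)‖) := by
        have : ‖(TS.mk ξ y).1.1‖ = ‖y‖ := rfl
        rw [this]
        ring
    _ ≤ _ := by
        refine mul_le_mul_of_nonneg_left (h1.trans (mul_le_mul_of_nonneg_left
          (mul_le_mul_of_nonneg_left (Finset.sum_le_sum fun m _ => (hC m ξ).2) ?_) ?_)) hc0 <;>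
        positivity

theorem IsSchwartz.eq_zero_of_fourierTS {φ : TS n → ℂ} (hφ : IsSchwartz φ) (hn : 0 < n)
    (h : ∀ p, fourierTS φ p = 0) : φ = 0 := by
  funext p
  obtain ⟨ξ, y, rfl⟩ := p.exists_mk
  set f := fun x : perp (ξ : E n) => φ (TS.mk ξ x) with hf
  have h1 : 𝓕 f = 0 := by
    funext w
    have h2 := h (TS.mk ξ ((2 * Real.pi) • w))
    rw [fourierTS_mk, smul_smul, inv_mul_cancel₀ (by positivity), one_smul] at h2
    refine (mul_eq_zero.mp h2).resolve_left ?_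
    exact_mod_cast (by positivity : (2 * Real.pi) ^ (-((n : ℝ) - 1) / 2) ≠ 0)
  have hcont : Continuous f := (hφ.contDiff_fibre ξ).continuous
  have h3 := hcont.fourierInv_fourier_eq (hφ.integrable_fibre hn ξ) (by
    rw [h1]
    exact integrable_zero _ _ _)
  rw [h1] at h3
  have h4 := congrFun h3 y
  change φ (TS.mk ξ y) = 0
  rw [← show f y = φ (TS.mk ξ y) from rfl, ← h4]
  simp [Real.fourierInv_eq]

end

section

/-! ### The fields `Ξ_i` commute with the fibrewise Fourier transform -/

open Set Filter Topology

variable {n : ℕ}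

/-- The normalization `ξ / |ξ|`. -/
def nrm (ξ : E n) : E n := ‖ξ‖⁻¹ • ξ

theorem norm_nrm {ξ : E n} (hξ : ξ ≠ 0) : ‖nrm ξ‖ = 1 := norm_smul_inv_norm (𝕜 := ℝ) hξ

theorem nrm_of_norm_eq_one {ξ : E n} (hξ : ‖ξ‖ = 1) : nrm ξ = ξ := by simp [nrm, hξ]

theorem contDiffAt_nrm {ξ : E n} (hξ : ξ ≠ 0) : ContDiffAt ℝ 2 nrm ξ :=
  ((contDiffAt_norm ℝ hξ).inv (norm_ne_zero_iff.mpr hξ)).smul contDiffAt_id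

theorem fderiv_nrm {ξ v : E n} (hξ : ‖ξ‖ = 1) (hv : ⟪ξ, v⟫_ℝ = 0) : fderiv ℝ nrm ξ v = v := by
  have hξ0 : ξ ≠ 0 := norm_ne_zero_iff.mp (by rw [hξ]; norm_num)
  have h1 : HasFDerivAt (fun ξ : E n => ‖ξ‖) (fderiv ℝ (fun ξ : E n => ‖ξ‖) ξ) ξ :=
    ((contDiffAt_norm ℝ hξ0 (n := 1)).differentiableAt one_ne_zero).hasFDerivAt
  have h2 : fderiv ℝ (fun ξ : E n => ‖ξ‖) ξ v = 0 := by
    have h3 := (h1.pow 2).unique (hasStrictFDerivAt_norm_sq ξ).hasFDerivAt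
    have h4 := congrArg (fun L : E n →L[ℝ] ℝ => L v) h3
    simp only [hξ] at h4
    simpa [hv] using h4
  have h5 := ((hasDerivAt_inv (norm_ne_zero_iff.mpr hξ0)).comp_hasFDerivAt ξ h1).smul
    (hasFDerivAt_id ξ)
  have h6 : fderiv ℝ nrm ξ = _ := HasFDerivAt.fderiv h5
  rw [h6]
  simp [h2, hξ]

/-- The reflection in the hyperplane orthogonal to `ξ / |ξ| + ξ₀`; it maps `ξ₀^⊥` onto `ξ^⊥`. -/
def turn (ξ₀ ξ : E n) : E n →L[ℝ] E n :=
  ContinuousLinearMap.id ℝ (E n) - (innerSL ℝ (nrm ξ + ξ₀)).smulRight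
    ((2 / ‖nrm ξ + ξ₀‖ ^ 2) • (nrm ξ + ξ₀))

theorem turn_apply (ξ₀ ξ x : E n) : turn ξ₀ ξ x =
    x - ⟪nrm ξ + ξ₀, x⟫_ℝ • (2 / ‖nrm ξ + ξ₀‖ ^ 2) • (nrm ξ + ξ₀) := by
  rw [turn, sub_apply, ContinuousLinearMap.id_apply, ContinuousLinearMap.smulRight_apply,
    innerSL_apply_apply]

theorem contDiffAt_turnVector {ξ₀ ξ : E n} (hξ : ξ ≠ 0) (hw : nrm ξ + ξ₀ ≠ 0) :
    ContDiffAt ℝ 2 (fun ξ => (2 / ‖nrm ξ + ξ₀‖ ^ 2) • (nrm ξ + ξ₀)) ξ := by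
  have h1 : ContDiffAt ℝ 2 (fun ξ => nrm ξ + ξ₀) ξ := (contDiffAt_nrm hξ).add contDiffAt_const
  exact (contDiffAt_const.div (h1.norm_sq ℝ) (pow_ne_zero 2 (norm_ne_zero_iff.mpr hw))).smul h1

theorem contDiffAt_turn {ξ₀ ξ : E n} (hξ : ξ ≠ 0) (hw : nrm ξ + ξ₀ ≠ 0) :
    ContDiffAt ℝ 2 (turn ξ₀) ξ := by
  have h1 : ContDiffAt ℝ 2 (fun ξ => nrm ξ + ξ₀) ξ := (contDiffAt_nrm hξ).add contDiffAt_const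
  exact contDiffAt_const.sub
    (((innerSL ℝ).contDiff.contDiffAt.comp ξ h1).smulRight (contDiffAt_turnVector hξ hw))

theorem norm_turn {ξ₀ ξ : E n} (hw : nrm ξ + ξ₀ ≠ 0) (x : E n) :
    ‖turn ξ₀ ξ x‖ = ‖x‖ := by
  have h1 : ‖nrm ξ + ξ₀‖ ≠ 0 := norm_ne_zero_iff.mpr hw
  refine (sq_eq_sq₀ (norm_nonneg _) (norm_nonneg _)).mp ?_
  rw [turn_apply, norm_sub_sq_real, inner_smul_right, inner_smul_right, norm_smul, norm_smul,
    real_inner_comm, mul_pow, mul_pow, Real.norm_eq_abs, Real.norm_eq_abs, sq_abs, sq_abs]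
  field_simp
  ring

section turn

variable {ξ₀ : E n} (h₀ : ‖ξ₀‖ = 1)
include h₀

theorem norm_sq_add_nrm {ξ : E n} (hξ : ξ ≠ 0) :
    ‖nrm ξ + ξ₀‖ ^ 2 = 2 * ⟪nrm ξ + ξ₀, nrm ξ⟫_ℝ := by
  rw [norm_add_sq_real, inner_add_left, real_inner_self_eq_norm_sq, norm_nrm hξ, h₀,
    real_inner_comm]
  ring

theorem inner_turn {ξ : E n} (hξ : ξ ≠ 0) (hw : nrm ξ + ξ₀ ≠ 0) (x : perp ξ₀) :
    ⟪nrm ξ, turn ξ₀ ξ x⟫_ℝ = 0 := by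
  have h1 : ‖nrm ξ + ξ₀‖ ^ 2 ≠ 0 := pow_ne_zero 2 (norm_ne_zero_iff.mpr hw)
  have h2 := norm_sq_add_nrm h₀ hξ
  rw [turn_apply, inner_sub_right, inner_smul_right, inner_smul_right, inner_add_left,
    inner_coe_perp, real_inner_comm (nrm ξ + ξ₀) (nrm ξ), h2]
  rw [h2] at h1
  have h3 : ⟪nrm ξ + ξ₀, nrm ξ⟫_ℝ ≠ 0 := fun h => h1 (by rw [h, mul_zero])
  field_simp
  ring

theorem turn_self (x : perp ξ₀) : turn ξ₀ ξ₀ x = x := by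
  rw [turn_apply, nrm_of_norm_eq_one h₀, inner_add_left, inner_coe_perp]
  simp

theorem self_add_ne_zero : nrm ξ₀ + ξ₀ ≠ 0 := by
  rw [nrm_of_norm_eq_one h₀, ← two_smul ℝ]
  exact smul_ne_zero two_ne_zero (norm_ne_zero_iff.mp (by rw [h₀]; norm_num))

/-- When the hyperplane tilts with velocity v, the point x moves by -⟨v, x⟩ ξ₀; for the ξ-part v of
Ξ_i this is the x-part of Ξ_i. At ξ₀ the coefficient ⟨ξ/|ξ| + ξ₀, x⟩ vanishes, so only its own
derivative survives in the product rule. -/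
theorem fderiv_turn {v : E n} (hv : ⟪ξ₀, v⟫_ℝ = 0) (x : perp ξ₀) :
    fderiv ℝ (turn ξ₀) ξ₀ v x = -(⟪v, (x : E n)⟫_ℝ • ξ₀) := by
  have hξ0 : ξ₀ ≠ 0 := norm_ne_zero_iff.mp (by rw [h₀]; norm_num)
  have hw := self_add_ne_zero h₀
  have h1 := ((contDiffAt_turn hξ0 hw).differentiableAt two_ne_zero).hasFDerivAt.clm_apply
    (hasFDerivAt_const (x : E n) ξ₀)
  have h2 : HasFDerivAt (fun ξ => nrm ξ + ξ₀) (fderiv ℝ nrm ξ₀) ξ₀ :=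
    ((contDiffAt_nrm hξ0).differentiableAt two_ne_zero).hasFDerivAt.add_const ξ₀
  have h3 := ((contDiffAt_turnVector hξ0 hw).differentiableAt two_ne_zero).hasFDerivAt
  have h4 := (hasFDerivAt_const (x : E n) ξ₀).sub
    ((h2.inner ℝ (hasFDerivAt_const (x : E n) ξ₀)).smul h3)
  have h5 := (h1.congr_of_eventuallyEq (f₁ := fun ξ => (x : E n) - ⟪nrm ξ + ξ₀, (x : E n)⟫_ℝ •
    (2 / ‖nrm ξ + ξ₀‖ ^ 2) • (nrm ξ + ξ₀))
    (.of_forall fun ξ => (turn_apply ξ₀ ξ x).symm)).unique h4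
  have h6 := congrArg (fun L : E n →L[ℝ] E n => L v) h5
  have h7 : (2 / ‖nrm ξ₀ + ξ₀‖ ^ 2) • (nrm ξ₀ + ξ₀) = ξ₀ := by
    rw [nrm_of_norm_eq_one h₀, ← two_smul ℝ ξ₀, norm_smul, h₀, smul_smul]
    norm_num
  have h8 : ⟪nrm ξ₀ + ξ₀, (x : E n)⟫_ℝ = 0 := by
    rw [nrm_of_norm_eq_one h₀, inner_add_left, inner_coe_perp, add_zero]
  simp only [h7, h8] at h6
  simpa [fderivInnerCLM_apply, fderiv_nrm h₀ hv] using h6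

/-- The reflection as an isometry of `ξ₀^⊥` onto `ξ^⊥`. -/
def turnEquiv {ξ : E n} (hξ : ξ ≠ 0) (hw : nrm ξ + ξ₀ ≠ 0) : perp ξ₀ ≃ₗᵢ[ℝ] perp (nrm ξ) :=
  LinearIsometry.toLinearIsometryEquiv
    { toLinearMap := LinearMap.codRestrict (perp (nrm ξ))
        ((turn ξ₀ ξ : E n →ₗ[ℝ] E n) ∘ₗ (perp ξ₀).subtype) fun x =>
          Submodule.mem_orthogonal_singleton_iff_inner_right.mpr (inner_turn h₀ hξ hw x)
      norm_map' := fun x => norm_turn hw x }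
    (by
      rw [finrank_perp _ (norm_ne_zero_iff.mp (by rw [h₀]; norm_num)),
        finrank_perp _ (norm_ne_zero_iff.mp (by rw [norm_nrm hξ]; norm_num))])

/-- The domain of integration ξ^⊥ moves with ξ. The reflection carries the integral to the fixed
space ξ₀^⊥, where differentiation under the integral sign is possible. The retraction of y drops out
because reflected points are orthogonal to ξ. -/
theorem ext_fourierTS (φ : TS n → ℂ) {q : E n × E n} (hξ : q.2 ≠ 0) (hw : nrm q.2 + ξ₀ ≠ 0) :
    ext (fourierTS φ) q = (((2 * Real.pi) ^ (-((n : ℝ) - 1) / 2) : ℝ) : ℂ) *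
      ∫ x : perp ξ₀, Complex.exp (-Complex.I * (⟪q.1, turn ξ₀ q.2 x⟫_ℝ : ℂ)) *
        ext φ (turn ξ₀ q.2 x, nrm q.2) := by
  have h1 : ext (fourierTS φ) q = (((2 * Real.pi) ^ (-((n : ℝ) - 1) / 2) : ℝ) : ℂ) *
      ∫ x : perp (nrm q.2),
        Complex.exp (-Complex.I * (⟪q.1 - (⟪q.2, q.1⟫_ℝ / ‖q.2‖ ^ 2) • q.2, (x : E n)⟫_ℝ : ℂ)) *
        φ (TS.mk ⟨nrm q.2, by simpa using norm_nrm hξ⟩ x) := by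
    simp only [ext, hξ, ne_eq, not_false_eq_true, dif_pos]
    rfl
  rw [h1]
  congr 1
  rw [← (turnEquiv h₀ hξ hw).measurePreserving.integral_comp
    (turnEquiv h₀ hξ hw).toHomeomorph.measurableEmbedding]
  refine integral_congr_ae (.of_forall fun x => ?_)
  have h2 : ((turnEquiv h₀ hξ hw x : perp (nrm q.2)) : E n) = turn ξ₀ q.2 x := rfl
  have h3 : ⟪q.2, turn ξ₀ q.2 x⟫_ℝ = 0 := by
    have h4 := inner_turn h₀ hξ hw x
    rw [nrm, inner_smul_left] at h4
    exact (mul_eq_zero.mp h4).resolve_left (by simpa using hξ)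
  simp only
  rw [h2, inner_sub_left, inner_smul_left, h3, mul_zero, sub_zero]
  congr 1
  exact (ext_apply_coe φ (TS.mk ⟨nrm q.2, by simpa using norm_nrm hξ⟩
    (turnEquiv h₀ hξ hw x))).symm

end turn

/-- The derivative of the phase `⟨y, x'⟩` where `x'` is the reflected point. -/
def phaseDeriv (ξ₀ : E n) (q : E n × E n) (x : E n) : E n × E n →L[ℝ] ℝ :=
  (innerSL ℝ (turn ξ₀ q.2 x)).comp (ContinuousLinearMap.fst ℝ (E n) (E n)) +
    (innerSL ℝ q.1).comp (((fderiv ℝ (turn ξ₀) q.2).flip x).comp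
      (ContinuousLinearMap.snd ℝ (E n) (E n)))

/-- The derivative of the reflected point of `T S^{n-1}`. -/
def pointDeriv (ξ₀ : E n) (q : E n × E n) (x : E n) : E n × E n →L[ℝ] E n × E n :=
  (ContinuousLinearMap.inl ℝ (E n) (E n)).comp (((fderiv ℝ (turn ξ₀) q.2).flip x).comp
      (ContinuousLinearMap.snd ℝ (E n) (E n))) +
    (ContinuousLinearMap.inr ℝ (E n) (E n)).comp ((fderiv ℝ nrm q.2).comp
      (ContinuousLinearMap.snd ℝ (E n) (E n)))

/-- The derivative of the integrand of the Fourier transform. -/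
def integrandDeriv (ξ₀ : E n) (φ : TS n → ℂ) (q : E n × E n) (x : E n) : E n × E n →L[ℝ] ℂ :=
  Complex.exp (-Complex.I * (⟪q.1, turn ξ₀ q.2 x⟫_ℝ : ℂ)) •
    (fderiv ℝ (ext φ) (turn ξ₀ q.2 x, nrm q.2)).comp (pointDeriv ξ₀ q x) +
  ext φ (turn ξ₀ q.2 x, nrm q.2) •
    (Complex.exp (-Complex.I * (⟪q.1, turn ξ₀ q.2 x⟫_ℝ : ℂ)) •
      (-Complex.I) • Complex.ofRealCLM.comp (phaseDeriv ξ₀ q x))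

theorem hasFDerivAt_integrand {ξ₀ : E n} {φ : TS n → ℂ} (hφ : IsSchwartz φ) {q : E n × E n}
    (hξ : q.2 ≠ 0) (hw : nrm q.2 + ξ₀ ≠ 0) (x : E n) :
    HasFDerivAt (fun q : E n × E n => Complex.exp (-Complex.I * (⟪q.1, turn ξ₀ q.2 x⟫_ℝ : ℂ)) *
      ext φ (turn ξ₀ q.2 x, nrm q.2)) (integrandDeriv ξ₀ φ q x) q := by
  have h1 : HasFDerivAt (fun q : E n × E n => turn ξ₀ q.2 x)
      (((fderiv ℝ (turn ξ₀) q.2).flip x).comp (ContinuousLinearMap.snd ℝ (E n) (E n))) q := by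
    have h2 := (((contDiffAt_turn hξ hw).differentiableAt two_ne_zero).hasFDerivAt.clm_apply
      (hasFDerivAt_const x q.2)).comp q hasFDerivAt_snd
    refine h2.congr_fderiv ?_
    ext v <;> simp
  have h3 : HasFDerivAt (fun q : E n × E n => nrm q.2)
      ((fderiv ℝ nrm q.2).comp (ContinuousLinearMap.snd ℝ (E n) (E n))) q :=
    ((contDiffAt_nrm hξ).differentiableAt two_ne_zero).hasFDerivAt.comp q hasFDerivAt_snd
  have h4 : HasFDerivAt (fun q : E n × E n => (turn ξ₀ q.2 x, nrm q.2)) (pointDeriv ξ₀ q x) q := by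
    refine (h1.prodMk h3).congr_fderiv ?_
    ext v <;> simp [pointDeriv]
  have h5 : HasFDerivAt (fun q : E n × E n => ⟪q.1, turn ξ₀ q.2 x⟫_ℝ) (phaseDeriv ξ₀ q x) q := by
    refine (hasFDerivAt_fst.inner ℝ h1).congr_fderiv ?_
    ext v <;> simp [phaseDeriv, fderivInnerCLM_apply, real_inner_comm]
  have h6 : HasFDerivAt (ext φ) (fderiv ℝ (ext φ) (turn ξ₀ q.2 x, nrm q.2))
      (turn ξ₀ q.2 x, nrm q.2) := by
    refine ((hφ.1.contDiffAt (isOpen_ne.mem_nhds ?_)).differentiableAt (by simp)).hasFDerivAt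
    exact smul_ne_zero (inv_ne_zero (norm_ne_zero_iff.mpr hξ)) hξ
  have h7 := ((Complex.ofRealCLM.hasFDerivAt.comp q h5).const_mul (-Complex.I)).cexp
  exact h7.mul (h6.comp (f := fun q : E n × E n => (turn ξ₀ q.2 x, nrm q.2)) q h4)

theorem norm_integrandDeriv_le {ξ₀ : E n} {φ : TS n → ℂ} {q : E n × E n}
    (hw : nrm q.2 + ξ₀ ≠ 0) {A : ℝ} (hA : 0 ≤ A)
    (h1 : ‖fderiv ℝ (turn ξ₀) q.2‖ ≤ A) (h2 : ‖fderiv ℝ nrm q.2‖ ≤ A) (h3 : ‖q.1‖ ≤ A) (x : E n) :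
    ‖integrandDeriv ξ₀ φ q x‖ ≤ (1 + A) ^ 2 * (1 + ‖x‖) *
      (‖fderiv ℝ (ext φ) (turn ξ₀ q.2 x, nrm q.2)‖ + ‖ext φ (turn ξ₀ q.2 x, nrm q.2)‖) := by
  have hexp : ‖Complex.exp (-Complex.I * (⟪q.1, turn ξ₀ q.2 x⟫_ℝ : ℂ))‖ = 1 := by
    rw [neg_mul, ← mul_neg, mul_comm, ← Complex.ofReal_neg, Complex.norm_exp_ofReal_mul_I]
  have hflip : ‖(fderiv ℝ (turn ξ₀) q.2).flip x‖ ≤ A * ‖x‖ := by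
    refine (ContinuousLinearMap.le_opNorm _ _).trans ?_
    rw [ContinuousLinearMap.opNorm_flip]
    gcongr
  have hsnd := ContinuousLinearMap.norm_snd_le ℝ (E n) (E n)
  have hfst := ContinuousLinearMap.norm_fst_le ℝ (E n) (E n)
  have hx := norm_nonneg x
  have hphase : ‖phaseDeriv ξ₀ q x‖ ≤ ‖x‖ + A * (A * ‖x‖) := by
    refine (norm_add_le _ _).trans (add_le_add ?_ ?_)
    · refine (ContinuousLinearMap.opNorm_comp_le _ _).trans ?_
      rw [innerSL_apply_norm, norm_turn hw]
      exact mul_le_of_le_one_right hx hfst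
    · refine (ContinuousLinearMap.opNorm_comp_le _ _).trans ?_
      rw [innerSL_apply_norm]
      refine mul_le_mul h3 ?_ (norm_nonneg _) hA
      refine (ContinuousLinearMap.opNorm_comp_le _ _).trans ?_
      exact (mul_le_of_le_one_right (norm_nonneg _) hsnd).trans hflip
  have hpoint : ‖pointDeriv ξ₀ q x‖ ≤ A * ‖x‖ + A := by
    refine (norm_add_le _ _).trans (add_le_add ?_ ?_)
    · refine (ContinuousLinearMap.opNorm_comp_le _ _).trans ?_
      refine (mul_le_of_le_one_left (norm_nonneg _)
        (ContinuousLinearMap.norm_inl_le_one ℝ (E n) (E n))).trans ?_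
      refine (ContinuousLinearMap.opNorm_comp_le _ _).trans ?_
      exact (mul_le_of_le_one_right (norm_nonneg _) hsnd).trans hflip
    · refine (ContinuousLinearMap.opNorm_comp_le _ _).trans ?_
      refine (mul_le_of_le_one_left (norm_nonneg _)
        (ContinuousLinearMap.norm_inr_le_one ℝ (E n) (E n))).trans ?_
      refine (ContinuousLinearMap.opNorm_comp_le _ _).trans ?_
      exact (mul_le_of_le_one_right (norm_nonneg _) hsnd).trans h2
  have hofReal : ‖Complex.ofRealCLM.comp (phaseDeriv ξ₀ q x)‖ ≤ ‖x‖ + A * (A * ‖x‖) := by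
    refine (ContinuousLinearMap.opNorm_comp_le _ _).trans ?_
    rw [Complex.ofRealCLM_norm, one_mul]
    exact hphase
  refine (norm_add_le _ _).trans ?_
  rw [mul_add]
  refine add_le_add ?_ ?_
  · rw [norm_smul, hexp, one_mul, mul_comm]
    refine (ContinuousLinearMap.opNorm_comp_le _ _).trans ?_
    refine mul_le_mul_of_nonneg_left (hpoint.trans ?_) (norm_nonneg _)
    nlinarith [mul_nonneg hA hx, mul_nonneg (mul_nonneg hA hA) hx, mul_nonneg hA hA]
  · rw [norm_smul, norm_smul, hexp, one_mul, norm_smul, norm_neg, Complex.norm_I, one_mul, mul_comm]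
    refine mul_le_mul_of_nonneg_right (hofReal.trans ?_) (norm_nonneg _)
    nlinarith [mul_nonneg hA hx, mul_nonneg (mul_nonneg hA hA) hx, mul_nonneg hA hA]

theorem hasFDerivAt_ext_fourierTS (hn : 0 < n) {φ : TS n → ℂ} (hφ : IsSchwartz φ) (p : TS n) :
    Integrable (fun x : perp p.1.2 => integrandDeriv p.1.2 φ p.1 x) ∧
    HasFDerivAt (ext (fourierTS φ)) ((((2 * Real.pi) ^ (-((n : ℝ) - 1) / 2) : ℝ) : ℂ) •
      ∫ x : perp p.1.2, integrandDeriv p.1.2 φ p.1 x) p.1 := by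
  set ξ₀ := p.1.2 with hξ₀
  have h₀ : ‖ξ₀‖ = 1 := p.2.1
  have hξ0 : ξ₀ ≠ 0 := p.snd_ne_zero
  have hw0 := self_add_ne_zero h₀
  -- One power absorbs the factor 1 + |x| from differentiating the phase and the reflected point.
  -- The other n make the bound integrable on the (n-1)-dimensional fibre.
  obtain ⟨C₀, hC₀, hC₀'⟩ := hφ.exists_bound 0 (n + 1)
  obtain ⟨C₁, hC₁, hC₁'⟩ := hφ.exists_bound 1 (n + 1)
  set A : ℝ := ‖fderiv ℝ (turn ξ₀) ξ₀‖ + ‖fderiv ℝ nrm ξ₀‖ + ‖p.1.1‖ + 1 with hAdef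
  have hA : 0 ≤ A := by positivity
  have hturn := (contDiffAt_turn hξ0 hw0).fderiv_right (m := 1) (by norm_num)
  have hnrm := (contDiffAt_nrm hξ0).fderiv_right (m := 1) (by norm_num)
  have hs : Tendsto (fun q : E n × E n => q.2) (𝓝 p.1) (𝓝 ξ₀) := continuous_snd.tendsto p.1
  have e1 : ∀ᶠ q : E n × E n in 𝓝 p.1, q.2 ≠ 0 := isOpen_ne.mem_nhds hξ0
  have e2 : ∀ᶠ q : E n × E n in 𝓝 p.1, nrm q.2 + ξ₀ ≠ 0 :=
    hs.eventually (((contDiffAt_nrm hξ0).continuousAt.add continuousAt_const).eventually_ne hw0)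
  have e3 : ∀ᶠ q : E n × E n in 𝓝 p.1, ‖fderiv ℝ (turn ξ₀) q.2‖ < A :=
    hs.eventually (hturn.continuousAt.norm.eventually_lt_const (by
      rw [hAdef]
      linarith [norm_nonneg (fderiv ℝ nrm ξ₀), norm_nonneg p.1.1]))
  have e4 : ∀ᶠ q : E n × E n in 𝓝 p.1, ‖fderiv ℝ nrm q.2‖ < A :=
    hs.eventually (hnrm.continuousAt.norm.eventually_lt_const (by
      rw [hAdef]
      linarith [norm_nonneg (fderiv ℝ (turn ξ₀) ξ₀), norm_nonneg p.1.1]))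
  have e5 : ∀ᶠ q : E n × E n in 𝓝 p.1, ‖q.1‖ < A :=
    (continuous_fst.norm.tendsto p.1).eventually_lt_const (by
      rw [hAdef]
      linarith [norm_nonneg (fderiv ℝ (turn ξ₀) ξ₀), norm_nonneg (fderiv ℝ nrm ξ₀)])
  have eall := e1.and (e2.and (e3.and (e4.and e5)))
  have hpt : ∀ q : E n × E n, q.2 ≠ 0 → nrm q.2 + ξ₀ ≠ 0 → ∀ x : perp ξ₀, ∃ p' : TS n,
      p'.1 = (turn ξ₀ q.2 x, nrm q.2) ∧ ‖p'.1.1‖ = ‖x‖ := fun q hq hw x =>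
    ⟨⟨(turn ξ₀ q.2 x, nrm q.2), norm_nrm hq, by
      rw [real_inner_comm]
      exact inner_turn h₀ hq hw x⟩, rfl, norm_turn hw x⟩
  have hbound : ∀ q : E n × E n, q.2 ≠ 0 ∧ nrm q.2 + ξ₀ ≠ 0 ∧ ‖fderiv ℝ (turn ξ₀) q.2‖ < A ∧
      ‖fderiv ℝ nrm q.2‖ < A ∧ ‖q.1‖ < A → ∀ x : perp ξ₀, ‖integrandDeriv ξ₀ φ q x‖ ≤
        ((1 + A) ^ 2 * (C₁ + C₀)) * ((1 + ‖x‖) ^ n)⁻¹ := by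
    intro q hq x
    refine (norm_integrandDeriv_le hq.2.1 hA hq.2.2.1.le hq.2.2.2.1.le
      hq.2.2.2.2.le x).trans ?_
    obtain ⟨p', hp', hp''⟩ := hpt q hq.1 hq.2.1 x
    have b0 := hC₀' p'
    have b1 := hC₁' p'
    rw [norm_iteratedFDeriv_zero, hp'', hp'] at b0
    rw [norm_iteratedFDeriv_one, hp'', hp'] at b1
    rw [mul_assoc, mul_assoc]
    refine mul_le_mul_of_nonneg_left ?_ (by positivity)
    rw [← div_eq_mul_inv, le_div_iff₀ (by positivity)]
    calc _ = (1 + ‖x‖) ^ (n + 1) * ‖fderiv ℝ (ext φ) (turn ξ₀ q.2 x, nrm q.2)‖ +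
          (1 + ‖x‖) ^ (n + 1) * ‖ext φ (turn ξ₀ q.2 x, nrm q.2)‖ := by
            rw [pow_succ]
            simp only [Submodule.coe_norm]
            ring
      _ ≤ _ := add_le_add b1 b0
  have hI : Integrable fun x : perp ξ₀ => ((1 + A) ^ 2 * (C₁ + C₀)) * ((1 + ‖x‖) ^ n)⁻¹ :=
    (integrable_inv_one_add_pow _ (by rw [finrank_perp _ hξ0]; omega)).const_mul _
  have hpair : ∀ q : E n × E n, q.2 ≠ 0 →
      Continuous fun x : perp ξ₀ => ext φ (turn ξ₀ q.2 x, nrm q.2) := fun q hq =>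
    hφ.1.continuousOn.comp_continuous (by fun_prop)
      fun x => smul_ne_zero (inv_ne_zero (norm_ne_zero_iff.mpr hq)) hq
  have hpair' : Continuous fun x : perp ξ₀ => fderiv ℝ (ext φ) (turn ξ₀ ξ₀ x, nrm ξ₀) :=
    (hφ.1.continuousOn_fderiv_of_isOpen isOpen_ne (by simp)).comp_continuous (by fun_prop)
      fun x => smul_ne_zero (inv_ne_zero (norm_ne_zero_iff.mpr hξ0)) hξ0
  have hexpc : ∀ q : E n × E n, Continuous fun x : perp ξ₀ =>
      Complex.exp (-Complex.I * (⟪q.1, turn ξ₀ q.2 x⟫_ℝ : ℂ)) := fun q => by fun_prop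
  have hmeas : Continuous fun x : perp ξ₀ => integrandDeriv ξ₀ φ p.1 x := by
    have h1 := hpair p.1 hξ0
    have h2 : Continuous fun x : perp ξ₀ => phaseDeriv ξ₀ p.1 x := by
      unfold phaseDeriv
      fun_prop
    have h3 : Continuous fun x : perp ξ₀ => pointDeriv ξ₀ p.1 x := by
      unfold pointDeriv
      fun_prop
    have h4 : Continuous fun x : perp ξ₀ =>
        Complex.ofRealCLM.comp (phaseDeriv ξ₀ p.1 (x : E n)) := continuous_const.clm_comp h2
    have h5 : Continuous fun x : perp ξ₀ =>
        (-Complex.I) • Complex.ofRealCLM.comp (phaseDeriv ξ₀ p.1 (x : E n)) :=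
      h4.const_smul (-Complex.I)
    unfold integrandDeriv
    exact Continuous.add ((hexpc p.1).smul (hpair'.clm_comp h3))
      (h1.smul ((hexpc p.1).smul h5))
  have hint : Integrable (fun x : perp ξ₀ => integrandDeriv ξ₀ φ p.1 x) :=
    hI.mono' hmeas.aestronglyMeasurable (.of_forall (hbound p.1 eall.self_of_nhds))
  refine ⟨hint, ?_⟩
  have hFcont : ∀ q : E n × E n, q.2 ≠ 0 → Continuous fun x : perp ξ₀ =>
      Complex.exp (-Complex.I * (⟪q.1, turn ξ₀ q.2 x⟫_ℝ : ℂ)) * ext φ (turn ξ₀ q.2 x, nrm q.2) :=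
    fun q hq => (hexpc q).mul (hpair q hq)
  have hFint : Integrable fun x : perp ξ₀ =>
      Complex.exp (-Complex.I * (⟪p.1.1, turn ξ₀ p.1.2 x⟫_ℝ : ℂ)) *
        ext φ (turn ξ₀ p.1.2 x, nrm p.1.2) := by
    have hI0 : Integrable fun x : perp ξ₀ => C₀ * ((1 + ‖x‖) ^ (n + 1))⁻¹ :=
      (integrable_inv_one_add_pow _ (by rw [finrank_perp _ hξ0]; omega)).const_mul _
    refine hI0.mono' (hFcont p.1 hξ0).aestronglyMeasurable (.of_forall fun x => ?_)
    obtain ⟨p', hp', hp''⟩ := hpt p.1 hξ0 hw0 x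
    have b0 := hC₀' p'
    rw [norm_iteratedFDeriv_zero, hp'', hp'] at b0
    rw [norm_mul, neg_mul, ← mul_neg, mul_comm Complex.I, ← Complex.ofReal_neg,
      Complex.norm_exp_ofReal_mul_I, one_mul, ← div_eq_mul_inv, le_div_iff₀ (by positivity),
      mul_comm]
    exact b0
  have key := hasFDerivAt_integral_of_dominated_of_fderiv_le (𝕜 := ℝ)
    (μ := (volume : Measure (perp ξ₀)))
    (F := fun (q : E n × E n) (x : perp ξ₀) =>
      Complex.exp (-Complex.I * (⟪q.1, turn ξ₀ q.2 x⟫_ℝ : ℂ)) * ext φ (turn ξ₀ q.2 x, nrm q.2))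
    (F' := fun q x => integrandDeriv ξ₀ φ q x) (x₀ := p.1) eall
    (bound := fun x => ((1 + A) ^ 2 * (C₁ + C₀)) * ((1 + ‖x‖) ^ n)⁻¹)
    (e1.mono fun q hq => (hFcont q hq).aestronglyMeasurable) hFint hmeas.aestronglyMeasurable
    (.of_forall fun x q hq => hbound q hq x) hI
    (.of_forall fun x q hq => hasFDerivAt_integrand hφ hq.1 hq.2.1 x)
  refine (key.const_mul _).congr_of_eventuallyEq ?_
  filter_upwards [e1, e2] with q h1 h2
  exact ext_fourierTS h₀ φ h1 h2

theorem IsSchwartz.differentiableAt_fourierTS (hn : 0 < n) {φ : TS n → ℂ} (hφ : IsSchwartz φ)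
    (p : TS n) : DifferentiableAt ℝ (ext (fourierTS φ)) p.1 :=
  (hasFDerivAt_ext_fourierTS hn hφ p).2.differentiableAt

theorem IsSchwartz.continuous_fourierTS (hn : 0 < n) {φ : TS n → ℂ} (hφ : IsSchwartz φ) :
    Continuous (fourierTS φ) := by
  have h : fourierTS φ = fun p : TS n => ext (fourierTS φ) p.1 :=
    funext fun p => (ext_apply_coe _ p).symm
  rw [h, continuous_iff_continuousAt]
  exact fun p => (hφ.differentiableAt_fourierTS hn p).continuousAt.comp continuousAt_subtype_val

/-- The direction of the tangent vector `Ξ_i` at a point. -/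
def xiDir (i : Fin n) (p : E n × E n) : E n × E n :=
  (-(p.1 i • p.2), EuclideanSpace.single i (1 : ℝ) - p.2 i • p.2)

theorem inner_xiDir (i : Fin n) (p : TS n) (x : E n) :
    ⟪(xiDir i p.1).2, x⟫_ℝ = x i - p.1.2 i * ⟪p.1.2, x⟫_ℝ := by
  rw [xiDir, inner_sub_left, inner_smul_left, EuclideanSpace.inner_single_left]
  simp

theorem inner_snd_xiDir (i : Fin n) (p : TS n) : ⟪p.1.2, (xiDir i p.1).2⟫_ℝ = 0 := by
  rw [real_inner_comm, inner_xiDir, real_inner_self_eq_norm_sq, p.2.1]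
  ring

/-- Along Ξ_i the phase ⟨y, x⟩ is stationary: the motion of y contributes -y_i ⟨x, ξ⟩ and that of x
contributes -x_i ⟨y, ξ⟩, and both vanish. The reflected point (x, ξ) itself moves in the direction
Ξ_i, so the derivative falls entirely on φ. -/
theorem IsSchwartz.xi_fourierTS (hn : 0 < n) {φ : TS n → ℂ} (hφ : IsSchwartz φ) (i : Fin n) :
    Xi i (fourierTS φ) = fourierTS (Xi i φ) := by
  funext p
  obtain ⟨hint, hder⟩ := hasFDerivAt_ext_fourierTS hn hφ p
  have h₀ : ‖p.1.2‖ = 1 := p.2.1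
  have h1 : Xi i (fourierTS φ) p = fderiv ℝ (ext (fourierTS φ)) p.1 (xiDir i p.1) := rfl
  rw [h1, hder.fderiv, FunLike.coe_smul, Pi.smul_apply,
    ContinuousLinearMap.integral_apply hint, smul_eq_mul, fourierTS]
  congr 1
  refine integral_congr_ae (.of_forall fun x => ?_)
  have hv := inner_snd_xiDir i p
  have h2 : fderiv ℝ (turn p.1.2) p.1.2 (xiDir i p.1).2 x = -((x : E n) i • p.1.2) := by
    rw [fderiv_turn h₀ hv, inner_xiDir, inner_coe_perp]
    simp
  have h3 : phaseDeriv p.1.2 p.1 x (xiDir i p.1) = 0 := by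
    simp only [phaseDeriv, add_apply, ContinuousLinearMap.comp_apply,
      ContinuousLinearMap.coe_fst', ContinuousLinearMap.coe_snd', ContinuousLinearMap.flip_apply,
      h2, innerSL_apply_apply, inner_neg_right, inner_smul_right, p.2.2, turn_self h₀]
    simp [xiDir, inner_smul_right, inner_perp_coe]
  have h4 : pointDeriv p.1.2 p.1 x (xiDir i p.1) = xiDir i (TS.mk p.base x).1 := by
    simp only [pointDeriv, add_apply, ContinuousLinearMap.comp_apply,
      ContinuousLinearMap.coe_snd', ContinuousLinearMap.flip_apply, h2, fderiv_nrm h₀ hv]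
    simp [xiDir, TS.mk, TS.base]
  simp only [integrandDeriv, add_apply, FunLike.coe_smul,
    Pi.smul_apply, ContinuousLinearMap.comp_apply, h3, h4, map_zero,
    turn_self h₀, nrm_of_norm_eq_one h₀, smul_eq_mul, mul_zero, add_zero]
  rfl

end

section

/-! ### Fourier transforms of momentum ray transforms -/

open Set Filter Topology FourierTransform

variable {n : ℕ}

theorem norm_phase (a : ℝ) : ‖Complex.exp (-Complex.I * (a : ℂ))‖ = 1 := by
  rw [neg_mul, ← mul_neg, mul_comm, ← Complex.ofReal_neg, Complex.norm_exp_ofReal_mul_I]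

theorem integrable_phase_smul {F : Type*} [NormedAddCommGroup F] [NormedSpace ℂ F] {g : E n → F}
    (hg : Integrable g) (y : E n) :
    Integrable fun z => Complex.exp (-Complex.I * (⟪y, z⟫_ℝ : ℂ)) • g z := by
  refine hg.norm.mono' ?_ (.of_forall fun z => ?_)
  · exact (Continuous.aestronglyMeasurable (by fun_prop)).smul hg.aestronglyMeasurable
  · rw [norm_smul, norm_phase, one_mul]

/-- The vector valued Fourier transform on `ℝⁿ`, with the normalization of `fourierE`. -/
def fourierCn (f : E n → Cn n) (y : E n) : Cn n :=
  (((2 * Real.pi) ^ (-(n : ℝ) / 2) : ℝ) : ℂ) •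
    ∫ x : E n, Complex.exp (-Complex.I * (⟪y, x⟫_ℝ : ℂ)) • f x

theorem fourierCn_apply {f : E n → Cn n} (hf : Integrable f) (y : E n) (i : Fin n) :
    fourierCn f y i = fourierE (fun x => f x i) y := by
  have h := (EuclideanSpace.proj i : Cn n →L[ℂ] ℂ).integral_comp_comm (integrable_phase_smul hf y)
  simp only [PiLp.proj_apply, PiLp.smul_apply, smul_eq_mul] at h
  simp only [fourierCn, fourierE, PiLp.smul_apply, smul_eq_mul, h]

theorem fourierCn_eq (f : E n → Cn n) (y : E n) : fourierCn f y =
    (((2 * Real.pi) ^ (-(n : ℝ) / 2) : ℝ) : ℂ) • 𝓕 f ((2 * Real.pi)⁻¹ • y) := by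
  rw [Real.fourier_eq', fourierCn]
  congr 1
  refine integral_congr_ae (.of_forall fun x => ?_)
  have h2 : -2 * Real.pi * ⟪x, (2 * Real.pi)⁻¹ • y⟫_ℝ = -⟪y, x⟫_ℝ := by
    rw [inner_smul_right, real_inner_comm]
    have := Real.pi_ne_zero
    field_simp
  simp only
  rw [h2]
  congr 2
  push_cast
  ring

theorem integrable_inner_smul (f : 𝓢(E n, Cn n)) (k : ℕ) (ξ : E n) :
    Integrable fun z => (⟪ξ, z⟫_ℝ) ^ k • f z := by
  refine ((f.integrable_pow_mul volume k).const_mul (‖ξ‖ ^ k)).mono' ?_ (.of_forall fun z => ?_)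
  · have := f.continuous
    exact Continuous.aestronglyMeasurable (by fun_prop)
  · rw [norm_smul, norm_pow, ← mul_assoc, ← mul_pow]
    gcongr
    exact norm_inner_le_norm _ _

theorem hasFDerivAt_fourierCn (f : 𝓢(E n, Cn n)) (y : E n) :
    DifferentiableAt ℝ (fourierCn f) y ∧ ∀ ξ, fderiv ℝ (fourierCn f) y ξ =
      -Complex.I • fourierCn (fun z => ⟪ξ, z⟫_ℝ • f z) y := by
  have hi := f.integrable (μ := volume)
  have hi1 : Integrable fun v : E n => ‖v‖ * ‖f v‖ := by
    simpa using f.integrable_pow_mul volume 1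
  have h1 := Real.hasFDerivAt_fourier hi hi1 ((2 * Real.pi)⁻¹ • y)
  have h2 : HasFDerivAt (fun y : E n => (2 * Real.pi)⁻¹ • y)
      ((2 * Real.pi)⁻¹ • ContinuousLinearMap.id ℝ (E n)) y :=
    (hasFDerivAt_id y).const_smul (2 * Real.pi)⁻¹
  have h3 := (h1.comp y h2).const_smul (((2 * Real.pi) ^ (-(n : ℝ) / 2) : ℝ) : ℂ)
  have h5 := h3.congr_of_eventuallyEq (.of_forall fun y => fourierCn_eq f y : fourierCn f =ᶠ[𝓝 y] _)
  refine ⟨h5.differentiableAt, fun ξ => ?_⟩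
  have hm : Integrable (VectorFourier.fourierSMulRight (innerSL ℝ) (f : E n → Cn n)) := by
    refine (hi1.const_mul (2 * Real.pi * ‖innerSL ℝ (E := E n)‖)).mono'
      hi.aestronglyMeasurable.fourierSMulRight (.of_forall fun v => ?_)
    exact (VectorFourier.norm_fourierSMulRight_le _ _ v).trans (le_of_eq (by ring))
  rw [h5.fderiv, fourierCn_eq, smul_comm]
  simp only [FunLike.coe_smul, Pi.smul_apply, ContinuousLinearMap.comp_apply,
    ContinuousLinearMap.id_apply, map_smul]
  congr 1
  rw [Real.fourier_continuousLinearMap_apply hm, Real.fourier_eq', Real.fourier_eq',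
    ← integral_smul, ← integral_smul]
  refine integral_congr_ae (.of_forall fun z => ?_)
  have h6 : innerSL ℝ z ξ = ⟪ξ, z⟫_ℝ :=
    (innerSL_apply_apply ℝ z ξ).trans (real_inner_comm _ _)
  simp only [VectorFourier.fourierSMulRight_apply, h6]
  simp only [← Complex.coe_smul (E := Cn n), smul_smul]
  congr 1
  have : (Real.pi : ℂ) ≠ 0 := by exact_mod_cast Real.pi_ne_zero
  push_cast
  field_simp

/-- Source of the factor √(2π) in the slice formulas: the normalizing constants belong to dimensions
n - 1 and n. -/
theorem rpow_two_pi : (((2 * Real.pi) ^ (-((n : ℝ) - 1) / 2) : ℝ) : ℂ) =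
    (Real.sqrt (2 * Real.pi) : ℂ) * (((2 * Real.pi) ^ (-(n : ℝ) / 2) : ℝ) : ℂ) := by
  rw [← Complex.ofReal_mul, Real.sqrt_eq_rpow, ← Real.rpow_add (by positivity)]
  congr 2
  ring

theorem momentum_eq (f : 𝓢(E n, Cn n)) (k : ℕ) (p : TS n) : momentum k f p =
    ∫ t : ℝ, pairing n ((t ^ k : ℝ) • f (p.1.1 + t • p.1.2)) p.1.2 := by
  refine integral_congr_ae (.of_forall fun t => ?_)
  simp only [pairing_apply, PiLp.smul_apply, Complex.real_smul, Finset.mul_sum]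
  refine Finset.sum_congr rfl fun i _ => ?_
  push_cast
  ring

/-- The Fourier slice theorem for momentum ray transforms. -/
theorem fourierTS_momentum (f : 𝓢(E n, Cn n)) (k : ℕ) (p : TS n) : fourierTS (momentum k f) p =
    (Real.sqrt (2 * Real.pi) : ℂ) *
      pairing n (fourierCn (fun z => (⟪p.1.2, z⟫_ℝ) ^ k • f z) p.1.1) p.1.2 := by
  obtain ⟨ξ, y, rfl⟩ := p.exists_mk
  have hi := integrable_phase_smul (integrable_inner_smul f k (ξ : E n)) (y : E n)
  have hi2 := ((pairing n).flip (ξ : E n)).integrable_comp hi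
  have h1 : fourierTS (momentum k f) (TS.mk ξ y) =
      (((2 * Real.pi) ^ (-((n : ℝ) - 1) / 2) : ℝ) : ℂ) * ∫ x : perp (ξ : E n),
        Complex.exp (-Complex.I * (⟪(y : E n), (x : E n)⟫_ℝ : ℂ)) *
          momentum k f (TS.mk ξ x) := rfl
  rw [h1, rpow_two_pi, mul_assoc]
  congr 1
  change _ = pairing n (fourierCn (fun z => (⟪(ξ : E n), z⟫_ℝ) ^ k • f z) (y : E n)) (ξ : E n)
  have h2 : pairing n (fourierCn (fun z => (⟪(ξ : E n), z⟫_ℝ) ^ k • f z) (y : E n)) (ξ : E n) =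
      (((2 * Real.pi) ^ (-(n : ℝ) / 2) : ℝ) : ℂ) * ∫ z, (pairing n).flip (ξ : E n)
        (Complex.exp (-Complex.I * (⟪(y : E n), z⟫_ℝ : ℂ)) • (⟪(ξ : E n), z⟫_ℝ) ^ k • f z) := by
    rw [((pairing n).flip (ξ : E n)).integral_comp_comm hi, ContinuousLinearMap.flip_apply,
      fourierCn, Complex.coe_smul, map_smul, smul_apply, Complex.real_smul]
  rw [h2]
  congr 1
  -- Fubini on ξ^⊥ × ℝξ: for y ⊥ ξ the phase does not depend on t, and ⟨ξ, z⟩ = t supplies the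
  -- moment factor.
  rw [← (measurePreserving_slab (ξ : E n) (by simp)).integral_comp
    (measurableEmbedding_slab (ξ : E n) (by simp)), Measure.volume_eq_prod, integral_prod]
  · refine integral_congr_ae (.of_forall fun x => ?_)
    simp only
    rw [momentum_eq, ← integral_const_mul]
    refine integral_congr_ae (.of_forall fun t => ?_)
    have h3 : ⟪(y : E n), (x : E n) + t • (ξ : E n)⟫_ℝ = ⟪(y : E n), (x : E n)⟫_ℝ := by
      rw [inner_add_right, inner_smul_right, inner_perp_coe]
      simp
    simp only [inner_slab, h3, ContinuousLinearMap.flip_apply, pairing_apply, PiLp.smul_apply,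
      Finset.mul_sum, smul_eq_mul, TS.mk]
    exact Finset.sum_congr rfl fun i _ => by ring
  · exact (measurePreserving_slab (ξ : E n) (by simp)).integrable_comp_of_integrable hi2

theorem fourierTS_momentum_zero (f : 𝓢(E n, Cn n)) (p : TS n) : fourierTS (momentum 0 f) p =
    (Real.sqrt (2 * Real.pi) : ℂ) * pairing n (fourierCn f p.1.1) p.1.2 := by
  simp [fourierTS_momentum]

theorem fourierTS_momentum_one (f : 𝓢(E n, Cn n)) (p : TS n) : fourierTS (momentum 1 f) p =
    (Real.sqrt (2 * Real.pi) : ℂ) *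
      (Complex.I * pairing n (fderiv ℝ (fourierCn f) p.1.1 p.1.2) p.1.2) := by
  rw [fourierTS_momentum, (hasFDerivAt_fourierCn f p.1.1).2]
  simp only [pow_one, pairing_apply, PiLp.smul_apply, smul_eq_mul]
  congr 1
  rw [Finset.mul_sum]
  refine Finset.sum_congr rfl fun i _ => ?_
  linear_combination ((fourierCn (fun z => ⟪p.1.2, z⟫_ℝ • f z) p.1.1 i) * (p.1.2 i : ℂ)) *
    Complex.I_mul_I

/-- The derivative is taken along the straight line p + sV with V = Ξ_i(p). The two components stay
exactly orthogonal on it, so the retraction in the canonical extension only normalizes ξ and the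
slice formula applies for all small s. -/
theorem xi_fourierTS_momentum (hn : 0 < n) (f : 𝓢(E n, Cn n)) (i : Fin n) (p : TS n) :
    Xi i (fourierTS (momentum 0 f)) p = (Real.sqrt (2 * Real.pi) : ℂ) *
      (pairing n (fourierCn f p.1.1) (xiDir i p.1).2 -
        (p.1.1 i : ℂ) * pairing n (fderiv ℝ (fourierCn f) p.1.1 p.1.2) p.1.2) := by
  set V := xiDir i p.1 with hV
  have h₀ : ‖p.1.2‖ = 1 := p.2.1
  have hv : ⟪p.1.2, V.2⟫_ℝ = 0 := inner_snd_xiDir i p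
  have hyv : ⟪p.1.1, V.2⟫_ℝ = p.1.1 i := by
    rw [real_inner_comm, hV, inner_xiDir, real_inner_comm, p.2.2]
    ring
  have hline : HasDerivAt (fun s : ℝ => p.1 + s • V) V 0 := by
    simpa using ((hasDerivAt_id (0 : ℝ)).smul_const V).const_add p.1
  have h1 : HasDerivAt (fun s : ℝ => ext (fourierTS (momentum 0 f)) (p.1 + s • V))
      (Xi i (fourierTS (momentum 0 f)) p) 0 := by
    have h2 := ((isSchwartz_momentum f 0).differentiableAt_fourierTS hn p).hasFDerivAt
    exact HasFDerivAt.comp_hasDerivAt_of_eq (0 : ℝ) h2 hline (by simp)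
  have hfst : HasDerivAt (fun s : ℝ => (p.1 + s • V).1) V.1 0 :=
    (ContinuousLinearMap.fst ℝ (E n) (E n)).hasFDerivAt.comp_hasDerivAt (0 : ℝ) hline
  have hsnd : HasDerivAt (fun s : ℝ => (p.1 + s • V).2) V.2 0 :=
    (ContinuousLinearMap.snd ℝ (E n) (E n)).hasFDerivAt.comp_hasDerivAt (0 : ℝ) hline
  have h3 : HasDerivAt (fun s : ℝ => fourierCn f (p.1 + s • V).1)
      (fderiv ℝ (fourierCn f) p.1.1 V.1) 0 :=
    HasFDerivAt.comp_hasDerivAt_of_eq (0 : ℝ)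
      (hasFDerivAt_fourierCn f p.1.1).1.hasFDerivAt hfst (by simp)
  have h4 : HasDerivAt (fun s : ℝ => nrm (p.1 + s • V).2) V.2 0 := by
    have h5 := ((contDiffAt_nrm p.snd_ne_zero).differentiableAt two_ne_zero).hasFDerivAt
    have h6 := HasFDerivAt.comp_hasDerivAt_of_eq (0 : ℝ) h5 hsnd (by simp)
    rwa [fderiv_nrm h₀ hv] at h6
  have h7 := (((pairing n).hasFDerivAt_of_bilinear h3.hasFDerivAt
    h4.hasFDerivAt).hasDerivAt.const_mul (Real.sqrt (2 * Real.pi) : ℂ))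
  have h8 : (fun s : ℝ => ext (fourierTS (momentum 0 f)) (p.1 + s • V)) =ᶠ[𝓝 0]
      fun s => (Real.sqrt (2 * Real.pi) : ℂ) *
        pairing n (fourierCn f (p.1 + s • V).1) (nrm (p.1 + s • V).2) := by
    have h9 : ∀ᶠ s : ℝ in 𝓝 0, (p.1 + s • V).2 ≠ 0 :=
      hsnd.continuousAt.eventually_ne (by simpa using p.snd_ne_zero)
    filter_upwards [h9] with s hs
    have h10 : ⟪(p.1 + s • V).2, (p.1 + s • V).1⟫_ℝ = 0 := by
      have e1 : (p.1 + s • V).2 = p.1.2 + s • V.2 := rfl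
      have e2 : (p.1 + s • V).1 = p.1.1 + s • -(p.1.1 i • p.1.2) := rfl
      rw [e1, e2, inner_add_left, inner_add_right, inner_add_right, inner_smul_left,
        inner_smul_left, inner_smul_right, inner_smul_right, inner_neg_right, inner_neg_right,
        inner_smul_right, inner_smul_right, real_inner_comm p.1.2 V.2, hv,
        real_inner_comm p.1.1 V.2, hyv, real_inner_comm p.1.1 p.1.2, p.2.2,
        real_inner_self_eq_norm_sq, h₀]
      simp
    simp only [ext, hs, ne_eq, not_false_eq_true, dif_pos, fourierTS_momentum_zero, TS.retract,
      h10, zero_div, zero_smul, sub_zero]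
    rfl
  have h11 := h1.unique (h7.congr_of_eventuallyEq h8)
  rw [h11]
  congr 1
  have hV1 : V.1 = -(p.1.1 i • p.1.2) := rfl
  simp [nrm_of_norm_eq_one h₀, hV1]
  ring

/-- The vector `(u, Ξ_1 u - i y_1 v, …, Ξ_n u - i y_n v)` for the Fourier transforms `u`, `v`
of two functions. -/
def dataVec (φ ψ : TS n → ℂ) (p : TS n) : EuclideanSpace ℂ (Option (Fin n)) :=
  WithLp.toLp 2 fun o => o.elim (fourierTS φ p)
    fun i => Xi i (fourierTS φ) p - Complex.I * (p.1.1 i : ℂ) * fourierTS ψ p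

theorem norm_sq_dataVec (φ ψ : TS n → ℂ) (p : TS n) : ‖dataVec φ ψ p‖ ^ 2 =
    ‖fourierTS φ p‖ ^ 2 +
      ∑ i, ‖Xi i (fourierTS φ) p - Complex.I * (p.1.1 i : ℂ) * fourierTS ψ p‖ ^ 2 := by
  rw [EuclideanSpace.norm_sq_eq, Fintype.sum_option]
  rfl

/-- The terms y_i ⟨∂_ξ f̂, ξ⟩ in Ξ_i u and in i y_i v cancel. Up to √(2π), what remains are the
component P of f̂(y) along ξ and the vector f̂(y) - P ξ orthogonal to it, so the identity is
Pythagoras. -/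
theorem norm_sq_dataVec_momentum (hn : 0 < n) (f : 𝓢(E n, Cn n)) (p : TS n) :
    ‖dataVec (momentum 0 f) (momentum 1 f) p‖ ^ 2 = 2 * Real.pi * ‖fourierCn f p.1.1‖ ^ 2 := by
  set P := pairing n (fourierCn f p.1.1) p.1.2 with hP
  have h1 : ∀ i, Xi i (fourierTS (momentum 0 f)) p -
      Complex.I * (p.1.1 i : ℂ) * fourierTS (momentum 1 f) p =
      (Real.sqrt (2 * Real.pi) : ℂ) * (fourierCn f p.1.1 i - (p.1.2 i : ℂ) * P) := by
    intro i
    have h2 : pairing n (fourierCn f p.1.1) (xiDir i p.1).2 =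
        fourierCn f p.1.1 i - (p.1.2 i : ℂ) * P := by
      rw [xiDir, map_sub, map_smul, Complex.real_smul]
      congr 1
      simp [pairing_apply, apply_ite]
    rw [xi_fourierTS_momentum hn, fourierTS_momentum_one, h2]
    linear_combination (-(p.1.1 i : ℂ) * (Real.sqrt (2 * Real.pi) : ℂ) *
      pairing n (fderiv ℝ (fourierCn f) p.1.1 p.1.2) p.1.2) * Complex.I_mul_I
  rw [norm_sq_dataVec, fourierTS_momentum_zero, EuclideanSpace.norm_sq_eq]
  simp only [h1, norm_mul, mul_pow, ← Finset.mul_sum, Complex.norm_real, Real.norm_eq_abs, sq_abs,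
    Real.sq_sqrt (show (0 : ℝ) ≤ 2 * Real.pi by positivity), ← hP]
  rw [← mul_add]
  congr 1
  have h3 : ∑ i, (p.1.2 i) ^ 2 = 1 := by
    have h4 := EuclideanSpace.real_norm_sq_eq p.1.2
    rw [p.2.1] at h4
    linarith
  have h5 : ∀ i, ‖fourierCn f p.1.1 i - (p.1.2 i : ℂ) * P‖ ^ 2 = ‖fourierCn f p.1.1 i‖ ^ 2 -
      2 * (fourierCn f p.1.1 i * (p.1.2 i : ℂ) * (starRingEnd ℂ) P).re +
        (p.1.2 i) ^ 2 * ‖P‖ ^ 2 := by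
    intro i
    rw [← Complex.normSq_eq_norm_sq, ← Complex.normSq_eq_norm_sq, ← Complex.normSq_eq_norm_sq,
      Complex.normSq_sub, Complex.normSq_mul, Complex.normSq_ofReal, map_mul, Complex.conj_ofReal]
    ring_nf
  simp only [h5, Finset.sum_add_distrib, Finset.sum_sub_distrib, ← Finset.mul_sum, ← Finset.sum_mul,
    h3, one_mul, ← Complex.re_sum]
  have h6 : (∑ i, fourierCn f p.1.1 i * (p.1.2 i : ℂ)) = P := (pairing_apply _ _).symm
  rw [h6, Complex.mul_conj, Complex.ofReal_re, Complex.normSq_eq_norm_sq]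
  ring

end

section

/-! ### Convergence of the integrals -/

open Set Filter Topology FourierTransform
open scoped ENNReal

variable {n : ℕ}

/-- Integrability of `|x|^c (1 + |x|)^{-M}` for `c > -dim V` and large `M`. -/
theorem exists_integrable_rpow_mul_inv {V : Type*} [NormedAddCommGroup V] [NormedSpace ℝ V]
    [MeasurableSpace V] [BorelSpace V] [FiniteDimensional ℝ V] [Nontrivial V] (μ : Measure V)
    [μ.IsAddHaarMeasure] {c : ℝ} (hc : -(Module.finrank ℝ V : ℝ) < c) :
    ∃ M : ℕ, Integrable (fun x : V => ‖x‖ ^ c * ((1 + ‖x‖) ^ M)⁻¹) μ := by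
  set d := Module.finrank ℝ V with hd
  have hd0 : 0 < d := Module.finrank_pos
  obtain ⟨M, hM⟩ := exists_nat_gt (d + c)
  refine ⟨M, ?_⟩
  rw [integrable_fun_norm_addHaar μ (f := fun r : ℝ => r ^ c * ((1 + r) ^ M)⁻¹), ← hd]
  have hexp : ∀ y : ℝ, 0 < y → y ^ (d - 1) * y ^ c = y ^ (d - 1 + c) := fun y hy => by
    rw [Real.rpow_add hy, ← Real.rpow_natCast, Nat.cast_sub hd0, Nat.cast_one]
  have hmeas : Measurable fun y : ℝ => y ^ (d - 1) • (y ^ c * ((1 + y) ^ M)⁻¹) := by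
    fun_prop
  rw [← Ioc_union_Ioi_eq_Ioi (zero_le_one' ℝ)]
  refine IntegrableOn.union ?_ ?_
  · have h1 : IntegrableOn (fun y : ℝ => y ^ (d - 1 + c)) (Ioc 0 1) :=
      (intervalIntegrable_iff_integrableOn_Ioc_of_le zero_le_one).mp
        (intervalIntegral.intervalIntegrable_rpow' (by linarith))
    refine h1.mono' hmeas.aestronglyMeasurable ?_
    refine (ae_restrict_iff' measurableSet_Ioc).mpr (.of_forall fun y hy => ?_)
    have hy0 := hy.1
    rw [Real.norm_of_nonneg (by positivity), smul_eq_mul, ← mul_assoc, hexp y hy0]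
    refine mul_le_of_le_one_right (by positivity) (inv_le_one_of_one_le₀ ?_)
    exact one_le_pow₀ (by linarith)
  · have h1 : IntegrableOn (fun y : ℝ => y ^ (d - 1 + c - M)) (Ioi 1) :=
      integrableOn_Ioi_rpow_of_lt (by linarith) one_pos
    refine h1.mono' hmeas.aestronglyMeasurable ?_
    refine (ae_restrict_iff' measurableSet_Ioi).mpr (.of_forall fun y hy => ?_)
    have hy0 : 0 < y := one_pos.trans hy
    rw [Real.norm_of_nonneg (by positivity), smul_eq_mul, ← mul_assoc, hexp y hy0,
      Real.rpow_sub hy0, Real.rpow_natCast, div_eq_mul_inv]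
    gcongr
    linarith

theorem weight_nonneg (s t : ℝ) (y : E n) : 0 ≤ weight s t y := by
  unfold weight
  positivity

theorem weight_pos (s t : ℝ) {y : E n} (hy : y ≠ 0) : 0 < weight s t y := by
  have := norm_pos_iff.mpr hy
  unfold weight
  positivity

theorem measurable_weight (s t : ℝ) : Measurable (weight s t : E n → ℝ) := by
  unfold weight
  fun_prop

theorem exists_weight_le (s t : ℝ) :
    ∃ K : ℕ, ∀ y : E n, weight s t y ≤ ‖y‖ ^ (2 * t) * (1 + ‖y‖) ^ K := by
  refine ⟨2 * ⌈|s - t|⌉₊, fun y => ?_⟩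
  refine mul_le_mul_of_nonneg_left ?_ (by positivity)
  have h1 : (1 : ℝ) ≤ 1 + ‖y‖ ^ 2 := by simp
  calc (1 + ‖y‖ ^ 2) ^ (s - t) ≤ (1 + ‖y‖ ^ 2) ^ (⌈|s - t|⌉₊ : ℝ) :=
        Real.rpow_le_rpow_of_exponent_le h1 ((le_abs_self _).trans (Nat.le_ceil _))
    _ = (1 + ‖y‖ ^ 2) ^ ⌈|s - t|⌉₊ := Real.rpow_natCast _ _
    _ ≤ ((1 + ‖y‖) ^ 2) ^ ⌈|s - t|⌉₊ := by
        gcongr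
        nlinarith [norm_nonneg y]
    _ = _ := (pow_mul _ _ _).symm

theorem weight_add_half_one (s t : ℝ) {y : E n} (hy : y ≠ 0) :
    weight (s + 1) (t + 1) y = ‖y‖ * weight (s + 1 / 2) (t + 1 / 2) y := by
  have h := norm_pos_iff.mpr hy
  have h1 : 2 * (t + 1) = 1 + 2 * (t + 1 / 2) := by ring
  rw [weight, weight, h1, Real.rpow_add h, Real.rpow_one, mul_assoc]
  ring_nf

theorem weight_add_three_halves (s t : ℝ) {y : E n} (hy : y ≠ 0) :
    weight (s + 3 / 2) (t + 3 / 2) y = ‖y‖ ^ 2 * weight (s + 1 / 2) (t + 1 / 2) y := by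
  have h := norm_pos_iff.mpr hy
  have h1 : 2 * (t + 3 / 2) = (2 : ℕ) + 2 * (t + 1 / 2) := by push_cast; ring
  rw [weight, weight, h1, Real.rpow_add h, Real.rpow_natCast, mul_assoc]
  ring_nf

theorem weight_add_half (s t : ℝ) {y : E n} (hy : y ≠ 0) :
    weight (s + 1 / 2) (t + 1 / 2) y = ‖y‖ * weight s t y := by
  have h := norm_pos_iff.mpr hy
  have h1 : 2 * (t + 1 / 2) = 1 + 2 * t := by ring
  rw [weight, weight, h1, Real.rpow_add h, Real.rpow_one, mul_assoc]
  ring_nf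

/-- Functions on `T S^{n-1}` dominated by a weight times a rapidly decreasing function have
absolutely convergent integrals. -/
theorem tsIntegrable_of_le_weight (hn : 2 ≤ n) {F : TS n → ℂ} (hF : Measurable F) {s t : ℝ}
    (ht : -((n : ℝ) - 1) < 2 * t) {u : TS n → ℝ} (hu : Rapid u)
    (hb : ∀ p, ‖F p‖ ≤ weight s t p.1.1 * ‖u p‖) : TSIntegrable F := by
  have : Nontrivial (EuclideanSpace ℝ (Fin (n - 1))) :=
    Module.nontrivial_of_finrank_pos (R := ℝ) (by simp; omega)
  obtain ⟨K, hK⟩ := exists_weight_le (n := n) s t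
  obtain ⟨M, hM⟩ := exists_integrable_rpow_mul_inv
    (volume : Measure (EuclideanSpace ℝ (Fin (n - 1)))) (c := 2 * t) (by
      rw [finrank_euclideanSpace_fin, Nat.cast_sub (by omega), Nat.cast_one]
      exact ht)
  -- K powers of decay compensate the growth of the weight and M make the remaining power of |y|
  -- integrable at infinity.
  obtain ⟨C, hC⟩ := hu (K + M)
  set g : ℝ → ℝ := fun r => C * (r ^ (2 * t) * ((1 + r) ^ M)⁻¹) with hg
  have hgi := fun ξ : Sph n => integrable_perp_norm ξ (g := g) (hM.const_mul C)
  have hFg : ∀ p : TS n, ‖F p‖ ≤ g ‖p.1.1‖ := fun p => by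
    have h1 : 0 < (1 + ‖p.1.1‖) ^ M := by positivity
    have h2 := hC p
    rw [pow_add] at h2
    calc ‖F p‖ ≤ weight s t p.1.1 * ‖u p‖ := hb p
      _ ≤ ‖p.1.1‖ ^ (2 * t) * (1 + ‖p.1.1‖) ^ K * ‖u p‖ := by
          gcongr
          exact hK _
      _ = ‖p.1.1‖ ^ (2 * t) * ((1 + ‖p.1.1‖) ^ M)⁻¹ *
          ((1 + ‖p.1.1‖) ^ K * (1 + ‖p.1.1‖) ^ M * ‖u p‖) := by
          field_simp
      _ ≤ ‖p.1.1‖ ^ (2 * t) * ((1 + ‖p.1.1‖) ^ M)⁻¹ * C := by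
          gcongr
      _ = g ‖p.1.1‖ := mul_comm _ _
  refine (tsIntegrable_iff hF).mpr ⟨fun ξ => ?_, hF.aestronglyMeasurable, ?_⟩
  · refine (hgi ξ).mono' (hF.comp (TS.continuous_mk ξ).measurable).aestronglyMeasurable
      (.of_forall fun y => hFg _)
  · rw [hasFiniteIntegral_iff_enorm, lintegral_tsMeasure hF.enorm]
    refine lt_of_le_of_lt (lintegral_mono (g := fun _ => ENNReal.ofReal
      (∫ x : EuclideanSpace ℝ (Fin (n - 1)), g ‖x‖)) fun ξ => ?_) ?_
    · dsimp only
      rw [← integral_perp_norm ξ, ofReal_integral_eq_lintegral_ofReal (hgi ξ)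
        (.of_forall fun y => (norm_nonneg _).trans (hFg (TS.mk ξ y)))]
      refine lintegral_mono fun y => ?_
      rw [← ofReal_norm]
      exact ENNReal.ofReal_le_ofReal (hFg (TS.mk ξ y))
    · rw [lintegral_const]
      exact ENNReal.mul_lt_top ENNReal.ofReal_lt_top (measure_lt_top _ _)

theorem Rapid.mul {u v : TS n → ℝ} (hu : Rapid u) (hv : Rapid v) : Rapid fun p => u p * v p := by
  obtain ⟨C, hC⟩ := hu 0
  exact Moderate.mul_rapid ⟨C, 0, fun p => by simpa using hC p⟩ hv

theorem measurable_weight_fst (s t : ℝ) : Measurable fun p : TS n => weight s t p.1.1 :=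
  (measurable_weight s t).comp (measurable_fst.comp measurable_subtype_coe)

theorem measurable_tsIntegrand (s t : ℝ) {u v : TS n → ℂ} (hu : Measurable u)
    (hv : Measurable v) : Measurable (tsIntegrand s t u v) :=
  (Complex.measurable_ofReal.comp (measurable_weight_fst s t)).mul
    (hu.mul (Complex.continuous_conj.measurable.comp hv))

theorem tsIntegrable_tsIntegrand (hn : 2 ≤ n) {s t : ℝ} (ht : -((n : ℝ) - 1) < 2 * t)
    {u v : TS n → ℂ} (hu : Measurable u) (hv : Measurable v) (hu' : Rapid u) (hv' : Rapid v) :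
    TSIntegrable (tsIntegrand s t u v) := by
  refine tsIntegrable_of_le_weight (s := s) hn (measurable_tsIntegrand s t hu hv) ht
    (hu'.norm.mul hv'.norm) fun p => le_of_eq ?_
  simp [tsIntegrand, abs_of_nonneg (weight_nonneg s t p.1.1)]

theorem IsSchwartz.rapid_fourierZ (hn : 0 < n) {φ : TS n → ℂ} (hφ : IsSchwartz φ) :
    Rapid (fourierZ φ) := by
  refine (Rapid.sum Finset.univ (u := fun i p => ‖Xi i (fourierTS φ) p‖) fun i _ => ?_).mono
    fun p => ?_
  · rw [hφ.xi_fourierTS hn]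
    exact ((hφ.xi i).rapid_fourierTS hn).norm
  · rw [Real.norm_of_nonneg (Finset.sum_nonneg fun _ _ => norm_nonneg _), fourierZ]
    refine norm_sum_le_of_le _ fun i _ => ?_
    rw [norm_mul, Complex.norm_real, norm_div, norm_norm]
    exact mul_le_of_le_one_left (norm_nonneg _)
      (div_le_one_of_le₀ (PiLp.norm_apply_le p.1.1 i) (norm_nonneg _))

theorem IsSchwartz.measurable_fourierZ (hn : 0 < n) {φ : TS n → ℂ} (hφ : IsSchwartz φ) :
    Measurable (fourierZ φ) := by
  unfold fourierZ
  refine Finset.measurable_sum _ fun i _ => ?_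
  rw [hφ.xi_fourierTS hn]
  refine Measurable.mul (Complex.measurable_ofReal.comp ?_)
    ((hφ.xi i).continuous_fourierTS hn).measurable
  have h1 : Measurable fun p : TS n => p.1.1 := measurable_fst.comp measurable_subtype_coe
  have h2 : Measurable fun p : TS n => p.1.1 i :=
    (EuclideanSpace.proj i : E n →L[ℝ] ℝ).continuous.measurable.comp h1
  exact h2.div h1.norm

/-- The assumption t > -n/2 means 2(t + 1/2) > -(n - 1), which is local integrability of |y|^{2t+1}
on the (n-1)-dimensional fibres. The other weights carry higher powers of |y| and are milder at 0.
-/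
theorem calHConverges (hn : 2 ≤ n) {s t : ℝ} (ht : -(n : ℝ) / 2 < t) {φ ψ : TS n → ℂ}
    (hφ : IsSchwartz φ) (hψ : IsSchwartz ψ) : CalHConverges s t φ ψ := by
  have hn0 : 0 < n := by omega
  have hφm := (hφ.continuous_fourierTS hn0).measurable
  have hψm := (hψ.continuous_fourierTS hn0).measurable
  have hφr := hφ.rapid_fourierTS hn0
  have hψr := hψ.rapid_fourierTS hn0
  refine ⟨fun i => ?_, ?_, ?_, ?_⟩
  · exact tsIntegrable_tsIntegrand hn (by linarith)
      ((hφ.xi i).continuous_fourierTS hn0).measurable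
      ((hφ.xi i).continuous_fourierTS hn0).measurable
      ((hφ.xi i).rapid_fourierTS hn0) ((hφ.xi i).rapid_fourierTS hn0)
  · exact tsIntegrable_tsIntegrand hn (by linarith) hφm hφm hφr hφr
  · exact tsIntegrable_tsIntegrand hn (by linarith) hψm hψm hψr hψr
  · exact tsIntegrable_tsIntegrand hn (by linarith)
      ((hφ.measurable_fourierZ hn0).const_mul _) hψm
      ((hφ.rapid_fourierZ hn0).mono fun p => by simp) hψr

theorem continuous_fourierCn (f : 𝓢(E n, Cn n)) : Continuous (fourierCn f) :=
  continuous_iff_continuousAt.mpr fun y => (hasFDerivAt_fourierCn f y).1.continuousAt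

theorem fourierCn_decay (f : 𝓢(E n, Cn n)) (N : ℕ) :
    ∃ C : ℝ, ∀ y, (1 + ‖y‖) ^ N * ‖fourierCn f y‖ ≤ C := by
  obtain ⟨C, hC0, hC⟩ := schwartz_decay (𝓕 f) N
  set c : ℝ := (2 * Real.pi) ^ (-(n : ℝ) / 2) with hc
  have hc0 : 0 ≤ c := by positivity
  refine ⟨(2 * Real.pi) ^ N * c * C, fun y => ?_⟩
  have h1 : fourierCn f y = (c : ℂ) • (𝓕 f : 𝓢(E n, Cn n)) ((2 * Real.pi)⁻¹ • y) := fourierCn_eq f y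
  have hp : (0 : ℝ) < 2 * Real.pi := by positivity
  have h2 : 1 + ‖y‖ ≤ 2 * Real.pi * (1 + ‖(2 * Real.pi)⁻¹ • y‖) := by
    rw [norm_smul, norm_inv, Real.norm_of_nonneg hp.le, mul_add, mul_inv_cancel_left₀ hp.ne']
    nlinarith [Real.two_le_pi]
  rw [h1, norm_smul, Complex.norm_real, Real.norm_of_nonneg hc0]
  calc _ ≤ (2 * Real.pi * (1 + ‖(2 * Real.pi)⁻¹ • y‖)) ^ N *
        (c * ‖(𝓕 f : 𝓢(E n, Cn n)) ((2 * Real.pi)⁻¹ • y)‖) := by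
        gcongr
    _ = (2 * Real.pi) ^ N * c * ((1 + ‖(2 * Real.pi)⁻¹ • y‖) ^ N *
        ‖(𝓕 f : 𝓢(E n, Cn n)) ((2 * Real.pi)⁻¹ • y)‖) := by
        rw [mul_pow (2 * Real.pi)]
        ac_rfl
    _ ≤ _ := by
        gcongr
        exact hC _

theorem hstIntegrand_eq (s t : ℝ) (f : 𝓢(E n, Cn n)) (y : E n) :
    hstIntegrand s t f y = weight s t y * ‖fourierCn f y‖ ^ 2 := by
  rw [hstIntegrand, EuclideanSpace.norm_sq_eq]
  simp only [fourierCn_apply (f.integrable (μ := volume))]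

theorem measurable_hstIntegrand (s t : ℝ) (f : 𝓢(E n, Cn n)) :
    Measurable (hstIntegrand s t f) := by
  have h : hstIntegrand s t f = fun y => weight s t y * ‖fourierCn f y‖ ^ 2 :=
    funext (hstIntegrand_eq s t f)
  rw [h]
  exact (measurable_weight s t).mul ((continuous_fourierCn f).measurable.norm.pow_const 2)

theorem integrable_hstIntegrand (hn : 2 ≤ n) {s t : ℝ} (ht : -(n : ℝ) / 2 < t)
    (f : 𝓢(E n, Cn n)) : Integrable (hstIntegrand s t f) := by
  have : Nontrivial (E n) := Module.nontrivial_of_finrank_pos (R := ℝ) (by simp; omega)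
  obtain ⟨K, hK⟩ := exists_weight_le (n := n) s t
  obtain ⟨M, hM⟩ := exists_integrable_rpow_mul_inv (volume : Measure (E n)) (c := 2 * t) (by
      rw [finrank_euclideanSpace_fin]
      linarith)
  obtain ⟨C, hC⟩ := fourierCn_decay f (K + M)
  obtain ⟨D, hD⟩ := fourierCn_decay f 0
  refine (hM.const_mul (C * D)).mono' (measurable_hstIntegrand s t f).aestronglyMeasurable
    (.of_forall fun y => ?_)
  have h0 := weight_nonneg s t y
  rw [hstIntegrand_eq, Real.norm_of_nonneg (by positivity)]
  have h1 : 0 < (1 + ‖y‖) ^ M := by positivity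
  have h2 := hC y
  have h3 := hD y
  rw [pow_add] at h2
  rw [pow_zero, one_mul] at h3
  have hC0 : 0 ≤ C := le_trans (by positivity) h2
  calc _ ≤ ‖y‖ ^ (2 * t) * (1 + ‖y‖) ^ K * ‖fourierCn f y‖ ^ 2 := by
        gcongr
        exact hK _
    _ = ‖y‖ ^ (2 * t) * ((1 + ‖y‖) ^ M)⁻¹ *
          (((1 + ‖y‖) ^ K * (1 + ‖y‖) ^ M * ‖fourierCn f y‖) * ‖fourierCn f y‖) := by
          field_simp
    _ ≤ ‖y‖ ^ (2 * t) * ((1 + ‖y‖) ^ M)⁻¹ * (C * D) := by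
          gcongr
    _ = _ := mul_comm _ _

end

section

/-! ### Identities for the norms -/

open Set Filter Topology
open scoped ENNReal

variable {n : ℕ}

theorem aConst_pos (hn : 2 ≤ n) : 0 < aConst n := by
  have hn2 : (2 : ℝ) ≤ n := by exact_mod_cast hn
  have := Real.Gamma_pos_of_pos (show 0 < ((n : ℝ) - 1) / 2 by linarith)
  rw [aConst]
  positivity

theorem isOpen_slab : IsOpen (slab n) :=
  isOpen_Ioo.preimage (f := fun q : Sph n × E n => ⟪(q.1 : E n), q.2⟫_ℝ) (by fun_prop)

/-- Allows continuous functions on T S^{n-1} that vanish almost everywhere to be recognized as zero.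
A point (y, ξ) of an open set lifts to y + ξ/2 in the open slab. -/
instance tsMeasure.instIsOpenPosMeasure : (tsMeasure n).IsOpenPosMeasure where
  open_pos U hU := by
    rintro ⟨p, hp⟩
    obtain ⟨ξ, y, rfl⟩ := p.exists_mk
    rw [tsMeasure, Measure.map_apply TS.continuous_proj.measurable hU.measurableSet,
      Measure.restrict_apply (TS.continuous_proj.measurable hU.measurableSet)]
    refine ((hU.preimage TS.continuous_proj).inter isOpen_slab).measure_ne_zero _
      ⟨(ξ, (y : E n) + (1 / 2 : ℝ) • (ξ : E n)), ?_, ?_⟩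
    · simpa only [mem_preimage, TS.proj_add_smul] using hp
    · simp only [slab, mem_ofPred_eq, inner_slab]
      norm_num

/-- The integration formula for functions of y alone is applied to the indicator function of {0}. -/
theorem ae_fst_ne_zero (hn : 2 ≤ n) : ∀ᵐ p ∂tsMeasure n, p.1.1 ≠ 0 := by
  have h := lintegral_tsMeasure_fst hn (h := indicator {(0 : E n)} 1)
    (measurable_one.indicator (measurableSet_singleton 0))
  have h1 : ∀ᵐ y : E n, ‖y‖ₑ⁻¹ * indicator {(0 : E n)} 1 y = 0 := by
    have : Nontrivial (E n) := Module.nontrivial_of_finrank_pos (R := ℝ) (by simp; omega)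
    filter_upwards [Measure.ae_ne volume (0 : E n)] with y hy
    simp [hy]
  rw [lintegral_congr_ae h1, lintegral_zero, mul_eq_zero, ENNReal.ofReal_eq_zero,
    lintegral_eq_zero_iff] at h
  · filter_upwards [h.resolve_left (aConst_pos hn).not_ge] with p hp h0
    simp [h0] at hp
  · exact (measurable_one.indicator (measurableSet_singleton 0)).comp
      (measurable_fst.comp measurable_subtype_coe)

theorem tsInner_re {s t : ℝ} {u v : TS n → ℂ} (hu : Measurable u) (hv : Measurable v)
    (h : TSIntegrable (tsIntegrand s t u v)) : (tsInner s t u v).re =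
      1 / (2 * Real.pi) * ∫ p, (tsIntegrand s t u v p).re ∂tsMeasure n := by
  have hm := measurable_tsIntegrand s t hu hv
  have hi := ((tsIntegrable_iff hm).mp h).2
  rw [tsInner, h.tsIntegral_eq hm, Complex.re_ofReal_mul]
  congr 1
  exact (Complex.reCLM.integral_comp_comm hi).symm

theorem tsIntegrand_self_re (s t : ℝ) (u : TS n → ℂ) (p : TS n) :
    (tsIntegrand s t u u p).re = weight s t p.1.1 * ‖u p‖ ^ 2 := by
  rw [tsIntegrand, Complex.re_ofReal_mul, Complex.mul_conj, Complex.ofReal_re,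
    Complex.normSq_eq_norm_sq]

theorem norm_sq_sub_I_mul (a b : ℂ) (c : ℝ) : ‖a - Complex.I * (c : ℂ) * b‖ ^ 2 =
    ‖a‖ ^ 2 + c ^ 2 * ‖b‖ ^ 2 + 2 * (c * (Complex.I * a * (starRingEnd ℂ) b).re) := by
  simp only [← Complex.normSq_eq_norm_sq, Complex.normSq_apply]
  simp
  ring

/-- Expansion of the squares |Ξ_i u - i y_i v|². The terms in |v|² sum to |y|² |v|² and the cross
terms to |y| times the integrand with Z, and these powers of |y| raise the weight by 1 and by 1/2 in
both indices. The cross term of the ℋ-norm is thereby hidden in a sum of squares. -/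
theorem weight_mul_norm_sq_dataVec (s t : ℝ) (φ ψ : TS n → ℂ) {p : TS n} (hp : p.1.1 ≠ 0) :
    weight (s + 1 / 2) (t + 1 / 2) p.1.1 * ‖dataVec φ ψ p‖ ^ 2 =
      (∑ i, weight (s + 1 / 2) (t + 1 / 2) p.1.1 * ‖Xi i (fourierTS φ) p‖ ^ 2) +
      weight (s + 1 / 2) (t + 1 / 2) p.1.1 * ‖fourierTS φ p‖ ^ 2 +
      weight (s + 3 / 2) (t + 3 / 2) p.1.1 * ‖fourierTS ψ p‖ ^ 2 +
      2 * (tsIntegrand (s + 1) (t + 1) (fun p => Complex.I * fourierZ φ p)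
        (fourierTS ψ) p).re := by
  have h0 : ‖p.1.1‖ ≠ 0 := norm_ne_zero_iff.mpr hp
  have h1 : ‖p.1.1‖ * (Complex.I * fourierZ φ p * (starRingEnd ℂ) (fourierTS ψ p)).re =
      ∑ i, p.1.1 i *
        (Complex.I * Xi i (fourierTS φ) p * (starRingEnd ℂ) (fourierTS ψ p)).re := by
    rw [fourierZ, Finset.mul_sum, Finset.sum_mul, Complex.re_sum, Finset.mul_sum]
    refine Finset.sum_congr rfl fun i _ => ?_
    rw [show Complex.I * (((p.1.1 i / ‖p.1.1‖ : ℝ) : ℂ) * Xi i (fourierTS φ) p) *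
      (starRingEnd ℂ) (fourierTS ψ p) = ((p.1.1 i / ‖p.1.1‖ : ℝ) : ℂ) *
        (Complex.I * Xi i (fourierTS φ) p * (starRingEnd ℂ) (fourierTS ψ p)) by ring,
      Complex.re_ofReal_mul]
    field_simp
  have h2 : ∑ i, (p.1.1 i) ^ 2 = ‖p.1.1‖ ^ 2 := (EuclideanSpace.real_norm_sq_eq p.1.1).symm
  rw [norm_sq_dataVec, tsIntegrand, Complex.re_ofReal_mul, weight_add_half_one s t hp,
    weight_add_three_halves s t hp]
  simp only [norm_sq_sub_I_mul, Finset.sum_add_distrib, ← Finset.mul_sum, ← Finset.sum_mul, h2,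
    ← h1]
  ring

section pair

variable {φ ψ : TS n → ℂ}

theorem measurable_dataVec (hn : 0 < n) (hφ : IsSchwartz φ) (hψ : IsSchwartz ψ) :
    Measurable (dataVec φ ψ) := by
  refine (WithLp.measurable_toLp 2 _).comp (measurable_pi_lambda _ fun o => ?_)
  have hψm := (hψ.continuous_fourierTS hn).measurable
  cases o with
  | none => exact (hφ.continuous_fourierTS hn).measurable
  | some i =>
    have h1 : Measurable (Xi i (fourierTS φ)) := by
      rw [hφ.xi_fourierTS hn]
      exact ((hφ.xi i).continuous_fourierTS hn).measurable
    have h2 : Measurable fun p : TS n => p.1.1 i :=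
      (EuclideanSpace.proj i : E n →L[ℝ] ℝ).continuous.measurable.comp
        (measurable_fst.comp measurable_subtype_coe)
    exact h1.sub (((Complex.measurable_ofReal.comp h2).const_mul _).mul hψm)

theorem integral_norm_sq_dataVec (hn : 2 ≤ n) {s t : ℝ} (ht : -(n : ℝ) / 2 < t)
    (hφ : IsSchwartz φ) (hψ : IsSchwartz ψ) :
    Integrable (fun p => weight (s + 1 / 2) (t + 1 / 2) p.1.1 * ‖dataVec φ ψ p‖ ^ 2)
      (tsMeasure n) ∧
    calHNormSq s t φ ψ = aConst n / (2 * Real.pi) *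
      ∫ p, weight (s + 1 / 2) (t + 1 / 2) p.1.1 * ‖dataVec φ ψ p‖ ^ 2 ∂tsMeasure n := by
  have hn0 : 0 < n := by omega
  obtain ⟨c1, c2, c3, c4⟩ := calHConverges hn (s := s) ht hφ hψ
  have hφm := (hφ.continuous_fourierTS hn0).measurable
  have hψm := (hψ.continuous_fourierTS hn0).measurable
  have hxm := fun i => ((hφ.xi i).continuous_fourierTS hn0).measurable
  have hzm := (hφ.measurable_fourierZ hn0).const_mul Complex.I
  have hre : ∀ {s t : ℝ} {u v : TS n → ℂ}, Measurable u → Measurable v →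
      TSIntegrable (tsIntegrand s t u v) →
      Integrable (fun p => (tsIntegrand s t u v p).re) (tsMeasure n) := fun hu hv h =>
    Complex.reCLM.integrable_comp ((tsIntegrable_iff (measurable_tsIntegrand _ _ hu hv)).mp h).2
  have i1 := fun i => hre (hxm i) (hxm i) (c1 i)
  have i2 := hre hφm hφm c2
  have i3 := hre hψm hψm c3
  have i4 := hre hzm hψm c4
  have hae : (fun p => weight (s + 1 / 2) (t + 1 / 2) p.1.1 * ‖dataVec φ ψ p‖ ^ 2)
      =ᵐ[tsMeasure n] fun p =>
      (∑ i, (tsIntegrand (s + 1 / 2) (t + 1 / 2) (fourierTS (Xi i φ)) (fourierTS (Xi i φ)) p).re) +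
      (tsIntegrand (s + 1 / 2) (t + 1 / 2) (fourierTS φ) (fourierTS φ) p).re +
      (tsIntegrand (s + 3 / 2) (t + 3 / 2) (fourierTS ψ) (fourierTS ψ) p).re +
      2 * (tsIntegrand (s + 1) (t + 1) (fun p => Complex.I * fourierZ φ p)
        (fourierTS ψ) p).re := by
    filter_upwards [ae_fst_ne_zero hn] with p hp
    rw [weight_mul_norm_sq_dataVec s t φ ψ hp]
    simp only [tsIntegrand_self_re, hφ.xi_fourierTS hn0]
  have j1 := integrable_finsetSum Finset.univ fun i _ => i1 i
  refine ⟨(((j1.add i2).add i3).add (i4.const_mul 2)).congr hae.symm, ?_⟩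
  rw [integral_congr_ae hae, integral_add (j1.fun_add i2 |>.fun_add i3) (i4.const_mul 2),
    integral_add (j1.fun_add i2) i3, integral_add j1 i2, integral_finsetSum _ fun i _ => i1 i,
    integral_const_mul, calHNormSq]
  simp only [tsNormSq, tsInner_re (hxm _) (hxm _) (c1 _), tsInner_re hφm hφm c2,
    tsInner_re hψm hψm c3, tsInner_re hzm hψm c4, ← Finset.mul_sum]
  ring

/-- If `dataVec` vanishes almost everywhere, then so does û, which is continuous; hence φ = 0. The
remaining components then read y_i v̂ = 0 with y ≠ 0 almost everywhere, which gives ψ = 0. -/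
theorem eq_zero_of_calHNormSq (hn : 2 ≤ n) {s t : ℝ} (ht : -(n : ℝ) / 2 < t)
    (hφ : IsSchwartz φ) (hψ : IsSchwartz ψ) (h : calHNormSq s t φ ψ = 0) : φ = 0 ∧ ψ = 0 := by
  have hn0 : 0 < n := by omega
  obtain ⟨hi, heq⟩ := integral_norm_sq_dataVec hn (s := s) ht hφ hψ
  have ha := aConst_pos hn
  rw [h, eq_comm, mul_eq_zero, or_iff_right (by positivity), integral_eq_zero_iff_of_nonneg
    (fun p => mul_nonneg (weight_nonneg _ _ _) (by positivity)) hi] at heq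
  have h1 : ∀ᵐ p ∂tsMeasure n, dataVec φ ψ p = 0 := by
    filter_upwards [heq, ae_fst_ne_zero hn] with p hp hp0
    have hw := (weight_pos (s + 1 / 2) (t + 1 / 2) hp0).ne'
    simpa using (mul_eq_zero.mp hp).resolve_left hw
  have h2 : φ = 0 := by
    refine hφ.eq_zero_of_fourierTS hn0 fun p => congrFun (((hφ.continuous_fourierTS
      hn0).ae_eq_iff_eq (tsMeasure n) (continuous_const (y := (0 : ℂ)))).mp ?_) p
    filter_upwards [h1] with p hp
    exact congrArg (fun v : EuclideanSpace ℂ (Option (Fin n)) => v none) hp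
  refine ⟨h2, hψ.eq_zero_of_fourierTS hn0 fun p => congrFun (((hψ.continuous_fourierTS
      hn0).ae_eq_iff_eq (tsMeasure n) (continuous_const (y := (0 : ℂ)))).mp ?_) p⟩
  filter_upwards [h1, ae_fst_ne_zero hn] with p hp hp0
  by_contra hv
  apply hp0
  ext i
  have h3 : Xi i (fourierTS φ) p - Complex.I * (p.1.1 i : ℂ) * fourierTS ψ p = 0 :=
    congrArg (fun v : EuclideanSpace ℂ (Option (Fin n)) => v (some i)) hp
  have h4 : Xi i (fourierTS φ) p = 0 := by
    have h5 : ext (fourierTS φ) = fun _ => 0 := by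
      funext q
      simp [ext, fourierTS, h2]
    simp [Xi, h5]
  rw [h4] at h3
  simpa [hv] using h3

end pair

/-- For momentum ray transforms the integrand of the ℋ-norm depends on y alone. The constant 2π
cancels the normalization 1/(2π), and the density 1/|y| cancels the factor |y| by which the weight
with indices shifted by 1/2 exceeds the original one. -/
theorem hstNormSq_eq_calHNormSq (hn : 2 ≤ n) {s t : ℝ} (ht : -(n : ℝ) / 2 < t)
    (f : 𝓢(E n, Cn n)) :
    hstNormSq s t f = calHNormSq s t (momentum 0 f) (momentum 1 f) := by
  have hn0 : 0 < n := by omega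
  have : Nontrivial (E n) := Module.nontrivial_of_finrank_pos (R := ℝ) (by simp; omega)
  set h : E n → ℝ := fun y => weight (s + 1 / 2) (t + 1 / 2) y * ‖fourierCn f y‖ ^ 2 with hh
  have hm : Measurable h :=
    (measurable_weight _ _).mul ((continuous_fourierCn f).measurable.norm.pow_const 2)
  have h0 : ∀ y, 0 ≤ h y := fun y => mul_nonneg (weight_nonneg _ _ _) (by positivity)
  have hm' : Measurable fun p : TS n => h p.1.1 :=
    hm.comp (measurable_fst.comp measurable_subtype_coe)
  have ha := aConst_pos hn
  have h1 : ∀ p : TS n, weight (s + 1 / 2) (t + 1 / 2) p.1.1 *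
      ‖dataVec (momentum 0 f) (momentum 1 f) p‖ ^ 2 = 2 * Real.pi * h p.1.1 := fun p => by
    rw [norm_sq_dataVec_momentum hn0, hh]
    ring
  rw [(integral_norm_sq_dataVec hn ht (isSchwartz_momentum f 0) (isSchwartz_momentum f 1)).2]
  simp only [h1]
  rw [integral_const_mul, ← mul_assoc, div_mul_cancel₀ _ (by positivity),
    integral_eq_lintegral_of_nonneg_ae (.of_forall fun p => h0 _) hm'.aestronglyMeasurable,
    ← ENNReal.toReal_ofReal ha.le, ← ENNReal.toReal_mul,
    lintegral_tsMeasure_fst hn (h := fun y => ENNReal.ofReal (h y)) hm.ennreal_ofReal,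
    hstNormSq, integral_eq_lintegral_of_nonneg_ae (.of_forall fun y => ?_)
      (measurable_hstIntegrand s t f).aestronglyMeasurable]
  · congr 1
    refine lintegral_congr_ae ?_
    filter_upwards [Measure.ae_ne volume (0 : E n)] with y hy
    have hy0 : ‖y‖ₑ ≠ 0 := by simpa using hy
    rw [hstIntegrand_eq, hh]
    simp only
    rw [weight_add_half s t hy, mul_assoc, ENNReal.ofReal_mul (norm_nonneg _), ofReal_norm,
      ← mul_assoc, ENNReal.inv_mul_cancel hy0 enorm_ne_top, one_mul]
  · rw [hstIntegrand_eq]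
    exact mul_nonneg (weight_nonneg _ _ _) (by positivity)

end

section

/-! ### The Hilbert spaces -/

open Set Filter Topology FourierTransform
open scoped ENNReal

variable {n : ℕ}

section generic

variable {V W H : Type*} [AddCommGroup V] [Module ℂ V] [AddCommGroup W] [Module ℂ W]
  [NormedAddCommGroup H] [InnerProductSpace ℂ H]

/-- The inner product obtained by pulling back the one of `H` along an injective linear map. -/
@[reducible]
def pullbackCore (T : V →ₗ[ℂ] H) (hT : ∀ v, T v = 0 → v = 0) : InnerProductSpace.Core ℂ V where
  inner x y := ⟪T x, T y⟫_ℂ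
  conj_inner_symm x y := inner_conj_symm _ _
  re_inner_nonneg x := inner_self_nonneg
  add_left x y z := by rw [map_add, inner_add_left]
  smul_left x y r := by rw [map_smul, inner_smul_left]
  definite x hx := hT x (inner_self_eq_zero.mp hx)

theorem norm_preHilbert (c : InnerProductSpace.Core ℂ V) (v : PreHilbert c) :
    ‖v‖ = Real.sqrt (c.inner v v).re := rfl

/-- Linear maps preserving inner products extend uniquely to isometries of the completions. -/
theorem existsUnique_extension (c : InnerProductSpace.Core ℂ V) (d : InnerProductSpace.Core ℂ W)
    (M : V →ₗ[ℂ] W) (hM : ∀ v, d.inner (M v) (M v) = c.inner v v) :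
    ∃! L : HilbertCompletion c →ₗᵢ[ℂ] HilbertCompletion d,
      (∀ v, L (toCompletion c v) = toCompletion d (M v)) ∧ ∀ F, ‖F‖ = ‖L F‖ := by
  let M' : PreHilbert c →ₗᵢ[ℂ] PreHilbert d :=
    { toLinearMap := M
      norm_map' := fun v => by
        rw [norm_preHilbert, norm_preHilbert]
        exact congrArg (fun z : ℂ => Real.sqrt z.re) (hM v) }
  let e : PreHilbert c →L[ℂ] HilbertCompletion c := UniformSpace.Completion.toComplL
  let g : PreHilbert c →L[ℂ] HilbertCompletion d :=
    (UniformSpace.Completion.toComplₗᵢ.comp M').toContinuousLinearMap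
  have he : DenseRange e := UniformSpace.Completion.denseRange_coe
  have hu : IsUniformInducing e := UniformSpace.Completion.isUniformInducing_coe _
  have hext : ∀ v, g.extend e (e v) = g v := ContinuousLinearMap.extend_eq g he hu
  have hnorm : ∀ F, ‖g.extend e F‖ = ‖F‖ := fun F =>
    isClosed_property he (isClosed_eq (g.extend e).continuous.norm continuous_norm) (fun v => by
      rw [hext]
      exact ((UniformSpace.Completion.toComplₗᵢ (𝕜 := ℂ).comp M').norm_map v).trans
        (UniformSpace.Completion.norm_coe v).symm) F
  refine ⟨⟨(g.extend e).toLinearMap, hnorm⟩, ⟨hext, fun F => (hnorm F).symm⟩, fun L hL => ?_⟩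
  ext F
  exact congrFun (he.equalizer L.continuous (g.extend e).continuous
    (funext fun v => (hL.1 v).trans (hext v).symm)) F

end generic

section weighted

variable {α G V : Type*} [MeasurableSpace α] {μ : Measure α} [NormedAddCommGroup G]
  [InnerProductSpace ℂ G] [AddCommGroup V] [Module ℂ V]

/-- The linear map `v ↦ √ρ D v` into the space of square integrable functions. -/
def weightedToLp (D : V →ₗ[ℂ] α → G) (ρ : α → ℝ)
    (h : ∀ v, MemLp (fun p => (Real.sqrt (ρ p) : ℂ) • D v p) 2 μ) : V →ₗ[ℂ] Lp G 2 μ where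
  toFun v := (h v).toLp
  map_add' v w := by
    rw [← MemLp.toLp_add]
    congr 1
    funext p
    simp
  map_smul' c v := by
    rw [RingHom.id_apply, ← MemLp.toLp_const_smul]
    congr 1
    funext p
    change _ = c • (Real.sqrt (ρ p) : ℂ) • D v p
    rw [map_smul, Pi.smul_apply, smul_comm]

theorem norm_sq_sqrt_smul {a : ℝ} (ha : 0 ≤ a) (x : G) :
    ‖(Real.sqrt a : ℂ) • x‖ ^ 2 = a * ‖x‖ ^ 2 := by
  rw [norm_smul, Complex.norm_real, mul_pow, Real.norm_eq_abs, sq_abs, Real.sq_sqrt ha]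

theorem inner_weightedToLp_self (D : V →ₗ[ℂ] α → G) {ρ : α → ℝ} (hρ : ∀ p, 0 ≤ ρ p)
    (h : ∀ v, MemLp (fun p => (Real.sqrt (ρ p) : ℂ) • D v p) 2 μ) (v : V) :
    ⟪weightedToLp D ρ h v, weightedToLp D ρ h v⟫_ℂ = ((∫ p, ρ p * ‖D v p‖ ^ 2 ∂μ : ℝ) : ℂ) := by
  rw [L2.inner_def, ← integral_complex_ofReal]
  refine integral_congr_ae ?_
  filter_upwards [(h v).coeFn_toLp] with p hp
  change ⟪MemLp.toLp _ (h v) p, MemLp.toLp _ (h v) p⟫_ℂ = _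
  rw [hp, inner_self_eq_norm_sq_to_K, ← norm_sq_sqrt_smul (hρ p)]
  push_cast
  rfl

theorem memLp_sqrt_smul {u : α → G} {ρ : α → ℝ} (hρ : ∀ p, 0 ≤ ρ p) (hm : Measurable ρ)
    (hu : AEStronglyMeasurable u μ) (hi : Integrable (fun p => ρ p * ‖u p‖ ^ 2) μ) :
    MemLp (fun p => (Real.sqrt (ρ p) : ℂ) • u p) 2 μ := by
  rw [memLp_two_iff_integrable_sq_norm]
  · simpa only [norm_sq_sqrt_smul (hρ _)] using hi
  · exact (Complex.measurable_ofReal.comp hm.sqrt).aestronglyMeasurable.smul hu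

end weighted

/-- The Fourier transform of Schwartz vector fields as a linear map. -/
def fourierCnMap (n : ℕ) : 𝓢(E n, Cn n) →ₗ[ℂ] E n → Cn n where
  toFun f := fourierCn f
  map_add' f g := by
    funext y
    have hf := integrable_phase_smul (f.integrable (μ := volume)) y
    have hg := integrable_phase_smul (g.integrable (μ := volume)) y
    rw [Pi.add_apply, fourierCn, fourierCn, fourierCn, ← smul_add, ← integral_add hf hg]
    simp
  map_smul' c f := by
    funext y
    rw [Pi.smul_apply, fourierCn, fourierCn, RingHom.id_apply, smul_comm c]
    congr 1
    rw [← integral_smul c]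
    exact integral_congr_ae (.of_forall fun x => smul_comm _ c (f x))

theorem fourierTS_add (hn : 0 < n) {φ ψ : TS n → ℂ} (hφ : IsSchwartz φ) (hψ : IsSchwartz ψ) :
    fourierTS (φ + ψ) = fourierTS φ + fourierTS ψ := by
  have h : ∀ {φ : TS n → ℂ}, IsSchwartz φ → ∀ p : TS n, Integrable fun x : perp (p.base : E n) =>
      Complex.exp (-Complex.I * (⟪p.1.1, (x : E n)⟫_ℝ : ℂ)) * φ (TS.mk p.base x) := fun hφ p => by
    refine (hφ.integrable_fibre hn p.base).norm.mono' ?_ (.of_forall fun z => ?_)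
    · exact (Continuous.aestronglyMeasurable (by fun_prop)).mul
        (hφ.integrable_fibre hn p.base).aestronglyMeasurable
    · rw [norm_mul, norm_phase, one_mul]
  funext p
  rw [Pi.add_apply, fourierTS, fourierTS, fourierTS, ← mul_add, ← integral_add (h hφ p) (h hψ p)]
  simp only [Pi.add_apply, mul_add]

theorem fourierTS_smul (c : ℂ) (φ : TS n → ℂ) : fourierTS (c • φ) = c • fourierTS φ := by
  funext p
  rw [Pi.smul_apply, fourierTS, fourierTS, smul_eq_mul, mul_left_comm c]
  congr 1
  rw [← integral_const_mul c]
  exact integral_congr_ae (.of_forall fun x => mul_left_comm _ c _)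

/-- The map `(φ, ψ) ↦ dataVec φ ψ` as a linear map. -/
def dataVecMap (hn : 0 < n) : SchwartzTS n × SchwartzTS n →ₗ[ℂ]
    TS n → EuclideanSpace ℂ (Option (Fin n)) where
  toFun q := dataVec q.1.1 q.2.1
  map_add' q r := by
    have h1 : fourierTS (q + r).1.1 = fourierTS q.1.1 + fourierTS r.1.1 :=
      fourierTS_add hn q.1.2 r.1.2
    have h2 : fourierTS (q + r).2.1 = fourierTS q.2.1 + fourierTS r.2.1 :=
      fourierTS_add hn q.2.2 r.2.2
    have h3 : ∀ i p, Xi i (fourierTS q.1.1 + fourierTS r.1.1) p =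
        Xi i (fourierTS q.1.1) p + Xi i (fourierTS r.1.1) p := fun i p => by
      rw [Xi, ext_add, fderiv_add (IsSchwartz.differentiableAt_fourierTS hn q.1.2 p)
        (IsSchwartz.differentiableAt_fourierTS hn r.1.2 p)]
      rfl
    funext p
    ext o
    cases o with
    | none => exact congrFun h1 p
    | some i =>
      simp only [dataVec, h1, h2, Option.elim_some, Pi.add_apply, PiLp.add_apply, h3]
      ring
  map_smul' c q := by
    have h1 : fourierTS (c • q).1.1 = c • fourierTS q.1.1 := fourierTS_smul c q.1.1
    have h2 : fourierTS (c • q).2.1 = c • fourierTS q.2.1 := fourierTS_smul c q.2.1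
    have h3 : ∀ i p, Xi i (c • fourierTS q.1.1) p = c • Xi i (fourierTS q.1.1) p := fun i p => by
      rw [Xi, ext_smul, fderiv_const_smul (IsSchwartz.differentiableAt_fourierTS hn q.1.2 p)]
      rfl
    funext p
    ext o
    cases o with
    | none => exact congrFun h1 p
    | some i =>
      simp only [dataVec, h1, h2, Option.elim_some, Pi.smul_apply, PiLp.smul_apply, h3,
        RingHom.id_apply, smul_eq_mul]
      ring

/-- The weight is positive away from 0, so the continuous function f̂ vanishes identically, and
Fourier inversion applies. -/
theorem eq_zero_of_hstNormSq (hn : 2 ≤ n) {s t : ℝ} (ht : -(n : ℝ) / 2 < t) (f : 𝓢(E n, Cn n))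
    (h : hstNormSq s t f = 0) : f = 0 := by
  have : Nontrivial (E n) := Module.nontrivial_of_finrank_pos (R := ℝ) (by simp; omega)
  rw [hstNormSq, integral_eq_zero_iff_of_nonneg (fun y => ?_) (integrable_hstIntegrand hn ht f)] at h
  · have h1 : fourierCn f = fun _ => 0 := by
      refine ((continuous_fourierCn f).ae_eq_iff_eq volume continuous_const).mp ?_
      filter_upwards [h, Measure.ae_ne volume (0 : E n)] with y hy hy0
      rw [hstIntegrand_eq] at hy
      simpa using (mul_eq_zero.mp hy).resolve_left (weight_pos s t hy0).ne'
    have h2 : (𝓕 f : 𝓢(E n, Cn n)) = 0 := by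
      ext1 z
      have hp : (2 * Real.pi) ≠ 0 := by positivity
      have h3 := fourierCn_eq f ((2 * Real.pi) • z)
      rw [h1, inv_smul_smul₀ hp, eq_comm, smul_eq_zero, Complex.ofReal_eq_zero,
        or_iff_right (by positivity)] at h3
      exact h3
    have h4 : 𝓕⁻ (𝓕 f : 𝓢(E n, Cn n)) = f := FourierPair.fourierInv_fourier_eq f
    rw [← h4, h2, FourierTransform.fourierInv_zero]
  · rw [hstIntegrand_eq]
    exact mul_nonneg (weight_nonneg _ _ _) (by positivity)

theorem calHNormSq_pos (hn : 2 ≤ n) {s t : ℝ} (ht : -(n : ℝ) / 2 < t) {φ ψ : TS n → ℂ}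
    (hφ : IsSchwartz φ) (hψ : IsSchwartz ψ) (h : ¬(φ = 0 ∧ ψ = 0)) : 0 < calHNormSq s t φ ψ := by
  refine lt_of_le_of_ne ?_ fun h0 => h (eq_zero_of_calHNormSq hn ht hφ hψ h0.symm)
  have ha := aConst_pos hn
  rw [(integral_norm_sq_dataVec hn ht hφ hψ).2]
  exact mul_nonneg (by positivity)
    (integral_nonneg fun p => mul_nonneg (weight_nonneg _ _ _) (by positivity))

/-- The inner product is pulled back from L² along f ↦ √weight · f̂, so only linearity, square
integrability and injectivity need proof. -/
theorem exists_core_hst (hn : 2 ≤ n) (s : ℝ) {t : ℝ} (ht : -(n : ℝ) / 2 < t) :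
    ∃ c : InnerProductSpace.Core ℂ 𝓢(E n, Cn n), ∀ f, c.inner f f = (hstNormSq s t f : ℂ) := by
  have hL : ∀ f : 𝓢(E n, Cn n),
      MemLp (fun y => (Real.sqrt (weight s t y) : ℂ) • fourierCnMap n f y) 2 volume := fun f =>
    memLp_sqrt_smul (weight_nonneg s t) (measurable_weight s t)
      (continuous_fourierCn f).aestronglyMeasurable
      ((integrable_hstIntegrand hn ht f).congr (.of_forall (hstIntegrand_eq s t f)))
  have hT : ∀ f, ⟪weightedToLp (fourierCnMap n) (weight s t) hL f,
      weightedToLp (fourierCnMap n) (weight s t) hL f⟫_ℂ = (hstNormSq s t f : ℂ) := fun f => by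
    rw [inner_weightedToLp_self _ (weight_nonneg s t), hstNormSq]
    exact congrArg _ (integral_congr_ae (.of_forall fun y => (hstIntegrand_eq s t f y).symm))
  refine ⟨pullbackCore (weightedToLp (fourierCnMap n) (weight s t) hL) fun f hf => eq_zero_of_hstNormSq hn ht (s := s) f ?_, hT⟩
  have h1 := hT f
  rw [hf, inner_zero_left] at h1
  exact_mod_cast h1.symm

/-- The same pullback along `dataVec`, which is linear in (φ, ψ), with the constant a_n/(2π)
included in the density. No polarization of the explicit formula for the norm is required. -/
theorem exists_core_calH (hn : 2 ≤ n) (s : ℝ) {t : ℝ} (ht : -(n : ℝ) / 2 < t) :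
    ∃ d : InnerProductSpace.Core ℂ (SchwartzTS n × SchwartzTS n),
      ∀ q, d.inner q q = (calHNormSq s t q.1.1 q.2.1 : ℂ) := by
  have hn0 : 0 < n := by omega
  have ha := aConst_pos hn
  set ρ : TS n → ℝ := fun p =>
    aConst n / (2 * Real.pi) * weight (s + 1 / 2) (t + 1 / 2) p.1.1 with hρ
  have hρ0 : ∀ p, 0 ≤ ρ p := fun p => mul_nonneg (by positivity) (weight_nonneg _ _ _)
  have hL : ∀ q, MemLp (fun p => (Real.sqrt (ρ p) : ℂ) • dataVecMap hn0 q p) 2 (tsMeasure n) :=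
    fun q => by
    refine memLp_sqrt_smul hρ0 ((measurable_weight_fst _ _).const_mul _)
      (measurable_dataVec hn0 q.1.2 q.2.2).aestronglyMeasurable ?_
    have h := (integral_norm_sq_dataVec hn (s := s) ht q.1.2 q.2.2).1.const_mul
      (aConst n / (2 * Real.pi))
    simp only [← mul_assoc] at h
    exact h
  have hT : ∀ q, ⟪weightedToLp (dataVecMap hn0) ρ hL q, weightedToLp (dataVecMap hn0) ρ hL q⟫_ℂ =
      (calHNormSq s t q.1.1 q.2.1 : ℂ) := fun q => by
    rw [inner_weightedToLp_self _ hρ0, (integral_norm_sq_dataVec hn ht q.1.2 q.2.2).2,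
      ← integral_const_mul]
    simp only [hρ, mul_assoc]
    rfl
  refine ⟨pullbackCore (weightedToLp (dataVecMap hn0) ρ hL) fun q hq => ?_, hT⟩
  have h1 := hT q
  rw [hq, inner_zero_left] at h1
  have h2 := eq_zero_of_calHNormSq hn ht (s := s) q.1.2 q.2.2 (by exact_mod_cast h1.symm)
  exact Prod.ext (Subtype.ext h2.1) (Subtype.ext h2.2)

end

end MomentumRay

end

theorem mainTheorem5 (n : ℕ) (hn : 2 ≤ n) (s t : ℝ) (ht : -(n : ℝ) / 2 < t) :
    -- all integrals in the squared norms converge, and the norms are positive definite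
    (∀ f : 𝓢(MomentumRay.E n, MomentumRay.Cn n),
      MeasureTheory.Integrable (MomentumRay.hstIntegrand s t f)) ∧
    (∀ φ ψ : MomentumRay.SchwartzTS n, MomentumRay.CalHConverges s t φ.1 ψ.1) ∧
    (∀ φ ψ : MomentumRay.SchwartzTS n, (φ, ψ) ≠ (0, 0) →
      0 < MomentumRay.calHNormSq s t φ.1 ψ.1) ∧
    -- both squared norms come from inner products `c` and `d`
    ∃ (c : InnerProductSpace.Core ℂ 𝓢(MomentumRay.E n, MomentumRay.Cn n))
      (d : InnerProductSpace.Core ℂ (MomentumRay.SchwartzTS n × MomentumRay.SchwartzTS n)),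
      (∀ f, c.inner f f = (MomentumRay.hstNormSq s t f : ℂ)) ∧
      (∀ p, d.inner p p = (MomentumRay.calHNormSq s t p.1.1 p.2.1 : ℂ)) ∧
      -- `f ↦ (I⁰ f, I¹ f)` is a linear map between the Schwartz spaces
      ∃ M : 𝓢(MomentumRay.E n, MomentumRay.Cn n) →ₗ[ℂ]
          MomentumRay.SchwartzTS n × MomentumRay.SchwartzTS n,
        (∀ f, (M f).1.1 = MomentumRay.momentum 0 f ∧ (M f).2.1 = MomentumRay.momentum 1 f) ∧
        -- `M` extends (uniquely) to a linear isometric embedding of the completions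
        ∃! L : MomentumRay.HilbertCompletion c →ₗᵢ[ℂ] MomentumRay.HilbertCompletion d,
          (∀ f, L (MomentumRay.toCompletion c f) = MomentumRay.toCompletion d (M f)) ∧
          ∀ F, ‖F‖ = ‖L F‖ := by
  obtain ⟨c, hc⟩ := MomentumRay.exists_core_hst hn s ht
  obtain ⟨d, hd⟩ := MomentumRay.exists_core_calH hn s ht
  refine ⟨fun f => MomentumRay.integrable_hstIntegrand hn ht f,
    fun φ ψ => MomentumRay.calHConverges hn ht φ.2 ψ.2,
    fun φ ψ h => MomentumRay.calHNormSq_pos hn ht φ.2 ψ.2 fun h0 => h ?_,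
    c, d, hc, hd, MomentumRay.momentumMap n, fun f => ⟨rfl, rfl⟩,
    MomentumRay.existsUnique_extension c d (MomentumRay.momentumMap n) fun f => ?_⟩
  · exact Prod.ext (Subtype.ext h0.1) (Subtype.ext h0.2)
  · rw [hc, hd, MomentumRay.hstNormSq_eq_calHNormSq hn ht f]
    rfl
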